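/- A $3$-triangulation is a finite collection of tetrahedra together with affine gluings of some of their triangular faces in pairs (two faces of the same tetrahedron may be glued); the unglued faces are its boundary faces, and, glued along their common boundary edges, they form its boundary $2$-triangulation. Let $\mathcal T$ be a one-vertex $3$-triangulation of a compact orientable $3$-manifold whose boundary is a single closed surface of genus $g$ (so $g\ge 1$). Let $\gamma_1,\dots,\gamma_g$ be resolved filling petals: boundary edges of $\mathcal T$ (hence loops at the vertex) whose intersections at the vertex are pairwise non-crossing, such that the $g$ disjoint simple closed curves obtained from them by a small perturbation do not separate $\partial\mathcal T$. Assume that $\gamma_1,\dots,\gamma_g$ are diagonals of mutually disjoint quadrilaterals, each formed by two distinct boundary faces. The Wedge-Folder is the following routine. (1) Layer over each petal $\gamma_k$: attach a new tetrahedron $\Delta_k$ to $\partial\mathcal T$ by gluing two of its faces to the two boundary faces adjacent to $\gamma_k$, so that the common edge of these two faces of $\Delta_k$ is identified with $\gamma_k$. (2) For each $k$, fold along $\gamma_k$: glue the two remaining boundary faces of $\Delta_k$ to each other by the affine map that fixes their common edge (the edge introduced by the layering). Assume that each petal is given together with its two adjacent boundary faces, and that adding a tetrahedron and introducing a face gluing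 each take constant time. Then the Wedge-Folder terminates in $O(g)$ time, with an absolute implied constant, every layering and fold being possible when it is performed, and it adds exactly $g$ new tetrahedra (via layering). Upon termination the result is again a one-vertex $3$-triangulation, and: (a) the link of its vertex is a (connected, orientable) surface of genus $0$, possibly with boundary; (b) if $g\ge 2$, the remaining boundary faces form a pinched $2$-sphere: the boundary $2$-triangulation is a $2$-sphere that is immersed in the underlying space of the $3$-triangulation (a $3$-manifold away from the vertex), is embedded away from its vertices, and has all its vertices mapped to the single vertex of the $3$-triangulation, where its sheets do not cross: they are the cones over distinct boundary circles of the vertex link, of which there are at least two. If $g=1$, no boundary faces remain. -/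

import Mathlib

open Equiv

/-! ### Triangulations -/

/-- Gluing data in dimension `d`: a finite collection `cells` of `d`-simplices, each with vertices
labelled by `Fin (d + 1)`, and for each facet (named by the vertex opposite to it) either nothing
(`none`, an unglued facet) or the simplex it is glued to together with the affine gluing map.
If `glue t i = some (t', π)`, then the facet of `t` opposite `i` is glued to the facet of `t'`
opposite `π i`, and for `j ≠ i` the vertex `j` of `t` goes to the vertex `π j` of `t'`. -/
structure GluingData (d : ℕ) (ι : Type) where
  cells : Finset ι
  glue : ι → Fin (d + 1) → Option (ι × Perm (Fin (d + 1)))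

namespace GluingData

variable {d : ℕ} {ι : Type}

/-- The gluing data describe a (generalised) triangulation: facets of members of the collection
are glued in pairs, and no facet is glued to itself. -/
def IsTriangulation (T : GluingData d ι) : Prop :=
  ∀ t i t' π, T.glue t i = some (t', π) →
    t ∈ T.cells ∧ t' ∈ T.cells ∧ T.glue t' (π i) = some (t, π⁻¹) ∧ (t', π i) ≠ (t, i)

/-- Every facet is glued. -/
def IsClosed (T : GluingData d ι) : Prop :=
  ∀ t ∈ T.cells, ∀ i, T.glue t i ≠ none

/-- Non-empty, and any two simplices are joined by a chain of gluings. -/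
def IsConnected (T : GluingData d ι) : Prop :=
  T.cells.Nonempty ∧ ∀ t ∈ T.cells, ∀ t' ∈ T.cells,
    Relation.ReflTransGen (fun s s' => ∃ i π, T.glue s i = some (s', π)) t t'

/-- The simplices can be oriented so that all gluings reverse the orientations induced on facets;
for a gluing map extended to all vertices as above, this means that the permutation is odd
exactly when it relates two simplices with the same sign. -/
def IsOrientable (T : GluingData d ι) : Prop :=
  ∃ o : ι → ℤˣ, ∀ t i t' π, T.glue t i = some (t', π) → o t' = -Perm.sign π * o t

/-- The vertices of the triangulation: vertices of simplices up to identification. -/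
def Vertex (T : GluingData d ι) : Type :=
  Quot (fun p q : {p : ι × Fin (d + 1) // p.1 ∈ T.cells} =>
    ∃ i π, i ≠ p.1.2 ∧ T.glue p.1.1 i = some (q.1.1, π) ∧ q.1.2 = π p.1.2)

/-- The facets of the triangulation: facets of simplices up to identification. -/
def Facet (T : GluingData d ι) : Type :=
  Quot (fun p q : {p : ι × Fin (d + 1) // p.1 ∈ T.cells} =>
    ∃ π, T.glue p.1.1 p.1.2 = some (q.1.1, π) ∧ q.1.2 = π p.1.2)

/-- An edge of a simplex, with a direction: `(t, a, b)` runs from the vertex `a` of `t` to `b`. -/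
def DirectedSide (T : GluingData d ι) : Type :=
  {p : ι × Fin (d + 1) × Fin (d + 1) // p.1 ∈ T.cells ∧ p.2.1 ≠ p.2.2}

/-- The directed edges of the triangulation: directed edges of simplices up to identification. -/
def DirectedEdge (T : GluingData d ι) : Type :=
  Quot (fun p q : T.DirectedSide =>
    ∃ i π, i ≠ p.1.2.1 ∧ i ≠ p.1.2.2 ∧ T.glue p.1.1 i = some (q.1.1, π) ∧
      q.1.2.1 = π p.1.2.1 ∧ q.1.2.2 = π p.1.2.2)

/-- The same edge of a simplex with the opposite direction. -/
def DirectedSide.reverse {T : GluingData d ι} (p : T.DirectedSide) : T.DirectedSide :=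
  ⟨(p.1.1, p.1.2.2, p.1.2.1), p.2.1, p.2.2.symm⟩

/-- The directed edge of the triangulation represented by a directed edge of a simplex. -/
def edgeOf (T : GluingData d ι) (p : T.DirectedSide) : T.DirectedEdge := Quot.mk _ p

/-- The vertex of the triangulation represented by a vertex of a simplex. -/
def vertexOf (T : GluingData d ι) (p : {p : ι × Fin (d + 1) // p.1 ∈ T.cells}) : T.Vertex :=
  Quot.mk _ p

/-- There is exactly one vertex. -/
def OneVertex (T : GluingData d ι) : Prop := Nat.card T.Vertex = 1

/-- No edge is identified with itself in reverse. -/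
def EdgesValid (T : GluingData d ι) : Prop :=
  ∀ p : T.DirectedSide, T.edgeOf p ≠ T.edgeOf p.reverse

/-! ### Surfaces -/

/-- The unglued edges of the triangles of a 2-triangulation. -/
def FreeSide (S : GluingData 2 ι) : Type :=
  {p : ι × Fin 3 // p.1 ∈ S.cells ∧ S.glue p.1 p.2 = none}

/-- The boundary circles of a triangulated surface: the unglued edges, where two of them belong to
the same circle if they can be joined by a chain in which successive edges share a vertex. -/
def BoundaryCircle (S : GluingData 2 ι) : Type :=
  Quot (fun p q : S.FreeSide =>
    ∃ a b : Fin 3, a ≠ p.1.2 ∧ b ≠ q.1.2 ∧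
      S.vertexOf ⟨(p.1.1, a), p.2.1⟩ = S.vertexOf ⟨(q.1.1, b), q.2.1⟩)

/-- The boundary circle containing an unglued edge. -/
def circleOf (S : GluingData 2 ι) (p : S.FreeSide) : S.BoundaryCircle := Quot.mk _ p

/-- Vertices minus edges plus triangles. -/
noncomputable def eulerChar (S : GluingData 2 ι) : ℤ :=
  (Nat.card S.Vertex : ℤ) - (Nat.card S.Facet : ℤ) + (S.cells.card : ℤ)

/-- `S` triangulates a connected orientable surface of genus `g`, possibly with boundary. -/
def IsSurfaceOfGenus (S : GluingData 2 ι) (g : ℕ) : Prop :=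
  S.IsTriangulation ∧ S.IsConnected ∧ S.IsOrientable ∧
    S.eulerChar = 2 - 2 * (g : ℤ) - (Nat.card S.BoundaryCircle : ℤ)

/-- `S` triangulates a disc. -/
def IsDisc (S : GluingData 2 ι) : Prop :=
  S.IsSurfaceOfGenus 0 ∧ Nat.card S.BoundaryCircle = 1

/-- `S` triangulates a 2-sphere. -/
def IsSphere (S : GluingData 2 ι) : Prop :=
  S.IsSurfaceOfGenus 0 ∧ S.IsClosed

/-! ### The vertex link and the boundary of a 3-triangulation -/

/-- A permutation `π` of `Fin 4` restricts to a bijection from the complement of `i` to the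
complement of `π i`; here both complements are relabelled by `Fin 3` in increasing order. -/
def restrictPerm (i : Fin 4) (π : Perm (Fin 4)) : Perm (Fin 3) :=
  (finSuccAboveEquiv i).trans
    ((π.subtypeEquiv (fun a => (π.injective.ne_iff (x := a) (y := i)).symm)).trans
      (finSuccAboveEquiv (π i)).symm)

/-- The vertex link. Its triangles are the pairs `(t, i)`: the triangle cutting off the vertex `i`
of the tetrahedron `t`. The corner `s` of this triangle lies on the edge from `i` to
`i.succAbove s`; the side opposite this corner lies in the face opposite `i.succAbove s`, and
sides are glued as the faces containing them are. For a one-vertex triangulation this is the link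
of the vertex (in general, it is the disjoint union of all vertex links). -/
def link (T : GluingData 3 ι) : GluingData 2 (ι × Fin 4) where
  cells := T.cells ×ˢ Finset.univ
  glue := fun f s =>
    (T.glue f.1 (f.2.succAbove s)).map fun r => ((r.1, r.2 f.2), restrictPerm f.2 r.2)

/-- Rotation around an edge, starting from a face containing it (opposite the vertex `i`, with `k`
the vertex of that face which is not on the edge), passing through tetrahedra until an
unglued face is met. The permutation `ρ` carries the original labels to those of the current
tetrahedron: `ρ i` is opposite the current face, `ρ k` is the vertex of the current face that is
not on the edge, and the two ends of the edge go to the two ends of the edge. The first argument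
bounds the number of tetrahedra visited. -/
def edgeWalk (T : GluingData 3 ι) (i k : Fin 4) :
    ℕ → ι → Perm (Fin 4) → Option (ι × Perm (Fin 4))
  | 0, _, _ => none
  | m + 1, t, ρ =>
    match T.glue t (ρ k) with
    | none => some (t, ρ * swap i k)
    | some (t', π) => edgeWalk T i k m t' (π * ρ * swap i k)

/-- The unglued face on the other side of a boundary edge. The walk does not visit the same
position twice, and there are fewer than `24 * #tetrahedra` positions. -/
def acrossEdge (T : GluingData 3 ι) (t : ι) (i k : Fin 4) : Option (ι × Perm (Fin 4)) :=
  T.edgeWalk i k (24 * T.cells.card) t 1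

/-- The boundary 2-triangulation of a 3-triangulation. Its triangles are the unglued faces
`(t, i)`, the corner `s` of such a triangle being the vertex `i.succAbove s` of `t`. Two sides
are glued if they are the two boundary sides of one edge, found by rotating around this edge. -/
def boundary [DecidableEq ι] (T : GluingData 3 ι) : GluingData 2 (ι × Fin 4) where
  cells := (T.cells ×ˢ Finset.univ).filter fun f => T.glue f.1 f.2 = none
  glue := fun f s =>
    if f.1 ∈ T.cells ∧ T.glue f.1 f.2 = none then
      (T.acrossEdge f.1 f.2 (f.2.succAbove s)).map
        fun r => ((r.1, r.2 f.2), restrictPerm f.2 r.2)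
    else none

/-- `T` is a one-vertex triangulation of a compact orientable 3-manifold whose boundary is one
closed surface of genus `g`. -/
structure IsOneVertexManifold [DecidableEq ι] (T : GluingData 3 ι) (g : ℕ) : Prop where
  isTriangulation : T.IsTriangulation
  oneVertex : T.OneVertex
  edgesValid : T.EdgesValid
  orientable : T.IsOrientable
  link_disc : T.link.IsDisc
  boundary_closed : T.boundary.IsClosed
  boundary_genus : T.boundary.IsSurfaceOfGenus g

/-- A directed side of a boundary triangle, as a directed edge of a tetrahedron. -/
def boundarySide [DecidableEq ι] (T : GluingData 3 ι) (p : T.boundary.DirectedSide) :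
    T.DirectedSide :=
  ⟨(p.1.1.1, p.1.1.2.succAbove p.1.2.1, p.1.1.2.succAbove p.1.2.2),
    (Finset.mem_product.1 (Finset.mem_filter.1 p.2.1).1).1,
    fun h => p.2.2 (Fin.succAbove_right_injective h)⟩

/-- The boundary faces of a one-vertex 3-triangulation `T` form a 2-sphere that is pinched at the
vertex: the boundary 2-triangulation is a 2-sphere; the space of `T` is a 3-manifold away from the
vertex; distinct edges of the boundary 2-triangulation are distinct edges of `T`, so that the sphere
is embedded away from the vertex; and the sheets of the sphere at the vertex are the cones over
distinct, hence disjoint, boundary circles of the vertex link, of which there are at least two, so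
the sheets do not cross. In the last field, the arc near the corner `a` of a boundary triangle
`(t, i)` is the unglued side, lying in the face opposite `i`, of the triangle
`(t, i.succAbove a)` of the link. -/
structure HasPinchedSphereBoundary [DecidableEq ι] (T : GluingData 3 ι) : Prop where
  oneVertex : T.OneVertex
  edgesValid : T.EdgesValid
  sphere : T.boundary.IsSphere
  edges_injective : ∀ p q : T.boundary.DirectedSide,
    T.edgeOf (T.boundarySide p) = T.edgeOf (T.boundarySide q) →
      T.boundary.edgeOf p = T.boundary.edgeOf q
  two_le_circles : 2 ≤ Nat.card T.link.BoundaryCircle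
  sheets : ∀ (p q : {p : (ι × Fin 4) × Fin 3 // p.1 ∈ T.boundary.cells}) (x y : T.link.FreeSide),
    x.1.1 = (p.1.1.1, p.1.1.2.succAbove p.1.2) → x.1.1.2.succAbove x.1.2 = p.1.1.2 →
    y.1.1 = (q.1.1.1, q.1.1.2.succAbove q.1.2) → y.1.1.2.succAbove y.1.2 = q.1.1.2 →
      (T.boundary.vertexOf p = T.boundary.vertexOf q ↔ T.link.circleOf x = T.link.circleOf y)

end GluingData

/-! ### Boundary edges and filling petals -/

/-- An edge together with two faces on either side of it. The edge runs from the vertex `σ₁ 0` to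
the vertex `σ₁ 1` of the tetrahedron `t₁`; the first face has `σ₁ 2` as its third vertex and is
opposite `σ₁ 3`. Likewise for the second face, with the same edge in the same direction. -/
structure EdgeRef where
  t₁ : ℕ
  σ₁ : Perm (Fin 4)
  t₂ : ℕ
  σ₂ : Perm (Fin 4)

namespace EdgeRef

/-- The first of the two faces. -/
def face₁ (e : EdgeRef) : ℕ × Fin 4 := (e.t₁, e.σ₁ 3)

/-- The second of the two faces. -/
def face₂ (e : EdgeRef) : ℕ × Fin 4 := (e.t₂, e.σ₂ 3)

/-- The side of the triangle `f` opposite its corner `s` is `e`, seen from one of its faces. -/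
def IsSide (e : EdgeRef) (f : ℕ × Fin 4) (s : Fin 3) : Prop :=
  (f = e.face₁ ∧ f.2.succAbove s = e.σ₁ 2) ∨ (f = e.face₂ ∧ f.2.succAbove s = e.σ₂ 2)

/-- `e` is a boundary edge of `T` and is the diagonal of a quadrilateral formed by two distinct
boundary faces, which are the ones recorded in `e`. -/
def IsDiagonal (e : EdgeRef) (T : GluingData 3 ℕ) : Prop :=
  e.t₁ ∈ T.cells ∧ e.t₂ ∈ T.cells ∧
  T.glue e.t₁ (e.σ₁ 3) = none ∧ T.glue e.t₂ (e.σ₂ 3) = none ∧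
  T.acrossEdge e.t₁ (e.σ₁ 3) (e.σ₁ 2) = some (e.t₂, e.σ₂ * e.σ₁⁻¹) ∧
  e.face₁ ≠ e.face₂

instance (e : EdgeRef) (T : GluingData 3 ℕ) : Decidable (e.IsDiagonal T) := by
  unfold IsDiagonal
  infer_instance

end EdgeRef

/-- The corners `c` and `c'` of triangles of `S`, seen as arcs in the link of a vertex of `S`, can
be joined in this link without crossing an end of the edge whose sides are given by `cut`. If this
link is a circle and the edge is a loop at the vertex, this says that `c` and `c'` are on the same
side of the loop, near the vertex. -/
def SameSide {ι : Type} (S : GluingData 2 ι) (cut : ι → Fin 3 → Prop) (c c' : ι × Fin 3) : Prop :=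
  Relation.ReflTransGen (fun x y : ι × Fin 3 => ∃ s π, s ≠ x.2 ∧ ¬ cut x.1 s ∧
    S.glue x.1 s = some (y.1, π) ∧ y.2 = π x.2) c c'

/-- The edges `P 0, …, P (g - 1)` of the one-vertex boundary of `T` are resolved filling petals
forming diagonals of mutually disjoint quadrilaterals. -/
structure IsIsolatedFillingBouquet {g : ℕ} (T : GluingData 3 ℕ) (P : Fin g → EdgeRef) : Prop where
  /-- Each petal is the diagonal of a quadrilateral in the boundary. -/
  diagonal : ∀ k, (P k).IsDiagonal T
  /-- The quadrilaterals are mutually disjoint. -/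
  disjoint : ∀ k l, k ≠ l →
    Disjoint ({(P k).face₁, (P k).face₂} : Finset (ℕ × Fin 4)) {(P l).face₁, (P l).face₂}
  /-- Two petals do not cross at the vertex: the two ends of one are on the same side of the
  other. -/
  noncrossing : ∀ k l, k ≠ l → ∀ a b : Fin 3,
    (P l).face₁.2.succAbove a = (P l).σ₁ 0 → (P l).face₁.2.succAbove b = (P l).σ₁ 1 →
      SameSide T.boundary (P k).IsSide ((P l).face₁, a) ((P l).face₁, b)
  /-- After the petals are pushed off each other near the vertex, their union does not separate
  the boundary: any two triangles are joined by a chain in which successive triangles either share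
  a side that is not a petal, or have corners which no petal separates near the vertex. -/
  nonseparating : ∀ f ∈ T.boundary.cells, ∀ f' ∈ T.boundary.cells,
    Relation.ReflTransGen (fun x y =>
      (∃ s π, (∀ k, ¬ (P k).IsSide x s) ∧ T.boundary.glue x s = some (y, π)) ∨
      (∃ a b : Fin 3, ∀ k, SameSide T.boundary (P k).IsSide (x, a) (y, b))) f f'

/-! ### The routine and its running time -/

/-- A routine working on a 3-triangulation held in memory. A run either aborts (`none`), or ends with
a result, the new triangulation and the number of elementary steps performed. -/
def Routine (α : Type) : Type := GluingData 3 ℕ → Option (α × GluingData 3 ℕ × ℕ)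

namespace Routine

/-- Sequential composition adds the numbers of steps. -/
instance : Monad Routine where
  pure a := fun T => some (a, T, 0)
  bind x f := fun T =>
    (x T).bind fun r => (f r.1 r.2.1).map fun r' => (r'.1, r'.2.1, r.2.2 + r'.2.2)

/-- An elementary step of control (passing to the next item of a list, or finding it exhausted). -/
def tick : Routine Unit := fun T => some ((), T, 1)

/-- A precondition. It is not part of the computation; the run aborts if the condition fails. -/
def require (p : GluingData 3 ℕ → Prop) [DecidablePred p] : Routine Unit :=
  fun T => if p T then some ((), T, 0) else none

/-- Add a new tetrahedron, with all faces unglued, and return its name. One step. -/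
def addTet : Routine ℕ := fun T =>
  some (T.cells.sup (· + 1), ⟨insert (T.cells.sup (· + 1)) T.cells, T.glue⟩, 1)

/-- Glue the face of `t` opposite `i` to the face of `t'` opposite `π i`, by the map `π`. One step.
The run aborts unless these are distinct unglued faces. -/
def glueFaces (t : ℕ) (i : Fin 4) (t' : ℕ) (π : Perm (Fin 4)) : Routine Unit := fun T =>
  if t ∈ T.cells ∧ t' ∈ T.cells ∧ T.glue t i = none ∧ T.glue t' (π i) = none ∧
      (t', π i) ≠ (t, i) then
    some ((), ⟨T.cells, fun s j =>
      if (s, j) = (t, i) then some (t', π)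
      else if (s, j) = (t', π i) then some (t, π⁻¹)
      else T.glue s j⟩, 1)
  else none

/-- Layer a new tetrahedron over the boundary edge `e`: the edge `01` of the new tetrahedron is
identified with `e`, its face `012` with the first face at `e`, and its face `013` with the second.
Return the new tetrahedron. -/
def layer (e : EdgeRef) : Routine ℕ := do
  require fun T => e.IsDiagonal T
  let t ← addTet
  glueFaces e.t₁ (e.σ₁ 3) t e.σ₁⁻¹
  glueFaces e.t₂ (e.σ₂ 3) t (swap 2 3 * e.σ₂⁻¹)
  pure t

/-- Fold across the boundary edge `e`: identify the two boundary faces at `e` with each other by the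
map fixing `e`. -/
def fold (e : EdgeRef) : Routine Unit := do
  require fun T => e.IsDiagonal T
  glueFaces e.t₁ (e.σ₁ 3) e.t₂ (e.σ₂ * e.σ₁⁻¹)

/-- The edge `23` of the tetrahedron `t`, with its faces `123` and `023` on either side: the boundary
edge introduced by layering `t`. -/
def newEdge (t : ℕ) : EdgeRef where
  t₁ := t
  σ₁ := swap 0 2 * swap 1 3 * swap 2 3
  t₂ := t
  σ₂ := swap 0 2 * swap 1 3

/-- Layer over each edge in a list; return the list of new tetrahedra. -/
def layerAll : List EdgeRef → Routine (List ℕ)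
  | [] => do
    tick
    pure []
  | e :: es => do
    tick
    let t ← layer e
    let ts ← layerAll es
    pure (t :: ts)

/-- For each tetrahedron in a list of layered tetrahedra, fold across the edge it introduced. -/
def foldAll : List ℕ → Routine Unit
  | [] => tick
  | t :: ts => do
    tick
    fold (newEdge t)
    foldAll ts

/-- The Wedge-Folder: layer over each filling petal, then fold along each filling petal, which has
become an off-diagonal, by folding across the edge introduced by the layering. -/
def wedgeFolder (petals : List EdgeRef) : Routine Unit := do
  let ts ← layerAll petals
  foldAll ts

end Routine

namespace GluingData

variable {ι : Type}

/-! ### Edges and flags of a 3-triangulation -/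

/-! Both genus claims are Euler characteristic computations, and the only delicate terms are numbers
of vertices. These are found by counting `ZMod 2`-valued functions. A vertex of the link is a
directed edge of the triangulation, so the group `edgeFun` of functions on directed edges has order
`2 ^ V`, with `V` the number of link vertices. A corner of a boundary triangle is an unglued side of
a link triangle, so vertices of the boundary surface correspond to boundary circles of the link
(`card_link_boundaryCircle`).

Layering over a petal and folding has this effect on old edges: in each of the `2g` boundary
triangles at the petals, the two sides other than the petal become identified, with directions
towards the apex (`sameEdge_apexEdge`). Edge functions after folding are therefore the functions in
the kernel of `linkDiff`, together with two free values for each new edge, one per direction. If `g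
≥ 2`, the `4g` conditions are independent and `V` drops by `4g - 2g = 2g`. If `g = 1`, the two
triangles at the petal are the whole torus, each condition for one triangle repeats one for the
other, the rank is `2`, and `V` is unchanged.

The topology of the petals enters through side functions. The corners of the one-vertex boundary
form a single cycle around the vertex. A petal `k` cuts this cycle into two arcs, and `u k` is the
indicator of one of them. A function on corners that is unchanged across non-petal sides and jumps
by `ε k` across petal `k` equals `∑ ε k * u k` up to a constant (`IsSideFunctions.add_sum_eq`). This
has two consequences. Together with non-separation, it shows that any two boundary triangles are
joined by crossing non-petal sides only (`reachable`). Together with non-crossing, it shows that the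
functions on the vertices of the new boundary are exactly `c₀ + ∑ δ k * u k`. The new boundary thus
has `g + 1` vertices. With its `2g - 2` triangles and `3g - 3` edges it has Euler characteristic
`2`, and the link has genus `0` with `g + 1` circles.

For `g ≥ 2` some triangle lies outside all quadrilaterals, and `reachable` lets statements about
sides spread from such triangles over all non-petal sides (`plain_induction`). This yields
surjectivity of `linkDiff`. Surjectivity also gives `IsWedgeFolding.edgesValid`: an arbitrary
direction of the edges can be corrected so that the folds respect it. Without valid edges a boundary
side could be glued to itself. Connectedness of the new boundary comes from a similar argument along
the paths of `reachable`. -/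

theorem succAbove_restrictPerm (i : Fin 4) (π : Perm (Fin 4)) (s : Fin 3) :
    (π i).succAbove (restrictPerm i π s) = π (i.succAbove s) := by
  have h : finSuccAboveEquiv (π i) (restrictPerm i π s) =
      (π.subtypeEquiv (fun a => (π.injective.ne_iff (x := a) (y := i)).symm))
        (finSuccAboveEquiv i s) := by
    simp [restrictPerm]
  simpa [finSuccAboveEquiv] using congrArg Subtype.val h

/-- Relabelling the complement of `i` in increasing order costs the sign `(-1) ^ i`, as in the
simplicial boundary operator. For this reason `o t * (-1) ^ i` orients both the link and the
boundary. -/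
theorem sign_restrictPerm (i : Fin 4) (π : Perm (Fin 4)) :
    Perm.sign (restrictPerm i π) = Perm.sign π * (-1) ^ (i.val + (π i).val) := by
  revert i π
  decide +kernel

theorem exists_perm_of_ne {a b c e : Fin 4} (hab : a ≠ b) (hac : a ≠ c) (hae : a ≠ e) (hbc : b ≠ c)
    (hbe : b ≠ e) (hce : c ≠ e) : ∃ ρ : Perm (Fin 4), ρ 0 = a ∧ ρ 1 = b ∧ ρ 2 = c ∧ ρ 3 = e := by
  revert a b c e
  decide +kernel

theorem perm_eq_or_eq_mul_swap {ρ τ : Perm (Fin 4)} (h0 : ρ 0 = τ 0) (h1 : ρ 1 = τ 1) :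
    τ = ρ ∨ τ = ρ * swap 2 3 := by
  have h : τ 2 = ρ 2 ∨ τ 2 = ρ 3 := by
    obtain ⟨j, hj⟩ := ρ.surjective (τ 2)
    fin_cases j
    · exact absurd (τ.injective (h0.symm.trans hj)) (by decide)
    · exact absurd (τ.injective (h1.symm.trans hj)) (by decide)
    · exact Or.inl hj.symm
    · exact Or.inr hj.symm
  have h' : τ 3 = ρ 2 ∨ τ 3 = ρ 3 := by
    obtain ⟨j, hj⟩ := ρ.surjective (τ 3)
    fin_cases j
    · exact absurd (τ.injective (h0.symm.trans hj)) (by decide)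
    · exact absurd (τ.injective (h1.symm.trans hj)) (by decide)
    · exact Or.inl hj.symm
    · exact Or.inr hj.symm
  have h23 : τ 2 ≠ τ 3 := fun h => absurd (τ.injective h) (by decide)
  rcases h with h | h <;> rcases h' with h' | h'
  · exact absurd (h.trans h'.symm) h23
  · left
    ext j
    fin_cases j <;> simp [h0, h1, h, h']
  · right
    ext j
    fin_cases j <;> simp [h0, h1, h, h', swap_apply_of_ne_of_ne]
  · exact absurd (h.trans h'.symm) h23

/-- Passing from a directed edge of a tetrahedron to the one it is glued to across a face. -/
def EdgeStep (T : GluingData 3 ι) (x y : ι × Fin 4 × Fin 4) : Prop :=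
  x.2.1 ≠ x.2.2 ∧ ∃ i π, i ≠ x.2.1 ∧ i ≠ x.2.2 ∧ T.glue x.1 i = some (y.1, π) ∧
    y.2.1 = π x.2.1 ∧ y.2.2 = π x.2.2

/-- Two directed edges of tetrahedra represent the same directed edge of the triangulation. -/
def SameEdge (T : GluingData 3 ι) : ι × Fin 4 × Fin 4 → ι × Fin 4 × Fin 4 → Prop :=
  Relation.EqvGen T.EdgeStep

theorem SameEdge.refl {T : GluingData 3 ι} (x) : T.SameEdge x x := Relation.EqvGen.refl x

theorem SameEdge.symm {T : GluingData 3 ι} {x y} (h : T.SameEdge x y) : T.SameEdge y x :=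
  Relation.EqvGen.symm _ _ h

theorem SameEdge.trans {T : GluingData 3 ι} {x y z} (h : T.SameEdge x y) (h' : T.SameEdge y z) :
    T.SameEdge x z := Relation.EqvGen.trans _ _ _ h h'

theorem EdgeStep.sameEdge {T : GluingData 3 ι} {x y} (h : T.EdgeStep x y) : T.SameEdge x y :=
  Relation.EqvGen.rel _ _ h

theorem SameEdge.apply_eq {T : GluingData 3 ι} {α : Sort*} {F : ι × Fin 4 × Fin 4 → α}
    (hF : ∀ x y, T.EdgeStep x y → F x = F y) {x y} (h : T.SameEdge x y) : F x = F y := by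
  induction h with
  | rel x y h => exact hF x y h
  | refl x => rfl
  | symm x y _ ih => exact ih.symm
  | trans x y z _ _ ih ih' => exact ih.trans ih'

/-- The directed edge of a tetrahedron with the opposite direction. -/
def revEdge (x : ι × Fin 4 × Fin 4) : ι × Fin 4 × Fin 4 := (x.1, x.2.2, x.2.1)

theorem EdgeStep.revEdge {T : GluingData 3 ι} {x y} (h : T.EdgeStep x y) :
    T.EdgeStep (revEdge x) (revEdge y) := by
  obtain ⟨h, i, π, h1, h2, h3, h4, h5⟩ := h
  exact ⟨h.symm, i, π, h2, h1, h3, h5, h4⟩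

theorem SameEdge.revEdge {T : GluingData 3 ι} {x y} (h : T.SameEdge x y) :
    T.SameEdge (revEdge x) (revEdge y) := by
  induction h with
  | rel x y h => exact h.revEdge.sameEdge
  | refl x => exact .refl _
  | symm x y _ ih => exact ih.symm
  | trans x y z _ _ ih ih' => exact ih.trans ih'

/-- A directed edge of a member of the collection. -/
def IsEdge (T : GluingData 3 ι) (x : ι × Fin 4 × Fin 4) : Prop := x.1 ∈ T.cells ∧ x.2.1 ≠ x.2.2

theorem EdgeStep.isEdge {T : GluingData 3 ι} (hT : T.IsTriangulation) {x y} (h : T.EdgeStep x y) :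
    T.IsEdge x ∧ T.IsEdge y := by
  obtain ⟨h, i, π, h1, h2, h3, h4, h5⟩ := h
  obtain ⟨a, b, -⟩ := hT _ _ _ _ h3
  exact ⟨⟨a, h⟩, b, by rw [h4, h5]; exact π.injective.ne h⟩

theorem SameEdge.isEdge_iff {T : GluingData 3 ι} (hT : T.IsTriangulation) {x y}
    (h : T.SameEdge x y) : T.IsEdge x ↔ T.IsEdge y :=
  iff_of_eq <| h.apply_eq fun _ _ h => propext
    ⟨fun _ => (h.isEdge hT).2, fun _ => (h.isEdge hT).1⟩

/-- The flag `(t, ρ)` consists of the directed edge from `ρ 0` to `ρ 1` of `t` and the face opposite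
`ρ 3` containing it. This is the flag with the other face. -/
def flip (x : ι × Perm (Fin 4)) : ι × Perm (Fin 4) := (x.1, x.2 * swap 2 3)

/-- The directed edge of a flag. -/
def flagEdge (x : ι × Perm (Fin 4)) : ι × Fin 4 × Fin 4 := (x.1, x.2 0, x.2 1)

/-- The flag with the reversed edge and the same face. -/
def revFlag (x : ι × Perm (Fin 4)) : ι × Perm (Fin 4) := (x.1, x.2 * swap 0 1)

/-- The flag glued to a given one along its face. -/
def cross (T : GluingData 3 ι) (x : ι × Perm (Fin 4)) : Option (ι × Perm (Fin 4)) :=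
  (T.glue x.1 (x.2 3)).map fun r => (r.1, r.2 * x.2)

/-- The flags of a triangulation whose face is not glued. -/
def IsFree (T : GluingData 3 ι) (x : ι × Perm (Fin 4)) : Prop :=
  x.1 ∈ T.cells ∧ T.glue x.1 (x.2 3) = none

theorem flip_flip (x : ι × Perm (Fin 4)) : flip (flip x) = x := by
  simp [flip, mul_assoc]

theorem flagEdge_flip (x : ι × Perm (Fin 4)) : flagEdge (flip x) = flagEdge x := by
  simp [flip, flagEdge, swap_apply_of_ne_of_ne]

theorem flagEdge_revFlag (x : ι × Perm (Fin 4)) : flagEdge (revFlag x) = revEdge (flagEdge x) := by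
  simp [revFlag, revEdge, flagEdge]

theorem IsFree.isEdge {T : GluingData 3 ι} {x : ι × Perm (Fin 4)} (h : T.IsFree x) :
    T.IsEdge (flagEdge x) :=
  ⟨h.1, x.2.injective.ne (by decide)⟩

theorem cross_eq_none {T : GluingData 3 ι} {x : ι × Perm (Fin 4)} :
    T.cross x = none ↔ T.glue x.1 (x.2 3) = none := by
  simp [cross]

theorem cross_eq_some {T : GluingData 3 ι} {x y : ι × Perm (Fin 4)} :
    T.cross x = some y ↔ T.glue x.1 (x.2 3) = some (y.1, y.2 * x.2⁻¹) := by
  unfold cross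
  constructor
  · intro h
    obtain ⟨r, hr, rfl⟩ := Option.map_eq_some_iff.1 h
    simp [hr]
  · intro h
    simp [h]

theorem cross_symm {T : GluingData 3 ι} (hT : T.IsTriangulation) {x y : ι × Perm (Fin 4)}
    (h : T.cross x = some y) : T.cross y = some x := by
  rw [cross_eq_some] at h ⊢
  have := (hT _ _ _ _ h).2.2.1
  simpa using this

theorem edgeStep_of_cross {T : GluingData 3 ι} {x y : ι × Perm (Fin 4)} (h : T.cross x = some y) :
    T.EdgeStep (flagEdge x) (flagEdge y) := by
  rw [cross_eq_some] at h
  exact ⟨x.2.injective.ne (by decide), x.2 3, _, x.2.injective.ne (by decide),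
    x.2.injective.ne (by decide), h, by simp [flagEdge], by simp [flagEdge]⟩

theorem cross_mem {T : GluingData 3 ι} (hT : T.IsTriangulation) {x y : ι × Perm (Fin 4)}
    (h : T.cross x = some y) : x.1 ∈ T.cells ∧ y.1 ∈ T.cells := by
  rw [cross_eq_some] at h
  exact ⟨(hT _ _ _ _ h).1, (hT _ _ _ _ h).2.1⟩

/-! ### Rotation around an edge -/

/-- Rotation around the edge of a flag until an unglued face is met. -/
def flagWalk (T : GluingData 3 ι) : ℕ → ι × Perm (Fin 4) → Option (ι × Perm (Fin 4))
  | 0, _ => none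
  | m + 1, x =>
    match T.cross (flip x) with
    | none => some (flip x)
    | some y => flagWalk T m y

/-- The unglued flag on the other side of the edge of an unglued flag. -/
def across (T : GluingData 3 ι) (x : ι × Perm (Fin 4)) : Option (ι × Perm (Fin 4)) :=
  T.flagWalk (24 * T.cells.card) x

/-- `edgeWalk` records positions relative to the labels of the first tetrahedron, whereas a flag is
an absolute position. Right multiplication by the starting flag `τ` turns `swap i k` into `swap 2
3`, that is, into `flip`. -/
theorem edgeWalk_eq (T : GluingData 3 ι) (τ : Perm (Fin 4)) (m : ℕ) (t : ι) (ρ : Perm (Fin 4)) :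
    T.edgeWalk (τ 3) (τ 2) m t ρ = (T.flagWalk m (t, ρ * τ)).map fun y => (y.1, y.2 * τ⁻¹) := by
  induction m generalizing t ρ with
  | zero => rfl
  | succ m ih =>
    have h3 : (ρ * τ * swap 2 3 : Perm (Fin 4)) 3 = ρ (τ 2) := by simp
    have hs : ρ * swap (τ 3) (τ 2) * τ = ρ * τ * swap 2 3 := by
      rw [swap_comm, mul_assoc, ← mul_swap_eq_swap_mul, mul_assoc]
    have hc : T.cross (flip (t, ρ * τ)) =
        (T.glue t (ρ (τ 2))).map fun r => (r.1, r.2 * ρ * swap (τ 3) (τ 2) * τ) := by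
      simp only [cross, flip, h3]
      congr 1
      funext r
      rw [mul_assoc r.2, mul_assoc r.2, hs]
    rw [edgeWalk, flagWalk, hc]
    cases h : T.glue t (ρ (τ 2)) with
    | none => simp [flip, ← hs]
    | some r => exact ih _ _

theorem acrossEdge_eq (T : GluingData 3 ι) (x : ι × Perm (Fin 4)) :
    T.acrossEdge x.1 (x.2 3) (x.2 2) = (T.across x).map fun y => (y.1, y.2 * x.2⁻¹) := by
  simp [acrossEdge, across, edgeWalk_eq]

theorem acrossEdge_eq_some {T : GluingData 3 ι} {x y : ι × Perm (Fin 4)} :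
    T.acrossEdge x.1 (x.2 3) (x.2 2) = some (y.1, y.2 * x.2⁻¹) ↔ T.across x = some y := by
  rw [acrossEdge_eq, Option.map_eq_some_iff]
  constructor
  · rintro ⟨z, hz, h⟩
    obtain rfl : z = y := by simpa [Prod.ext_iff] using h
    exact hz
  · exact fun h => ⟨y, h, rfl⟩

/-- `z` is obtained from `x` by passing through some tetrahedra around the edge. -/
def Rotates (T : GluingData 3 ι) : ι × Perm (Fin 4) → ι × Perm (Fin 4) → Prop :=
  Relation.ReflTransGen fun y z => T.cross (flip y) = some z

theorem exists_rotates_of_flagWalk {T : GluingData 3 ι} {m : ℕ} {x r : ι × Perm (Fin 4)}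
    (h : T.flagWalk m x = some r) : ∃ z, T.Rotates x z ∧ T.cross (flip z) = none ∧ r = flip z := by
  induction m generalizing x with
  | zero => simp [flagWalk] at h
  | succ m ih =>
    rw [flagWalk] at h
    split at h
    · next h' => exact ⟨x, .refl, h', by simpa using h.symm⟩
    · next y h' =>
      obtain ⟨z, hz, h1, h2⟩ := ih h
      exact ⟨z, .head h' hz, h1, h2⟩

theorem flagWalk_eq_of_rotates {T : GluingData 3 ι} {m : ℕ} {x z r : ι × Perm (Fin 4)}
    (hz : T.Rotates x z) (h : T.cross (flip z) = none) (hr : T.flagWalk m x = some r) :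
    r = flip z := by
  induction hz using Relation.ReflTransGen.head_induction_on generalizing m with
  | refl =>
    cases m with
    | zero => simp [flagWalk] at hr
    | succ m => simpa [flagWalk, h] using hr.symm
  | head h' _ ih =>
    cases m with
    | zero => simp [flagWalk] at hr
    | succ m => exact ih (m := m) (by simpa [flagWalk, h'] using hr)

theorem Rotates.sameEdge {T : GluingData 3 ι} {x z : ι × Perm (Fin 4)} (h : T.Rotates x z) :
    T.SameEdge (flagEdge x) (flagEdge z) := by
  induction h with
  | refl => exact .refl _
  | tail _ h ih =>
    have := (edgeStep_of_cross h).sameEdge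
    rw [flagEdge_flip] at this
    exact ih.trans this

theorem Rotates.mem {T : GluingData 3 ι} (hT : T.IsTriangulation) {x z : ι × Perm (Fin 4)}
    (h : T.Rotates x z) (hx : x.1 ∈ T.cells) : z.1 ∈ T.cells := by
  induction h with
  | refl => exact hx
  | tail _ h ih => exact (cross_mem hT h).2

/-- `V` is the set of flags already visited. Gluings are symmetric, so a flag has at most one
predecessor. By `hpred`, re-entering `insert x V` from `x` would put `x` in `V`. Hence the walk
never repeats, and it must stop because there are only `24 * T.cells.card` flags. -/
theorem isSome_flagWalk {T : GluingData 3 ι} [DecidableEq ι] (hT : T.IsTriangulation) (m : ℕ)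
    (V : Finset (ι × Perm (Fin 4))) (x : ι × Perm (Fin 4)) (hV : V ⊆ T.cells ×ˢ Finset.univ)
    (hx : x.1 ∈ T.cells) (hxV : x ∉ V)
    (hpred : ∀ y z, T.cross (flip y) = some z → z ∈ insert x V → y ∈ V)
    (hm : 24 * T.cells.card ≤ V.card + m) : (T.flagWalk m x).isSome := by
  have hins : insert x V ⊆ T.cells ×ˢ Finset.univ :=
    Finset.insert_subset (by simp [hx]) hV
  induction m generalizing V x with
  | zero =>
    have := Finset.card_le_card hins
    rw [Finset.card_insert_of_notMem hxV, Finset.card_product, Finset.card_univ,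
      Fintype.card_perm, Fintype.card_fin] at this
    simp only [Nat.factorial] at this
    omega
  | succ m ih =>
    rw [flagWalk]
    split
    · rfl
    · next y hy =>
      have hyV : y ∉ insert x V := fun h => hxV (hpred _ _ hy h)
      refine ih (insert x V) y hins (cross_mem hT hy).2 hyV ?_ ?_ ?_
      · intro a b hab hb
        rcases Finset.mem_insert.1 hb with rfl | hb
        · have h1 := cross_symm hT hab
          rw [cross_symm hT hy] at h1
          have : a = x := by
            rw [← flip_flip a, ← flip_flip x, Option.some.inj h1]
          simp [this]
        · exact Finset.mem_insert_of_mem (hpred _ _ hab hb)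
      · rw [Finset.card_insert_of_notMem hxV]
        omega
      · exact Finset.insert_subset (by simp [(cross_mem hT hy).2]) hins

theorem exists_across {T : GluingData 3 ι} (hT : T.IsTriangulation) {x : ι × Perm (Fin 4)}
    (hx : T.IsFree x) : ∃ y, T.across x = some y := by
  classical
  rw [← Option.isSome_iff_exists]
  -- An unglued flag has no predecessor, so the walk can start with nothing visited.
  refine isSome_flagWalk hT _ ∅ x (by simp) hx.1 (by simp) ?_ (by simp)
  intro y z h hz
  obtain rfl : z = x := by simpa using hz
  have := cross_symm hT h
  rw [cross_eq_none.2 hx.2] at this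
  cases this

theorem across_spec {T : GluingData 3 ι} (hT : T.IsTriangulation) {x y : ι × Perm (Fin 4)}
    (hx : T.IsFree x) (h : T.across x = some y) :
    T.IsFree y ∧ T.SameEdge (flagEdge x) (flagEdge y) := by
  obtain ⟨z, hz, h1, rfl⟩ := exists_rotates_of_flagWalk h
  exact ⟨⟨hz.mem hT hx.1, cross_eq_none.1 h1⟩, by rw [flagEdge_flip]; exact hz.sameEdge⟩

/-- Being connected by rotation around an edge. -/
def FlagRel (T : GluingData 3 ι) : ι × Perm (Fin 4) → ι × Perm (Fin 4) → Prop :=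
  Relation.EqvGen fun x y => y = flip x ∨ T.cross x = some y

theorem flagRel_of_flagEdge_eq {T : GluingData 3 ι} {x y : ι × Perm (Fin 4)}
    (h : flagEdge x = flagEdge y) : T.FlagRel x y := by
  obtain ⟨t, ρ⟩ := x
  obtain ⟨t', τ⟩ := y
  simp only [flagEdge, Prod.mk.injEq] at h
  obtain ⟨rfl, h0, h1⟩ := h
  rcases perm_eq_or_eq_mul_swap h0 h1 with rfl | rfl
  · exact .refl _
  · exact .rel _ _ (Or.inl rfl)

theorem exists_flag {t : ι} {a b i : Fin 4} (hab : a ≠ b) (ha : i ≠ a) (hb : i ≠ b) :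
    ∃ x : ι × Perm (Fin 4), flagEdge x = (t, a, b) ∧ x.2 3 = i := by
  obtain ⟨c, hc⟩ : ∃ c : Fin 4, c ≠ a ∧ c ≠ b ∧ c ≠ i := by
    revert a b i
    decide
  obtain ⟨ρ, h0, h1, h2, h3⟩ := exists_perm_of_ne hab hc.1.symm ha.symm hc.2.1.symm hb.symm hc.2.2
  exact ⟨(t, ρ), by simp [flagEdge, h0, h1], h3⟩

theorem exists_flag' {x : ι × Fin 4 × Fin 4} (h : x.2.1 ≠ x.2.2) :
    ∃ y : ι × Perm (Fin 4), flagEdge y = x := by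
  obtain ⟨t, a, b⟩ := x
  have hex : ∀ a b : Fin 4, ∃ i : Fin 4, i ≠ a ∧ i ≠ b := by decide
  obtain ⟨i, hi⟩ := hex a b
  obtain ⟨y, hy, -⟩ := exists_flag (t := t) h hi.1 hi.2
  exact ⟨y, hy⟩

/-- The first conjunct is there for transitivity: it shows that the intermediate triple is a genuine
edge, hence the edge of some flag through which the two flag relations can be composed. -/
theorem SameEdge.flagRel {T : GluingData 3 ι} {e e'} (h : T.SameEdge e e') :
    (e.2.1 = e.2.2 ↔ e'.2.1 = e'.2.2) ∧
      ∀ x y, flagEdge x = e → flagEdge y = e' → T.FlagRel x y := by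
  induction h with
  | rel e e' h =>
    obtain ⟨hne, i, π, h1, h2, h3, h4, h5⟩ := h
    refine ⟨by rw [h4, h5, π.injective.eq_iff], ?_⟩
    intro x y hx hy
    obtain ⟨z, hz, hzi⟩ := exists_flag (t := e.1) hne h1 h2
    refine (flagRel_of_flagEdge_eq (hx.trans hz.symm)).trans _ _ _ ?_
    have hz1 : z.1 = e.1 := congrArg Prod.fst hz
    have hz2 : z.2 0 = e.2.1 := congrArg (·.2.1) hz
    have hz3 : z.2 1 = e.2.2 := congrArg (·.2.2) hz
    have hc : T.cross z = some (e'.1, π * z.2) := by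
      rw [cross_eq_some, hz1, hzi, h3]
      simp
    refine Relation.EqvGen.trans _ _ _ (Relation.EqvGen.rel _ _ (Or.inr hc)) ?_
    refine flagRel_of_flagEdge_eq ?_
    rw [hy]
    simp [flagEdge, hz2, hz3, ← h4, ← h5]
  | refl e => exact ⟨Iff.rfl, fun x y hx hy => flagRel_of_flagEdge_eq (hx.trans hy.symm)⟩
  | symm e e' _ ih => exact ⟨ih.1.symm, fun x y hx hy => (ih.2 y x hy hx).symm⟩
  | trans e e' e'' _ _ ih ih' =>
    refine ⟨ih.1.trans ih'.1, fun x y hx hy => ?_⟩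
    have hne : e'.2.1 ≠ e'.2.2 := by
      rw [Ne, ← ih.1, ← hx]
      exact x.2.injective.ne (by decide)
    obtain ⟨z, hz⟩ := exists_flag' hne
    exact (ih.2 x z hx hz).trans _ _ _ (ih'.2 z y hz hy)

/-- Around an edge with an unglued face the tetrahedra form a chain, not a cycle. The flags reached
from `x` by rotation, together with their flips, are closed under flipping and crossing, so they are
all the flags at this edge. An unglued one can only be at the beginning or the end of the chain. -/
theorem eq_or_across_of_sameEdge {T : GluingData 3 ι} (hT : T.IsTriangulation)
    {x y : ι × Perm (Fin 4)} (hx : T.IsFree x) (hy : T.IsFree y)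
    (h : T.SameEdge (flagEdge x) (flagEdge y)) : y = x ∨ T.across x = some y := by
  have hstep : ∀ z w, (w = flip z ∨ T.cross z = some w) →
      ((T.Rotates x z ∨ T.Rotates x (flip z)) ↔ (T.Rotates x w ∨ T.Rotates x (flip w))) := by
    have key : ∀ z w, T.cross z = some w → (T.Rotates x z ∨ T.Rotates x (flip z)) →
        (T.Rotates x w ∨ T.Rotates x (flip w)) := by
      rintro z w hzw (h | h)
      · rcases Relation.ReflTransGen.cases_tail h with rfl | ⟨v, hv, hvz⟩
        · rw [cross_eq_none.2 hx.2] at hzw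
          cases hzw
        · have := cross_symm hT hvz
          rw [hzw] at this
          right
          rwa [Option.some.inj this, flip_flip]
      · exact Or.inl (h.tail (by rwa [flip_flip]))
    rintro z w (rfl | h)
    · rw [flip_flip, or_comm]
    · exact ⟨key z w h, key w z (cross_symm hT h)⟩
  have hmem : ∀ z w, T.FlagRel z w →
      ((T.Rotates x z ∨ T.Rotates x (flip z)) ↔ (T.Rotates x w ∨ T.Rotates x (flip w))) := by
    intro z w h
    induction h with
    | rel z w h => exact hstep z w h
    | refl z => exact Iff.rfl
    | symm z w _ ih => exact ih.symm
    | trans z w v _ _ ih ih' => exact ih.trans ih'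
  rcases (hmem x y (h.flagRel.2 x y rfl rfl)).1 (Or.inl .refl) with h | h
  · left
    rcases Relation.ReflTransGen.cases_tail h with h | ⟨v, hv, hvz⟩
    · exact h
    · have := cross_symm hT hvz
      rw [cross_eq_none.2 hy.2] at this
      cases this
  · right
    obtain ⟨r, hr⟩ := exists_across hT hx
    rw [hr, flagWalk_eq_of_rotates h (by rw [flip_flip]; exact cross_eq_none.2 hy.2) hr, flip_flip]

theorem across_symm {T : GluingData 3 ι} (hT : T.IsTriangulation) {x y : ι × Perm (Fin 4)}
    (hx : T.IsFree x) (h : T.across x = some y) : T.across y = some x := by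
  obtain ⟨hy, hxy⟩ := across_spec hT hx h
  rcases eq_or_across_of_sameEdge hT hy hx hxy.symm with rfl | h'
  · exact h
  · exact h'

/-! ### Orientations along a rotation -/

/-- An orientation of a 3-triangulation. -/
def Orients (T : GluingData 3 ι) (o : ι → ℤˣ) : Prop :=
  ∀ t i t' π, T.glue t i = some (t', π) → o t' = -Perm.sign π * o t

/-- Each flip and each crossing changes the sign of a flag. A walk with `n` crossings has `n + 1`
flips, so the total change is odd. -/
theorem sign_across {T : GluingData 3 ι} {o : ι → ℤˣ} (ho : T.Orients o) {x y : ι × Perm (Fin 4)}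
    (h : T.across x = some y) : o y.1 * Perm.sign y.2 = -(o x.1 * Perm.sign x.2) := by
  obtain ⟨z, hz, h1, rfl⟩ := exists_rotates_of_flagWalk h
  have hflip : ∀ z : ι × Perm (Fin 4),
      o (flip z).1 * Perm.sign (flip z).2 = -(o z.1 * Perm.sign z.2) := by
    intro z
    simp [flip]
  rw [hflip]
  congr 1
  clear h1 h
  induction hz with
  | refl => rfl
  | @tail b c _ hbc ih =>
    rw [← ih, ← neg_neg (o b.1 * _), ← hflip b]
    rw [cross_eq_some] at hbc
    rw [ho _ _ _ _ hbc]
    generalize (flip b).2 = u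
    simp only [map_mul, Perm.sign_inv]
    have : Perm.sign c.2 * Perm.sign c.2 = 1 := Int.units_mul_self _
    calc -(Perm.sign c.2 * Perm.sign u) * o (flip b).1 * Perm.sign c.2
        = -((Perm.sign c.2 * Perm.sign c.2) * (o (flip b).1 * Perm.sign u)) := by
          simp only [neg_mul, neg_inj]; ac_rfl
      _ = _ := by rw [this, one_mul]

end GluingData

namespace GluingData

variable {ι : Type}

/-! ### The boundary and the link of a 3-triangulation -/

theorem edgeOf_eq_iff {T : GluingData 3 ι} (hT : T.IsTriangulation) {p q : T.DirectedSide} :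
    T.edgeOf p = T.edgeOf q ↔ T.SameEdge p.1 q.1 := by
  constructor
  · intro h
    replace h := Quot.eqvGen_exact h
    induction h with
    | rel p q h =>
      obtain ⟨i, π, h1, h2, h3, h4, h5⟩ := h
      exact EdgeStep.sameEdge ⟨p.2.2, i, π, h1, h2, h3, h4, h5⟩
    | refl p => exact .refl _
    | symm p q _ ih => exact ih.symm
    | trans p q r _ _ ih ih' => exact ih.trans ih'
  · obtain ⟨x, hx⟩ := p
    obtain ⟨y, hy⟩ := q
    intro h
    replace h : T.SameEdge x y := h
    induction h with
    | rel x y h =>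
      obtain ⟨-, i, π, h1, h2, h3, h4, h5⟩ := h
      exact Quot.sound ⟨i, π, h1, h2, h3, h4, h5⟩
    | refl x => rfl
    | symm x y _ ih => exact (ih hy hx).symm
    | trans x y z h _ ih ih' =>
      have hm := (SameEdge.isEdge_iff hT h).1 hx
      exact (ih hx hm).trans (ih' hm hy)

theorem edgesValid_iff {T : GluingData 3 ι} (hT : T.IsTriangulation) :
    T.EdgesValid ↔ ∀ x, T.IsEdge x → ¬ T.SameEdge x (revEdge x) := by
  constructor
  · intro h x hx hs
    exact h ⟨x, hx⟩ ((edgeOf_eq_iff hT).2 hs)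
  · intro h p hp
    exact h p.1 p.2 ((edgeOf_eq_iff hT).1 hp)

theorem restrictPerm_inv (i : Fin 4) (π : Perm (Fin 4)) :
    restrictPerm (π i) π⁻¹ = (restrictPerm i π)⁻¹ := by
  rw [eq_inv_iff_mul_eq_one]
  ext s
  congr 1
  have h1 := succAbove_restrictPerm (π i) π⁻¹ (restrictPerm i π s)
  rw [succAbove_restrictPerm i π s] at h1
  have h2 : ∀ j, π⁻¹ (π j) = j := by simp
  rw [h2, h2] at h1
  exact Fin.succAbove_right_injective h1

theorem mem_boundary_cells [DecidableEq ι] {T : GluingData 3 ι} {f : ι × Fin 4} :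
    f ∈ T.boundary.cells ↔ f.1 ∈ T.cells ∧ T.glue f.1 f.2 = none := by
  simp [boundary]

theorem IsFree.face_mem [DecidableEq ι] {T : GluingData 3 ι} {x : ι × Perm (Fin 4)}
    (hx : T.IsFree x) : (x.1, x.2 3) ∈ T.boundary.cells :=
  mem_boundary_cells.2 hx

theorem exists_free_flag [DecidableEq ι] {T : GluingData 3 ι} {f : ι × Fin 4}
    (hf : f ∈ T.boundary.cells) {a b s : Fin 3} (hab : a ≠ b) (has : s ≠ a) (hbs : s ≠ b) :
    ∃ x : ι × Perm (Fin 4), T.IsFree x ∧ x.1 = f.1 ∧ x.2 0 = f.2.succAbove a ∧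
      x.2 1 = f.2.succAbove b ∧ x.2 2 = f.2.succAbove s ∧ x.2 3 = f.2 := by
  have hinj := Fin.succAbove_right_injective (p := f.2)
  obtain ⟨ρ, h0, h1, h2, h3⟩ := exists_perm_of_ne (hinj.ne hab) (hinj.ne has.symm)
    (Fin.succAbove_ne _ _) (hinj.ne hbs.symm) (Fin.succAbove_ne _ _) (Fin.succAbove_ne f.2 s)
  obtain ⟨h, h'⟩ := mem_boundary_cells.1 hf
  exact ⟨(f.1, ρ), ⟨h, by rwa [h3]⟩, rfl, h0, h1, h2, h3⟩

theorem boundary_glue_eq [DecidableEq ι] {T : GluingData 3 ι} {x : ι × Perm (Fin 4)}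
    (hx : T.IsFree x) {s : Fin 3} (hs : (x.2 3).succAbove s = x.2 2) :
    T.boundary.glue (x.1, x.2 3) s = (T.across x).map fun y =>
      ((y.1, y.2 3), restrictPerm (x.2 3) (y.2 * x.2⁻¹)) := by
  have h : x.1 ∈ T.cells ∧ T.glue x.1 (x.2 3) = none := hx
  simp only [boundary, if_pos h, hs, acrossEdge_eq, Option.map_map]
  congr 1
  funext y
  simp

/-- The directed edge of the triangulation on the side from the corner `a` to the corner `b` of an
unglued face `f`. -/
def sideEdge (f : ι × Fin 4) (a b : Fin 3) : ι × Fin 4 × Fin 4 :=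
  (f.1, f.2.succAbove a, f.2.succAbove b)

theorem boundary_glue_mem [DecidableEq ι] {T : GluingData 3 ι} {f f' : ι × Fin 4} {s : Fin 3}
    {π : Perm (Fin 3)} (h : T.boundary.glue f s = some (f', π)) : f ∈ T.boundary.cells := by
  rw [mem_boundary_cells]
  by_contra hf
  simp [boundary, hf] at h

/-- Two sides of boundary triangles glued to each other, as flags. -/
theorem exists_flags_of_boundary_glue [DecidableEq ι] {T : GluingData 3 ι}
    {f f' : ι × Fin 4} {s : Fin 3} {π : Perm (Fin 3)} (h : T.boundary.glue f s = some (f', π))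
    {a b : Fin 3} (hab : a ≠ b) (has : s ≠ a) (hbs : s ≠ b) :
    ∃ x y : ι × Perm (Fin 4), T.IsFree x ∧ T.across x = some y ∧
      (x.1 = f.1 ∧ x.2 0 = f.2.succAbove a ∧ x.2 1 = f.2.succAbove b ∧ x.2 2 = f.2.succAbove s ∧
        x.2 3 = f.2) ∧
      (y.1 = f'.1 ∧ y.2 0 = f'.2.succAbove (π a) ∧ y.2 1 = f'.2.succAbove (π b) ∧
        y.2 2 = f'.2.succAbove (π s) ∧ y.2 3 = f'.2) ∧ π = restrictPerm (x.2 3) (y.2 * x.2⁻¹) := by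
  obtain ⟨x, hx, h1, h2, h3, h4, h5⟩ := exists_free_flag (boundary_glue_mem h) hab has hbs
  have hg := boundary_glue_eq hx (s := s) (by rw [h4, h5])
  rw [h1, h5, Prod.mk.eta, h, eq_comm, Option.map_eq_some_iff] at hg
  obtain ⟨y, hy, hy'⟩ := hg
  obtain ⟨rfl, rfl⟩ := Prod.mk.inj hy'
  have hr : ∀ c, (y.2 3).succAbove (restrictPerm f.2 (y.2 * x.2⁻¹) c) =
      (y.2 * x.2⁻¹) (f.2.succAbove c) := by
    intro c
    rw [← succAbove_restrictPerm]
    simp [← h5]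
  refine ⟨x, y, hx, hy, ⟨h1, h2, h3, h4, h5⟩, ⟨rfl, ?_, ?_, ?_, rfl⟩, by rw [h5]⟩
  · rw [hr, ← h2]; simp
  · rw [hr, ← h3]; simp
  · rw [hr, ← h4]; simp

theorem sameEdge_of_boundary_glue [DecidableEq ι] {T : GluingData 3 ι} (hT : T.IsTriangulation)
    {f f' : ι × Fin 4} {s : Fin 3} {π : Perm (Fin 3)} (h : T.boundary.glue f s = some (f', π))
    {a b : Fin 3} (hab : a ≠ b) (has : s ≠ a) (hbs : s ≠ b) :
    T.SameEdge (sideEdge f a b) (sideEdge f' (π a) (π b)) := by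
  obtain ⟨x, y, hx, hy, ⟨h1, h2, h3, h4, h5⟩, ⟨h1', h2', h3', h4', h5'⟩, -⟩ :=
    exists_flags_of_boundary_glue h hab has hbs
  have := (across_spec hT hx hy).2
  rwa [flagEdge, flagEdge, h1, h2, h3, h1', h2', h3'] at this

theorem exists_ne_ne (a b : Fin 3) : ∃ s : Fin 3, s ≠ a ∧ s ≠ b := by
  revert a b
  decide

theorem eq_or_boundary_glue_of_sameEdge [DecidableEq ι] {T : GluingData 3 ι}
    (hT : T.IsTriangulation) {f f' : ι × Fin 4} (hf : f ∈ T.boundary.cells)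
    (hf' : f' ∈ T.boundary.cells) {a b a' b' : Fin 3} (hab : a ≠ b) (hab' : a' ≠ b')
    (h : T.SameEdge (sideEdge f a b) (sideEdge f' a' b')) :
    (f = f' ∧ a = a' ∧ b = b') ∨
      ∃ s π, s ≠ a ∧ s ≠ b ∧ T.boundary.glue f s = some (f', π) ∧ π a = a' ∧ π b = b' := by
  obtain ⟨s, has, hbs⟩ := exists_ne_ne a b
  obtain ⟨s', has', hbs'⟩ := exists_ne_ne a' b'
  obtain ⟨x, hx, h1, h2, h3, h4, h5⟩ := exists_free_flag hf hab has hbs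
  obtain ⟨y, hy, h1', h2', h3', h4', h5'⟩ := exists_free_flag hf' hab' has' hbs'
  have hxy : T.SameEdge (flagEdge x) (flagEdge y) := by
    rwa [flagEdge, flagEdge, h1, h2, h3, h1', h2', h3']
  rcases eq_or_across_of_sameEdge hT hx hy hxy with rfl | hy2
  · left
    have he : f = f' := Prod.ext (h1.symm.trans h1') (h5.symm.trans h5')
    subst he
    exact ⟨rfl, Fin.succAbove_right_injective (h2.symm.trans h2'),
      Fin.succAbove_right_injective (h3.symm.trans h3')⟩
  · right
    have hg := boundary_glue_eq hx (s := s) (by rw [h4, h5])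
    rw [hy2, Option.map_some, h1, h5, Prod.mk.eta, h1', h5', Prod.mk.eta] at hg
    have hr : ∀ c, f'.2.succAbove (restrictPerm f.2 (y.2 * x.2⁻¹) c) =
        (y.2 * x.2⁻¹) (f.2.succAbove c) := by
      intro c
      rw [← succAbove_restrictPerm]
      simp [← h5, ← h5']
    refine ⟨s, _, has, hbs, hg, ?_, ?_⟩
    · apply Fin.succAbove_right_injective (p := f'.2)
      rw [hr, ← h2, ← h2']
      simp
    · apply Fin.succAbove_right_injective (p := f'.2)
      rw [hr, ← h3, ← h3']
      simp

theorem boundary_isClosed [DecidableEq ι] {T : GluingData 3 ι} (hT : T.IsTriangulation) :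
    T.boundary.IsClosed := by
  intro f hf s
  obtain ⟨a, b, hab, has, hbs⟩ : ∃ a b : Fin 3, a ≠ b ∧ s ≠ a ∧ s ≠ b := by
    revert s
    decide
  obtain ⟨x, hx, h1, h2, h3, h4, h5⟩ := exists_free_flag hf hab has hbs
  have hg := boundary_glue_eq hx (s := s) (by rw [h4, h5])
  obtain ⟨y, hy⟩ := exists_across hT hx
  rw [hy, h1, h5] at hg
  rw [← Prod.mk.eta (p := f), hg]
  simp

/-- Orientability and valid edges are needed only to exclude a side glued to itself. The flag across
such a side would be `x` itself, against `sign_across`, or `revFlag x`, in which case the edge would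
be identified with its reverse. -/
theorem boundary_isTriangulation [DecidableEq ι] {T : GluingData 3 ι} (hT : T.IsTriangulation)
    (hE : T.EdgesValid) (ho : T.IsOrientable) : T.boundary.IsTriangulation := by
  obtain ⟨o, ho⟩ := ho
  intro f s f' π h
  obtain ⟨a, b, hab, has, hbs⟩ : ∃ a b : Fin 3, a ≠ b ∧ s ≠ a ∧ s ≠ b := by
    clear h
    revert s
    decide
  obtain ⟨x, y, hx, hy, ⟨h1, h2, h3, h4, h5⟩, ⟨h1', h2', h3', h4', h5'⟩, hπ⟩ :=
    exists_flags_of_boundary_glue h hab has hbs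
  obtain ⟨hyf, hxy⟩ := across_spec hT hx hy
  refine ⟨boundary_glue_mem h, ?_, ?_, ?_⟩
  · have := hyf.face_mem
    rwa [h1', h5'] at this
  · have hg := boundary_glue_eq hyf (s := π s) (by rw [h4', h5'])
    rw [across_symm hT hx hy, Option.map_some, h1, h5, h1', h5', Prod.mk.eta, Prod.mk.eta] at hg
    rw [hg]
    have := restrictPerm_inv (x.2 3) (y.2 * x.2⁻¹)
    rw [← hπ] at this
    rw [← this]
    simp [h5']
  · intro he
    obtain ⟨rfl, hs⟩ := Prod.mk.inj he
    rw [hs] at h4'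
    have hyx : y = x ∨ y = revFlag x := by
      have hval : ∀ c : Fin 3, c ≠ s → c = a ∨ c = b := by
        clear h4 h4' hs he hπ h2 h3 h2' h3' h
        revert s a b
        decide
      have ha : π a = a ∨ π a = b := hval _ (by rw [← hs]; exact π.injective.ne has.symm)
      have hb : π b = a ∨ π b = b := hval _ (by rw [← hs]; exact π.injective.ne hbs.symm)
      have hne : π a ≠ π b := π.injective.ne hab
      rcases ha with ha | ha
      · left
        have hb : π b = b := hb.resolve_left (fun hb => hne (ha.trans hb.symm))
        refine Prod.ext (h1'.trans h1.symm) (Equiv.ext fun j => ?_)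
        fin_cases j
        · simp [h2', h2, ha]
        · simp [h3', h3, hb]
        · simp [h4', h4]
        · simp [h5', h5]
      · right
        have hb : π b = a := hb.resolve_right (fun hb => hne (ha.trans hb.symm))
        refine Prod.ext (h1'.trans h1.symm) (Equiv.ext fun j => ?_)
        fin_cases j
        · simp [h2', h3, ha, revFlag]
        · simp [h3', h2, hb, revFlag]
        · simp [h4', h4, revFlag, swap_apply_of_ne_of_ne]
        · simp [h5', h5, revFlag, swap_apply_of_ne_of_ne]
    rcases hyx with rfl | rfl
    · have := sign_across ho hy
      rcases Int.units_eq_one_or (o y.1 * Perm.sign y.2) with h | h <;> rw [h] at this <;>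
        exact absurd this (by decide)
    · rw [flagEdge_revFlag] at hxy
      exact (edgesValid_iff hT).1 hE _ hx.isEdge hxy

theorem boundary_isOrientable [DecidableEq ι] {T : GluingData 3 ι} (ho : T.IsOrientable) :
    T.boundary.IsOrientable := by
  obtain ⟨o, ho⟩ := ho
  refine ⟨fun f => o f.1 * (-1) ^ f.2.val, ?_⟩
  intro f s f' π h
  obtain ⟨a, b, hab, has, hbs⟩ : ∃ a b : Fin 3, a ≠ b ∧ s ≠ a ∧ s ≠ b := by
    clear h
    revert s
    decide
  obtain ⟨x, y, hx, hy, ⟨h1, -, -, -, h5⟩, ⟨h1', -, -, -, h5'⟩, hπ⟩ :=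
    exists_flags_of_boundary_glue h hab has hbs
  have hs := sign_across ho hy
  have hy3 : (y.2 * x.2⁻¹) (x.2 3) = y.2 3 := by simp
  change o f'.1 * (-1) ^ f'.2.val = -Perm.sign π * (o f.1 * (-1) ^ f.2.val)
  rw [hπ, sign_restrictPerm, hy3, ← h1, ← h5, ← h1', ← h5', map_mul, Perm.sign_inv]
  have e1 : o y.1 = -(o x.1 * Perm.sign x.2 * Perm.sign y.2) := by
    rw [← neg_mul, ← hs, mul_assoc, Int.units_mul_self, mul_one]
  rw [e1, pow_add]
  rcases Int.units_eq_one_or (Perm.sign x.2) with h | h <;>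
  rcases Int.units_eq_one_or (Perm.sign y.2) with h' | h' <;>
  rcases Int.units_eq_one_or (o x.1) with h'' | h'' <;>
  rcases Int.units_eq_one_or ((-1 : ℤˣ) ^ (x.2 3).val) with h3 | h3 <;>
  simp [h, h', h'', h3]

/-! ### The vertex link -/

theorem link_glue (T : GluingData 3 ι) (f : ι × Fin 4) (s : Fin 3) :
    T.link.glue f s = (T.glue f.1 (f.2.succAbove s)).map fun r =>
      ((r.1, r.2 f.2), restrictPerm f.2 r.2) := rfl

theorem link_glue_eq_some {T : GluingData 3 ι} {f f' : ι × Fin 4} {s : Fin 3} {π : Perm (Fin 3)} :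
    T.link.glue f s = some (f', π) ↔ ∃ ρ, T.glue f.1 (f.2.succAbove s) = some (f'.1, ρ) ∧
      f'.2 = ρ f.2 ∧ π = restrictPerm f.2 ρ := by
  rw [link_glue, Option.map_eq_some_iff]
  constructor
  · rintro ⟨⟨t, ρ⟩, h, h'⟩
    obtain ⟨rfl, rfl⟩ := Prod.mk.inj h'
    exact ⟨ρ, h, rfl, rfl⟩
  · rintro ⟨ρ, h, h', rfl⟩
    exact ⟨_, h, by simp [← h']⟩

theorem mem_link_cells {T : GluingData 3 ι} {f : ι × Fin 4} : f ∈ T.link.cells ↔ f.1 ∈ T.cells := by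
  simp [link]

theorem link_isTriangulation {T : GluingData 3 ι} (hT : T.IsTriangulation) :
    T.link.IsTriangulation := by
  intro f s f' π h
  obtain ⟨ρ, h1, h2, rfl⟩ := link_glue_eq_some.1 h
  obtain ⟨h3, h4, h5, h6⟩ := hT _ _ _ _ h1
  refine ⟨mem_link_cells.2 h3, mem_link_cells.2 h4, ?_, ?_⟩
  · rw [link_glue_eq_some]
    refine ⟨ρ⁻¹, ?_, by simp [h2], by rw [h2, restrictPerm_inv]⟩
    rw [h2, succAbove_restrictPerm, h5]
  · intro he
    obtain ⟨rfl, hs⟩ := Prod.mk.inj he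
    apply h6
    have := succAbove_restrictPerm f'.2 ρ s
    rw [hs, ← h2] at this
    rw [← this]

theorem link_isOrientable {T : GluingData 3 ι} (ho : T.IsOrientable) : T.link.IsOrientable := by
  obtain ⟨o, ho⟩ := ho
  refine ⟨fun f => o f.1 * (-1) ^ f.2.val, ?_⟩
  intro f s f' π h
  obtain ⟨ρ, h1, h2, rfl⟩ := link_glue_eq_some.1 h
  change o f'.1 * (-1) ^ f'.2.val = _ * (o f.1 * (-1) ^ f.2.val)
  rw [sign_restrictPerm, ho _ _ _ _ h1, ← h2, pow_add]
  rcases Int.units_eq_one_or (Perm.sign ρ) with h | h <;>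
  rcases Int.units_eq_one_or (o f.1) with h'' | h'' <;>
  rcases Int.units_eq_one_or ((-1 : ℤˣ) ^ f.2.val) with h3 | h3 <;>
  simp [h, h'', h3]

/-- The corner of a link triangle is the point where an edge leaves the vertex, and the sides at
this corner lie in the faces containing the edge. Turning around a link vertex is thus passing
between tetrahedra around a directed edge. -/
theorem link_vertexOf_eq_iff {T : GluingData 3 ι} (hT : T.IsTriangulation)
    {p q : {p : (ι × Fin 4) × Fin 3 // p.1 ∈ T.link.cells}} :
    T.link.vertexOf p = T.link.vertexOf q ↔
      T.SameEdge (p.1.1.1, p.1.1.2, p.1.1.2.succAbove p.1.2)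
        (q.1.1.1, q.1.1.2, q.1.1.2.succAbove q.1.2) := by
  constructor
  · intro h
    replace h := Quot.eqvGen_exact h
    induction h with
    | rel p q h =>
      obtain ⟨s, π, h1, h2, h3⟩ := h
      obtain ⟨ρ, h4, h5, rfl⟩ := link_glue_eq_some.1 h2
      refine EdgeStep.sameEdge ⟨(Fin.succAbove_ne _ _).symm, _, ρ, Fin.succAbove_ne _ _,
        Fin.succAbove_right_injective.ne h1, h4, h5, ?_⟩
      change q.1.1.2.succAbove q.1.2 = _
      rw [h3, h5, succAbove_restrictPerm]
    | refl p => exact .refl _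
    | symm p q _ ih => exact ih.symm
    | trans p q r _ _ ih ih' => exact ih.trans ih'
  · obtain ⟨⟨⟨t, v⟩, a⟩, hp⟩ := p
    obtain ⟨⟨⟨t', v'⟩, a'⟩, hq⟩ := q
    intro h
    suffices H : ∀ x y, T.SameEdge x y → T.IsEdge x → ∀ (t v a t' v' a')
        (hp : ((t, v), a).1 ∈ T.link.cells) (hq : ((t', v'), a').1 ∈ T.link.cells),
        x = (t, v, v.succAbove a) → y = (t', v', v'.succAbove a') →
        T.link.vertexOf ⟨((t, v), a), hp⟩ = T.link.vertexOf ⟨((t', v'), a'), hq⟩ from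
      H _ _ h ⟨mem_link_cells.1 hp, (Fin.succAbove_ne _ _).symm⟩ _ _ _ _ _ _ hp hq rfl rfl
    intro x y h
    induction h with
    | rel x y h =>
      rintro hx t v a t' v' a' hp hq rfl rfl
      obtain ⟨hne, i, π, h1, h2, h3, h4, h5⟩ := h
      obtain ⟨s, rfl⟩ := Fin.exists_succAbove_eq h1
      refine Quot.sound ⟨s, restrictPerm v π, fun hs => h2 (by rw [hs]), ?_, ?_⟩
      · exact link_glue_eq_some.2 ⟨π, h3, h4, rfl⟩
      · apply Fin.succAbove_right_injective (p := v')
        have h6 : v' = π v := h4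
        subst h6
        exact h5.trans (succAbove_restrictPerm _ _ _).symm
    | refl x =>
      rintro hx t v a t' v' a' hp hq rfl he
      simp only [Prod.mk.injEq] at he
      obtain ⟨rfl, rfl, he⟩ := he
      obtain rfl := Fin.succAbove_right_injective he
      rfl
    | symm x y h ih =>
      rintro hx t v a t' v' a' hp hq h1 h2
      exact (ih ((SameEdge.isEdge_iff hT h).2 hx) _ _ _ _ _ _ hq hp h2 h1).symm
    | trans x y z h h' ih ih' =>
      rintro hx t v a t' v' a' hp hq h1 h2
      have hy := (SameEdge.isEdge_iff hT h).1 hx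
      obtain ⟨t'', v'', w⟩ := y
      obtain ⟨a'', ha⟩ := Fin.exists_succAbove_eq hy.2.symm
      have hm : ((t'', v''), a'').1 ∈ T.link.cells := mem_link_cells.2 hy.1
      exact (ih hx _ _ _ _ _ _ hp hm h1 (by rw [← show v''.succAbove a'' = w from ha])).trans
        (ih' hy _ _ _ _ _ _ hm hq (by rw [← show v''.succAbove a'' = w from ha]) h2)

end GluingData

namespace GluingData

variable {ι : Type}

/-! ### Counting facets, circles and edges -/

instance finite_corner {d : ℕ} (S : GluingData d ι) :
    Finite {p : ι × Fin (d + 1) // p.1 ∈ S.cells} :=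
  Finite.of_injective (β := S.cells × Fin (d + 1)) (fun p => (⟨p.1.1, p.2⟩, p.1.2)) (by
    intro p q h
    simp only [Prod.mk.injEq, Subtype.mk.injEq] at h
    exact Subtype.ext (Prod.ext h.1 h.2))

theorem card_corner {d : ℕ} (S : GluingData d ι) :
    Nat.card {p : ι × Fin (d + 1) // p.1 ∈ S.cells} = (d + 1) * S.cells.card := by
  rw [Nat.card_congr (β := S.cells × Fin (d + 1)) ⟨fun p => (⟨p.1.1, p.2⟩, p.1.2),
    fun q => ⟨(q.1.1, q.2), q.1.2⟩, fun _ => rfl, fun _ => rfl⟩]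
  simp [mul_comm]

/-- The relation is a partial involution without fixed points, so a class is a pair or a single
unpaired element. Giving each element weight `1`, and unpaired elements a further `1`, makes every
class weigh `2`. -/
theorem two_mul_card_quot {α : Type} [Finite α] {r : α → α → Prop} (hs : ∀ a b, r a b → r b a)
    (hi : ∀ a, ¬ r a a) (hf : ∀ a b c, r a b → r a c → b = c) :
    2 * Nat.card (Quot r) = Nat.card α + Nat.card {a // ∀ b, ¬ r a b} := by
  classical
  have := Fintype.ofFinite α
  have := Fintype.ofFinite (Quot r)
  have heq : ∀ a b, Quot.mk r a = Quot.mk r b → b = a ∨ r a b := by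
    intro a b h
    replace h := Quot.eqvGen_exact h
    induction h with
    | rel a b h => exact Or.inr h
    | refl a => exact Or.inl rfl
    | symm a b _ ih => exact ih.imp Eq.symm (hs _ _)
    | trans a b c _ _ ih ih' =>
      rcases ih with rfl | ih
      · exact ih'
      · rcases ih' with rfl | ih'
        · exact Or.inr ih
        · exact Or.inl (hf b a c (hs _ _ ih) ih').symm
  have hfib : ∀ c : Quot r, ∑ a with Quot.mk r a = c, (1 + if ∀ b, ¬ r a b then 1 else 0) = 2 := by
    intro c
    obtain ⟨a, rfl⟩ := Quot.exists_rep c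
    by_cases h : ∀ b, ¬ r a b
    · have : (Finset.univ.filter fun x => Quot.mk r x = Quot.mk r a) = {a} := by
        ext x
        simp only [Finset.mem_filter, Finset.mem_univ, true_and, Finset.mem_singleton]
        exact ⟨fun hx => (heq _ _ hx.symm).resolve_right (h x), fun hx => by rw [hx]⟩
      rw [this, Finset.sum_singleton, if_pos h]
    · push Not at h
      obtain ⟨b, hb⟩ := h
      have hab : a ≠ b := fun h => hi a (by rwa [← h] at hb)
      have : (Finset.univ.filter fun x => Quot.mk r x = Quot.mk r a) = {a, b} := by
        ext x
        simp only [Finset.mem_filter, Finset.mem_univ, true_and, Finset.mem_singleton,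
          Finset.mem_insert]
        constructor
        · exact fun hx => (heq _ _ hx.symm).imp_right fun h => hf _ _ _ h hb
        · rintro (rfl | rfl)
          · rfl
          · exact (Quot.sound hb).symm
      rw [this, Finset.sum_pair hab, if_neg (fun h => h b hb), if_neg (fun h => h a (hs _ _ hb))]
  have hsum := Finset.sum_fiberwise (Finset.univ : Finset α) (fun a => Quot.mk r a)
    (fun a => 1 + if ∀ b, ¬ r a b then 1 else 0)
  rw [Finset.sum_congr rfl (fun c _ => hfib c), Finset.sum_const, Finset.sum_add_distrib,
    Finset.sum_boole] at hsum
  simp only [Finset.card_univ, smul_eq_mul, mul_one, Finset.sum_const, Nat.cast_id] at hsum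
  rw [Nat.card_eq_fintype_card, Nat.card_eq_fintype_card, Nat.card_eq_fintype_card,
    Fintype.card_subtype, mul_comm]
  exact hsum

theorem two_mul_card_facet {S : GluingData 2 ι} (hS : S.IsTriangulation) :
    2 * Nat.card S.Facet = 3 * S.cells.card + Nat.card S.FreeSide := by
  unfold Facet
  rw [two_mul_card_quot, card_corner]
  · congr 1
    refine Nat.card_congr ⟨fun p => ⟨p.1.1, p.1.2, ?_⟩, fun p => ⟨⟨p.1, p.2.1⟩, ?_⟩,
      fun _ => rfl, fun _ => rfl⟩
    · by_contra h
      obtain ⟨⟨t, π⟩, h⟩ := Option.ne_none_iff_exists'.1 h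
      exact p.2 ⟨(t, π p.1.1.2), (hS _ _ _ _ h).2.1⟩ ⟨π, h, rfl⟩
    · rintro b ⟨π, h, -⟩
      rw [p.2.2] at h
      cases h
  · rintro ⟨⟨a, i⟩, ha⟩ ⟨⟨b, j⟩, hb⟩ ⟨π, h, h'⟩
    obtain rfl : j = π i := h'
    exact ⟨π⁻¹, (hS _ _ _ _ h).2.2.1, by simp⟩
  · rintro ⟨⟨a, i⟩, ha⟩ ⟨π, h, h'⟩
    exact (hS _ _ _ _ h).2.2.2 (Prod.ext rfl h'.symm)
  · rintro ⟨⟨a, i⟩, ha⟩ ⟨⟨b, j⟩, hb⟩ ⟨⟨c, k⟩, hc⟩ ⟨π, h, h'⟩ ⟨ρ, h2, h2'⟩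
    rw [h] at h2
    simp only [Option.some.injEq, Prod.mk.injEq] at h2 h' h2'
    obtain ⟨rfl, rfl⟩ := h2
    subst h' h2'
    rfl

theorem IsClosed.isEmpty_freeSide {S : GluingData 2 ι} (h : S.IsClosed) : IsEmpty S.FreeSide :=
  ⟨fun p => h _ p.2.1 _ p.2.2⟩

theorem IsClosed.card_boundaryCircle {S : GluingData 2 ι} (h : S.IsClosed) :
    Nat.card S.BoundaryCircle = 0 := by
  have := h.isEmpty_freeSide
  have : IsEmpty S.BoundaryCircle := ⟨fun c => Quot.ind (β := fun _ => False) this.elim c⟩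
  exact Nat.card_of_isEmpty

/-! ### Corners of boundary triangles as unglued sides of the link -/

section Sheets

variable [DecidableEq ι] {T : GluingData 3 ι}

/-- The corner `p` of an unglued face has the unglued side `x` of a triangle of the link as arc
around it. -/
def IsArc (T : GluingData 3 ι) (p : {p : (ι × Fin 4) × Fin 3 // p.1 ∈ T.boundary.cells})
    (x : T.link.FreeSide) : Prop :=
  x.1.1 = (p.1.1.1, p.1.1.2.succAbove p.1.2) ∧ x.1.1.2.succAbove x.1.2 = p.1.1.2

theorem exists_isArc (p : {p : (ι × Fin 4) × Fin 3 // p.1 ∈ T.boundary.cells}) :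
    ∃ x, T.IsArc p x := by
  obtain ⟨⟨⟨t, i⟩, a⟩, hp⟩ := p
  obtain ⟨h1, h2⟩ := mem_boundary_cells.1 hp
  obtain ⟨s, hs⟩ := Fin.exists_succAbove_eq (Fin.succAbove_ne i a).symm
  refine ⟨⟨((t, i.succAbove a), s), mem_link_cells.2 h1, ?_⟩, rfl, hs⟩
  rw [link_glue, hs]
  simp only at h2
  rw [h2]
  rfl

theorem exists_isArc' (x : T.link.FreeSide) : ∃ p, T.IsArc p x := by
  obtain ⟨⟨⟨t, v⟩, s⟩, hx, hx'⟩ := x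
  obtain ⟨a, ha⟩ := Fin.exists_succAbove_eq (Fin.succAbove_ne v s).symm
  refine ⟨⟨((t, v.succAbove s), a), mem_boundary_cells.2
    ⟨(mem_link_cells (f := (t, v))).1 hx, ?_⟩⟩, ?_, rfl⟩
  · simpa [link_glue] using hx'
  · exact Prod.ext rfl ha.symm

theorem IsArc.eq_right {p x y} (h : T.IsArc p x) (h' : T.IsArc p y) : x = y := by
  obtain ⟨⟨f, s⟩, hx⟩ := x
  obtain ⟨⟨f', s'⟩, hy⟩ := y
  have h1 : f = f' := h.1.trans h'.1.symm
  subst h1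
  have : s = s' := Fin.succAbove_right_injective (h.2.trans h'.2.symm)
  subst this
  rfl

theorem IsArc.eq_left {p q x} (h : T.IsArc p x) (h' : T.IsArc q x) : p = q := by
  obtain ⟨⟨⟨t, i⟩, a⟩, hp⟩ := p
  obtain ⟨⟨⟨t', i'⟩, a'⟩, hq⟩ := q
  have h2 : i = i' := h.2.symm.trans h'.2
  obtain ⟨h3, h4⟩ := Prod.mk.inj (h.1.symm.trans h'.1)
  subst h2
  simp only at h3 h4
  subst h3
  obtain rfl := Fin.succAbove_right_injective h4
  rfl

/-- Crossing a boundary side at a corner and passing to the neighbouring unglued side of the link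
are the same move around one boundary edge. In the direction from circles to vertices,
`eq_or_boundary_glue_of_sameEdge` is essential: two boundary sides on the same edge either coincide
or are glued to each other. -/
theorem vertexOf_eq_iff_circleOf_eq (hT : T.IsTriangulation) {p q x y} (hpx : T.IsArc p x)
    (hqy : T.IsArc q y) :
    T.boundary.vertexOf p = T.boundary.vertexOf q ↔ T.link.circleOf x = T.link.circleOf y := by
  constructor
  · intro h
    replace h := Quot.eqvGen_exact h
    induction h generalizing x y with
    | rel p q h =>
      obtain ⟨s, π, hs, hg, hq⟩ := h
      obtain ⟨⟨f, a⟩, hp⟩ := p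
      obtain ⟨⟨f', a'⟩, hp'⟩ := q
      obtain ⟨b, hba, hbs⟩ := exists_ne_ne a s
      obtain rfl : a' = π a := hq
      have hse := sameEdge_of_boundary_glue hT hg hba.symm hs hbs.symm
      obtain ⟨⟨⟨t, v⟩, u⟩, hx⟩ := x
      obtain ⟨⟨⟨t', v'⟩, u'⟩, hy⟩ := y
      have hx1 := hpx.1
      have hx2 := hpx.2
      have hy1 := hqy.1
      have hy2 := hqy.2
      simp only [Prod.mk.injEq] at hx1 hx2 hy1 hy2
      obtain ⟨rfl, rfl⟩ := hx1
      obtain ⟨rfl, rfl⟩ := hy1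
      obtain ⟨c, hc⟩ := Fin.exists_succAbove_eq
        (Fin.succAbove_right_injective.ne hba : f.2.succAbove b ≠ f.2.succAbove a)
      obtain ⟨c', hc'⟩ := Fin.exists_succAbove_eq
        (Fin.succAbove_right_injective.ne (π.injective.ne hba) :
          f'.2.succAbove (π b) ≠ f'.2.succAbove (π a))
      refine Quot.sound ⟨c, c', ?_, ?_, (link_vertexOf_eq_iff hT).2 ?_⟩
      · rintro rfl
        exact Fin.succAbove_ne _ _ (hc.symm.trans hx2)
      · rintro rfl
        exact Fin.succAbove_ne _ _ (hc'.symm.trans hy2)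
      · simp only
        rw [hc, hc']
        exact hse
    | refl p => rw [hpx.eq_right hqy]
    | symm p q _ ih => exact (ih hqy hpx).symm
    | trans p q r _ _ ih ih' =>
      obtain ⟨z, hz⟩ := exists_isArc q
      exact (ih hpx hz).trans (ih' hz hqy)
  · intro h
    replace h := Quot.eqvGen_exact h
    induction h generalizing p q with
    | rel x y h =>
      obtain ⟨c, c', hc, hc', he⟩ := h
      have hse := (link_vertexOf_eq_iff hT).1 he
      obtain ⟨⟨f, a⟩, hp⟩ := p
      obtain ⟨⟨f', a'⟩, hp'⟩ := q
      obtain ⟨⟨⟨t, v⟩, u⟩, hx⟩ := x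
      obtain ⟨⟨⟨t', v'⟩, u'⟩, hy⟩ := y
      have hx1 := hpx.1
      have hx2 := hpx.2
      have hy1 := hqy.1
      have hy2 := hqy.2
      simp only [Prod.mk.injEq] at hx1 hx2 hy1 hy2 hse
      obtain ⟨rfl, rfl⟩ := hx1
      obtain ⟨rfl, rfl⟩ := hy1
      have hne : (f.2.succAbove a).succAbove c ≠ f.2 :=
         fun h => hc (Fin.succAbove_right_injective (h.trans hx2.symm))
      have hne' : (f'.2.succAbove a').succAbove c' ≠ f'.2 :=
         fun h => hc' (Fin.succAbove_right_injective (h.trans hy2.symm))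
      obtain ⟨b, hb⟩ := Fin.exists_succAbove_eq hne
      obtain ⟨b', hb'⟩ := Fin.exists_succAbove_eq hne'
      rw [← hb, ← hb'] at hse
      have hab : a ≠ b := by
        rintro rfl
        exact Fin.succAbove_ne _ _ hb.symm
      have hab' : a' ≠ b' := by
        rintro rfl
        exact Fin.succAbove_ne _ _ hb'.symm
      rcases eq_or_boundary_glue_of_sameEdge hT hp hp' hab hab' hse with
        ⟨rfl, rfl, -⟩ | ⟨s, π, h1, h2, h3, h4, -⟩
      · rfl
      · exact Quot.sound ⟨s, π, h1, h3, h4.symm⟩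
    | refl x => rw [hpx.eq_left hqy]
    | symm x y _ ih => exact (ih hqy hpx).symm
    | trans x y z _ _ ih ih' =>
      obtain ⟨r, hr⟩ := exists_isArc' y
      exact (ih hpx hr).trans (ih' hr hqy)

theorem card_link_boundaryCircle (hT : T.IsTriangulation) :
    Nat.card T.link.BoundaryCircle = Nat.card T.boundary.Vertex := by
  choose X hX using exists_isArc (T := T)
  let F : T.boundary.Vertex → T.link.BoundaryCircle :=
    Quot.lift (fun p => T.link.circleOf (X p)) fun p q h =>
      (vertexOf_eq_iff_circleOf_eq hT (hX p) (hX q)).1 (Quot.sound h)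
  refine (Nat.card_eq_of_bijective F ⟨?_, ?_⟩).symm
  · rintro ⟨p⟩ ⟨q⟩ h
    exact (vertexOf_eq_iff_circleOf_eq hT (hX p) (hX q)).2 h
  · rintro ⟨x⟩
    obtain ⟨p, hp⟩ := exists_isArc' x
    refine ⟨T.boundary.vertexOf p, ?_⟩
    change T.link.circleOf (X p) = T.link.circleOf x
    rw [(hX p).eq_right hp]

theorem card_link_freeSide : Nat.card T.link.FreeSide = 3 * T.boundary.cells.card := by
  rw [← card_corner]
  choose X hX using exists_isArc (T := T)
  refine (Nat.card_eq_of_bijective X ⟨?_, ?_⟩).symm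
  · intro p q h
    exact (hX p).eq_left (h ▸ hX q)
  · intro x
    obtain ⟨p, hp⟩ := exists_isArc' x
    exact ⟨p, (hX p).eq_right hp⟩

end Sheets

/-! ### Edge functions modulo 2 and the number of link vertices -/

/-- Functions on the directed edges of a 3-triangulation with values modulo 2. -/
def edgeFun (T : GluingData 3 ι) : AddSubgroup (ι × Fin 4 × Fin 4 → ZMod 2) where
  carrier := {F | (∀ x y, T.EdgeStep x y → F x = F y) ∧ ∀ x, ¬ T.IsEdge x → F x = 0}
  add_mem' := by
    rintro F G ⟨h1, h2⟩ ⟨h1', h2'⟩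
    exact ⟨fun x y h => by simp [h1 x y h, h1' x y h], fun x h => by simp [h2 x h, h2' x h]⟩
  zero_mem' := ⟨fun _ _ _ => rfl, fun _ _ => rfl⟩
  neg_mem' := by
    rintro F ⟨h1, h2⟩
    exact ⟨fun x y h => by simp [h1 x y h], fun x h => by simp [h2 x h]⟩

theorem edgeFun_sameEdge {T : GluingData 3 ι} {F : ι × Fin 4 × Fin 4 → ZMod 2} (hF : F ∈ T.edgeFun)
    {x y} (h : T.SameEdge x y) : F x = F y :=
  h.apply_eq hF.1

theorem indicator_mem_edgeFun {T : GluingData 3 ι} (hT : T.IsTriangulation) {x} (hx : T.IsEdge x) :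
    Set.indicator {y | T.SameEdge x y} 1 ∈ T.edgeFun := by
  classical
  refine ⟨fun y z h => ?_, fun y hy => ?_⟩
  · have : T.SameEdge x y ↔ T.SameEdge x z :=
      ⟨fun h' => h'.trans h.sameEdge, fun h' => h'.trans h.sameEdge.symm⟩
    simp [Set.indicator_apply, this]
  · rw [Set.indicator_of_notMem]
    exact fun h => hy ((SameEdge.isEdge_iff hT h).1 hx)

theorem finite_vertex {d : ℕ} (S : GluingData d ι) : Finite S.Vertex :=
  Finite.of_surjective (fun p => S.vertexOf p) Quot.mk_surjective

theorem card_fun_vertex {d : ℕ} (S : GluingData d ι) :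
    Nat.card (S.Vertex → ZMod 2) = 2 ^ Nat.card S.Vertex := by
  have := finite_vertex S
  rw [Nat.card_fun, Nat.card_zmod]

/-- Since edge functions vanish off genuine edges, they are just functions on directed edges up to
identification, that is, on link vertices. The number of link vertices becomes the exponent of a
group order, which can be computed from kernels and indices. -/
theorem card_edgeFun {T : GluingData 3 ι} (hT : T.IsTriangulation) :
    Nat.card T.edgeFun = 2 ^ Nat.card T.link.Vertex := by
  classical
  rw [← card_fun_vertex]
  let G : T.edgeFun → T.link.Vertex → ZMod 2 := fun F =>
    Quot.lift (fun p => F.1 (p.1.1.1, p.1.1.2, p.1.1.2.succAbove p.1.2)) fun p q h =>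
      edgeFun_sameEdge F.2 ((link_vertexOf_eq_iff hT).1 (Quot.sound h))
  have hG : ∀ F p, G F (T.link.vertexOf p) =
    F.1 (p.1.1.1, p.1.1.2, p.1.1.2.succAbove p.1.2) := fun _ _ => rfl
  have hex : ∀ x, T.IsEdge x → ∃ p : {p : (ι × Fin 4) × Fin 3 // p.1 ∈ T.link.cells},
      (p.1.1.1, p.1.1.2, p.1.1.2.succAbove p.1.2) = x := by
    rintro ⟨t, v, w⟩ ⟨h, h'⟩
    obtain ⟨a, ha⟩ := Fin.exists_succAbove_eq h'.symm
    exact ⟨⟨((t, v), a), mem_link_cells.2 h⟩, Prod.ext rfl (Prod.ext rfl ha)⟩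
  choose p hp using hex
  refine Nat.card_eq_of_bijective G ⟨?_, ?_⟩
  · intro F F' h
    ext x
    by_cases hx : T.IsEdge x
    · rw [← hp x hx, ← hG F, ← hG F', h]
    · rw [F.2.2 x hx, F'.2.2 x hx]
  · intro h
    refine ⟨⟨fun x => if hx : T.IsEdge x then h (T.link.vertexOf (p x hx)) else 0, ?_, ?_⟩, ?_⟩
    · intro x y hxy
      obtain ⟨hx, hy⟩ := hxy.isEdge hT
      beta_reduce
      rw [dif_pos hx, dif_pos hy, (link_vertexOf_eq_iff hT (q := p y hy)).2 (by
        rw [hp x hx, hp y hy]; exact hxy.sameEdge)]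
    · intro x hx
      beta_reduce
      rw [dif_neg hx]
    · ext ⟨q⟩
      change (if _ : T.IsEdge _ then _ else _) = h (T.link.vertexOf q)
      have hq : T.IsEdge (q.1.1.1, q.1.1.2, q.1.1.2.succAbove q.1.2) :=
        ⟨mem_link_cells.1 q.2, (Fin.succAbove_ne _ _).symm⟩
      rw [dif_pos hq, (link_vertexOf_eq_iff hT).2]
      rw [hp _ hq]
      exact .refl _

end GluingData

namespace GluingData

variable {ι : Type}

/-! ### Loops in a one-vertex oriented surface -/

/-- Passing from a corner of a triangle to the corner it is glued to across a side. -/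
def CrossesAt (S : GluingData 2 ι) (x y : ι × Fin 3) (s : Fin 3) : Prop :=
  s ≠ x.2 ∧ ∃ π, S.glue x.1 s = some (y.1, π) ∧ y.2 = π x.2

/-- On a cycle with two marked points, one of the two arcs between them. -/
theorem exists_arc {α : Type*} [Finite α] (r : Perm α) {x y : α} (hxy : x ≠ y)
    (h : r.SameCycle x y) : ∃ u : α → ZMod 2, u x = 0 ∧ u y = 1 ∧ u (r x) = 1 ∧ u (r y) = 0 ∧
      ∀ z, z ≠ x → z ≠ y → u (r z) = u z := by
  classical
  have hex : ∃ n, 0 < n ∧ (r ^ n) x = y := by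
    obtain ⟨n, h1, -, h2⟩ := h.exists_pow_eq''
    exact ⟨n, h1, h2⟩
  set n := Nat.find hex with hn
  obtain ⟨hn0, hny⟩ := Nat.find_spec hex
  rw [← hn] at hn0 hny
  have hmin : ∀ m, 0 < m → m < n → (r ^ m) x ≠ y := fun m h0 hm h => Nat.find_min hex hm ⟨h0, h⟩
  -- The points reached after one to `n` steps from `x`, where `n` is the first time at which `y` is
  -- reached: `y` is included and `x` is not.
  let A : α → Prop := fun z => ∃ j, 0 < j ∧ j ≤ n ∧ (r ^ j) x = z
  have hx : ¬ A x := by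
    rintro ⟨j, h0, hj, hjx⟩
    have h1 : (r ^ (n - j)) x = y := by
      rw [← hny, ← Nat.sub_add_cancel hj, pow_add, Perm.mul_apply, hjx, Nat.add_sub_cancel]
    rcases Nat.eq_zero_or_pos (n - j) with h2 | h2
    · rw [h2] at h1
      exact hxy h1
    · exact hmin _ h2 (by omega) h1
  have hy : A y := ⟨n, hn0, le_rfl, hny⟩
  have hrx : A (r x) := ⟨1, one_pos, hn0, by simp⟩
  have hry : ¬ A (r y) := by
    rintro ⟨j, h0, hj, hjx⟩
    obtain ⟨k, rfl⟩ : ∃ k, j = k + 1 := ⟨j - 1, by omega⟩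
    rw [pow_succ', Perm.mul_apply] at hjx
    have hk := r.injective hjx
    rcases Nat.eq_zero_or_pos k with rfl | hk0
    · exact hxy hk
    · exact hmin k hk0 (by omega) hk
  refine ⟨fun z => if A z then 1 else 0, if_neg hx, if_pos hy, if_pos hrx, if_neg hry, ?_⟩
  intro z hzx hzy
  have : A (r z) ↔ A z := by
    constructor
    · rintro ⟨j, h0, hj, hjx⟩
      obtain ⟨k, rfl⟩ : ∃ k, j = k + 1 := ⟨j - 1, by omega⟩
      rw [pow_succ', Perm.mul_apply] at hjx
      have hk := r.injective hjx
      rcases Nat.eq_zero_or_pos k with rfl | hk0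
      · exact absurd hk.symm hzx
      · exact ⟨k, hk0, by omega, hk⟩
    · rintro ⟨j, h0, hj, rfl⟩
      refine ⟨j + 1, by omega, ?_, by rw [pow_succ', Perm.mul_apply]⟩
      rcases hj.lt_or_eq with h | rfl
      · exact h
      · exact absurd hny hzy
  simp [this]

/-- An orientation picks one of the two sides at a corner as the one by which to leave, at offset
`1` or `2`. The sign rule for gluings says that one enters the next corner by its other side, so the
turning continues in the same sense. -/
theorem perm_add_eq (o : ℤˣ) (π : Perm (Fin 3)) (a : Fin 3) :
    π (a + if o = 1 then 1 else 2) = π a - (if -Perm.sign π * o = 1 then 1 else 2) := by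
  revert o π a
  decide +kernel

/-- Rotation around the vertices of a closed oriented surface. -/
theorem exists_rotation {S : GluingData 2 ι} (hS : S.IsTriangulation) (hc : S.IsClosed)
    {o : ι → ℤˣ} (ho : ∀ t i t' π, S.glue t i = some (t', π) → o t' = -Perm.sign π * o t) :
    ∃ r : Perm {p : ι × Fin 3 // p.1 ∈ S.cells}, ∀ p,
      S.CrossesAt p.1 (r p).1 (p.1.2 + if o p.1.1 = 1 then 1 else 2) := by
  have hne : ∀ (o : ℤˣ) (a : Fin 3), (a + if o = 1 then 1 else 2) ≠ a := by decide
  have hex : ∀ p : {p : ι × Fin 3 // p.1 ∈ S.cells}, ∃ q : {p : ι × Fin 3 // p.1 ∈ S.cells},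
      S.CrossesAt p.1 q.1 (p.1.2 + if o p.1.1 = 1 then 1 else 2) := by
    intro p
    obtain ⟨⟨t, π⟩, h⟩ := Option.ne_none_iff_exists'.1
      (hc p.1.1 p.2 (p.1.2 + if o p.1.1 = 1 then 1 else 2))
    exact ⟨⟨(t, π p.1.2), (hS _ _ _ _ h).2.1⟩, hne _ _, π, h, rfl⟩
  choose r hr using hex
  refine ⟨Equiv.ofBijective r (Finite.injective_iff_bijective.1 ?_), hr⟩
  intro p q h
  obtain ⟨-, π, h1, h2⟩ := hr p
  obtain ⟨-, ρ, h3, h4⟩ := hr q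
  rw [← h] at h3 h4
  have h5 := perm_add_eq (o p.1.1) π p.1.2
  have h6 := perm_add_eq (o q.1.1) ρ q.1.2
  rw [← ho _ _ _ _ h1, ← h2] at h5
  rw [← ho _ _ _ _ h3, ← h4] at h6
  have h7 := (hS _ _ _ _ h1).2.2.1
  have h8 := (hS _ _ _ _ h3).2.2.1
  rw [h6, ← h5, h7] at h8
  simp only [Option.some.injEq, Prod.mk.injEq, inv_inj] at h8
  obtain ⟨h9, rfl⟩ := h8
  exact Subtype.ext (Prod.ext h9 (π.injective (h2.symm.trans h4)))

/-- Rotation permutes the corners in a single cycle, because the surface has only one vertex. It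
crosses the given edge exactly twice, once at each end and in opposite directions. Between these two
crossings `u` is the indicator of an arc of the cycle. -/
theorem exists_side_function {S : GluingData 2 ι} (hS : S.IsTriangulation) (hc : S.IsClosed)
    (ho : S.IsOrientable) (hv : Nat.card S.Vertex = 1) {f₁ f₂ : ι} {s₁ : Fin 3} {π : Perm (Fin 3)}
    (hg : S.glue f₁ s₁ = some (f₂, π)) (hne : f₁ ≠ f₂) :
    ∃ u : ι × Fin 3 → ZMod 2,
      (∀ x y s, S.CrossesAt x y s → (x.1, s) ≠ (f₁, s₁) → (x.1, s) ≠ (f₂, π s₁) → u x = u y) ∧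
      (∀ a, a ≠ s₁ → u (f₁, a) = 0) ∧ (∀ a, a ≠ π s₁ → u (f₂, a) = 1) := by
  classical
  obtain ⟨o, ho⟩ := ho
  obtain ⟨r, hr⟩ := exists_rotation hS hc ho
  have hfun : ∀ {x y z : ι × Fin 3} {s : Fin 3}, S.CrossesAt x y s → S.CrossesAt x z s → y = z := by
    rintro x ⟨y, b⟩ ⟨z, c⟩ s ⟨-, π, h1, h2⟩ ⟨-, ρ, h3, h4⟩
    rw [h1] at h3
    simp only [Option.some.injEq, Prod.mk.injEq] at h3 h2 h4
    obtain ⟨rfl, rfl⟩ := h3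
    rw [h2, h4]
  have hval : ∀ (o : ℤˣ) (a s : Fin 3), s ≠ a → s ≠ (a + if o = 1 then 1 else 2) →
      s = (a - if o = 1 then 1 else 2) := by decide
  -- Leaving a corner by its other side is a rotation step taken backwards.
  have hother : ∀ (p q : {p : ι × Fin 3 // p.1 ∈ S.cells}) (s : Fin 3), S.CrossesAt p.1 q.1 s →
      s ≠ (p.1.2 + if o p.1.1 = 1 then 1 else 2) →
      r q = p ∧ ∃ ρ, S.glue p.1.1 s = some (q.1.1, ρ) ∧
        ρ s = (q.1.2 + if o q.1.1 = 1 then 1 else 2) := by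
    rintro p q s ⟨h1, ρ, h2, h3⟩ hs
    have h4 := hval _ _ _ h1 hs
    have h5 := (hS _ _ _ _ h2).2.2.1
    have h6 := perm_add_eq (o q.1.1) ρ⁻¹ q.1.2
    rw [← ho _ _ _ _ h5] at h6
    have h7 : ρ⁻¹ q.1.2 = p.1.2 := by rw [h3]; simp
    rw [h7, ← h4] at h6
    have h8 : ρ s = (q.1.2 + if o q.1.1 = 1 then 1 else 2) := by rw [← h6]; simp
    refine ⟨Subtype.ext (hfun (hr q) ?_), ρ, h2, h8⟩
    rw [← h8]
    exact ⟨by rw [h3]; exact ρ.injective.ne h1, ρ⁻¹, h5, h7.symm⟩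
  have hcyc : ∀ p q, r.SameCycle p q := by
    have : Subsingleton S.Vertex := (Nat.card_eq_one_iff_unique.1 hv).1
    intro p q
    have h : S.vertexOf p = S.vertexOf q := Subsingleton.elim _ _
    replace h := Quot.eqvGen_exact h
    induction h with
    | rel p q h =>
      obtain ⟨s, π, h1, h2, h3⟩ := h
      by_cases hs : s = (p.1.2 + if o p.1.1 = 1 then 1 else 2)
      · have : r p = q := Subtype.ext (hfun (hr p)
          ⟨by rw [← hs]; exact h1, π, by rw [← hs]; exact h2, h3⟩)
        exact ⟨1, by simpa using this⟩
      · have := (hother p q s ⟨h1, π, h2, h3⟩ hs).1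
        exact Perm.SameCycle.symm ⟨1, by simpa using this⟩
    | refl p => exact Perm.SameCycle.refl _ _
    | symm p q _ ih => exact ih.symm
    | trans p q t _ _ ih ih' => exact ih.trans ih'
  obtain ⟨hf₁, hf₂, hg', -⟩ := hS _ _ _ _ hg
  let w : ι → Fin 3 := fun f => if o f = 1 then 1 else 2
  -- The two corners from which rotation crosses the edge: `x` goes from `f₁` to `f₂` and `y` goes
  -- from `f₂` to `f₁`. The ends of the side in `f₁` are then the corners `x` and `r y`, and in `f₂`
  -- they are `y` and `r x`.
  let x : {p : ι × Fin 3 // p.1 ∈ S.cells} := ⟨(f₁, s₁ - w f₁), hf₁⟩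
  let y : {p : ι × Fin 3 // p.1 ∈ S.cells} := ⟨(f₂, π s₁ - w f₂), hf₂⟩
  have hxy : x ≠ y := fun h => hne (congrArg (·.1.1) h)
  obtain ⟨u, hux, huy, hurx, hury, hu⟩ := exists_arc r hxy (hcyc x y)
  have hsub : ∀ (o : ℤˣ) (s : Fin 3), (s - if o = 1 then 1 else 2) ≠ s := by decide
  have hadd : ∀ (o : ℤˣ) (s : Fin 3), (s - if o = 1 then 1 else 2) + (if o = 1 then 1 else 2) = s :=
    by decide
  have hcases : ∀ (o : ℤˣ) (a s : Fin 3), a ≠ s → a = (s - if o = 1 then 1 else 2) ∨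
      a = (s + if o = 1 then 1 else 2) := by decide
  have hrx : (r x).1 = (f₂, π s₁ + w f₂) := by
    have h1 := hr x
    rw [show x.1.2 + _ = s₁ from hadd _ _] at h1
    refine hfun h1 ⟨(hsub _ _).symm, π, hg, ?_⟩
    have := perm_add_eq (o f₁) π (s₁ - w f₁)
    rw [hadd, ← ho _ _ _ _ hg] at this
    change π s₁ + w f₂ = π (s₁ - w f₁)
    rw [this]
    exact hadd (o f₂) _
  have hry : (r y).1 = (f₁, s₁ + w f₁) := by
    have h1 := hr y
    rw [show y.1.2 + _ = π s₁ from hadd _ _] at h1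
    refine hfun h1 ⟨(hsub _ _).symm, π⁻¹, hg', ?_⟩
    have := perm_add_eq (o f₂) π⁻¹ (π s₁ - w f₂)
    rw [hadd, ← ho _ _ _ _ hg'] at this
    change s₁ + w f₁ = π⁻¹ (π s₁ - w f₂)
    have h3 : π⁻¹ (π s₁) = s₁ := by simp
    rw [h3] at this
    exact (congrArg (· + w f₁) this).trans (hadd (o f₁) _)
  have hxchar : ∀ p : {p : ι × Fin 3 // p.1 ∈ S.cells},
      (p.1.1, p.1.2 + w p.1.1) ≠ (f₁, s₁) → p ≠ x := by
    rintro p hp rfl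
    exact hp (Prod.ext rfl (hadd _ _))
  have hychar : ∀ p : {p : ι × Fin 3 // p.1 ∈ S.cells},
      (p.1.1, p.1.2 + w p.1.1) ≠ (f₂, π s₁) → p ≠ y := by
    rintro p hp rfl
    exact hp (Prod.ext rfl (hadd _ _))
  have hext : ∀ p (hp : p.1 ∈ S.cells),
      (fun z : ι × Fin 3 => if h : z.1 ∈ S.cells then u ⟨z, h⟩ else 0) p = u ⟨p, hp⟩ := fun p hp => by
    simp [hp]
  refine ⟨fun z => if h : z.1 ∈ S.cells then u ⟨z, h⟩ else 0, ?_, ?_, ?_⟩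
  · intro p q s hpq h1 h2
    obtain ⟨hs, ρ, h3, h4⟩ := hpq
    obtain ⟨hp, hq, h5, -⟩ := hS _ _ _ _ h3
    rw [hext p hp, hext q hq]
    by_cases hsp : s = (p.2 + if o p.1 = 1 then 1 else 2)
    · have h6 : r ⟨p, hp⟩ = ⟨q, hq⟩ :=
        Subtype.ext (hfun (hr ⟨p, hp⟩) ⟨by rw [← hsp]; exact hs, ρ, by rw [← hsp]; exact h3, h4⟩)
      rw [← h6]
      refine (hu _ (hxchar _ ?_) (hychar _ ?_)).symm
      · exact hsp ▸ h1
      · exact hsp ▸ h2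
    · obtain ⟨h6, ρ', h7, h8⟩ := hother ⟨p, hp⟩ ⟨q, hq⟩ s ⟨hs, ρ, h3, h4⟩ hsp
      obtain rfl : ρ = ρ' := by
        have := h3.symm.trans h7
        simpa using this
      rw [← h6]
      refine hu _ (hxchar _ ?_) (hychar _ ?_)
      · intro h9
        have h10 : (q.1, ρ s) = (f₁, s₁) := by rw [← h9]; exact Prod.ext rfl h8
        obtain ⟨h11, h12⟩ := Prod.mk.inj h10
        rw [h11, h12, hg] at h5
        simp only [Option.some.injEq, Prod.mk.injEq] at h5
        apply h2
        rw [h5.1, h5.2, ← h12]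
        simp
      · intro h9
        have h10 : (q.1, ρ s) = (f₂, π s₁) := by rw [← h9]; exact Prod.ext rfl h8
        obtain ⟨h11, h12⟩ := Prod.mk.inj h10
        rw [h11, h12, hg'] at h5
        simp only [Option.some.injEq, Prod.mk.injEq, inv_inj] at h5
        apply h1
        rw [h5.1, ρ.injective (h12.trans (by rw [h5.2]))]
  · intro a ha
    rw [hext (f₁, a) hf₁]
    rcases hcases (o f₁) a s₁ ha with h | h
    · have e : (⟨(f₁, a), hf₁⟩ : {p : ι × Fin 3 // p.1 ∈ S.cells}) = x :=
        Subtype.ext (Prod.ext rfl h)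
      rw [e, hux]
    · rw [← hury]
      exact congrArg u (Subtype.ext (by rw [hry]; exact Prod.ext rfl h))
  · intro a ha
    rw [hext (f₂, a) hf₂]
    rcases hcases (o f₂) a (π s₁) ha with h | h
    · have e : (⟨(f₂, a), hf₂⟩ : {p : ι × Fin 3 // p.1 ∈ S.cells}) = y :=
        Subtype.ext (Prod.ext rfl h)
      rw [e, huy]
    · rw [← hurx]
      exact congrArg u (Subtype.ext (by rw [hrx]; exact Prod.ext rfl h))

end GluingData

/-! ### Running the routine -/

namespace GluingData

/-- The triangulation obtained by one more gluing of faces. -/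
def glued (T : GluingData 3 ℕ) (t : ℕ) (i : Fin 4) (t' : ℕ) (π : Perm (Fin 4)) : GluingData 3 ℕ :=
  ⟨T.cells, fun s j =>
      if (s, j) = (t, i) then some (t', π)
      else if (s, j) = (t', π i) then some (t, π⁻¹)
      else T.glue s j⟩

theorem isTriangulation_glued {T : GluingData 3 ℕ} (hT : T.IsTriangulation) {t t' : ℕ} {i : Fin 4}
    {π : Perm (Fin 4)} (ht : t ∈ T.cells) (ht' : t' ∈ T.cells) (h : T.glue t i = none)
    (h' : T.glue t' (π i) = none) (hne : (t', π i) ≠ (t, i)) :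
    (T.glued t i t' π).IsTriangulation := by
  intro s j s' ρ hs
  simp only [glued] at hs ⊢
  split_ifs at hs with h1 h2
  · simp only [Option.some.injEq, Prod.mk.injEq] at hs h1
    obtain ⟨rfl, rfl⟩ := hs
    obtain ⟨rfl, rfl⟩ := h1
    exact ⟨ht, ht', by rw [if_neg hne, if_pos rfl], hne⟩
  · simp only [Option.some.injEq, Prod.mk.injEq] at hs h2
    obtain ⟨rfl, rfl⟩ := hs
    obtain ⟨rfl, rfl⟩ := h2
    have : π⁻¹ (π i) = i := by simp
    exact ⟨ht', ht, by rw [this, if_pos rfl, inv_inv], by rw [this]; exact hne.symm⟩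
  · obtain ⟨h3, h4, h5, h6⟩ := hT _ _ _ _ hs
    refine ⟨h3, h4, ?_, h6⟩
    rw [if_neg, if_neg, h5]
    · intro he
      obtain ⟨he1, he2⟩ := Prod.mk.inj he
      rw [he1, he2, h'] at h5
      cases h5
    · intro he
      obtain ⟨he1, he2⟩ := Prod.mk.inj he
      rw [he1, he2, h] at h5
      cases h5

/-- Further gluings do not disturb a finished walk if the face where it stopped stays unglued. Hence
layering over one petal leaves the petals of disjoint quadrilaterals diagonals. -/
theorem edgeWalk_mono {T T' : GluingData 3 ℕ} {i k : Fin 4}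
    (hTT' : ∀ t j r, T.glue t j = some r → T'.glue t j = some r) {m m' : ℕ} (hm : m ≤ m')
    {t : ℕ} {ρ : Perm (Fin 4)} {r : ℕ × Perm (Fin 4)} (h : T.edgeWalk i k m t ρ = some r)
    (hr : T'.glue r.1 (r.2 i) = none) : T'.edgeWalk i k m' t ρ = some r := by
  induction m generalizing m' t ρ with
  | zero => simp [edgeWalk] at h
  | succ m ih =>
    obtain ⟨n, rfl⟩ : ∃ n, m' = n + 1 := ⟨m' - 1, by omega⟩
    rw [edgeWalk] at h ⊢
    cases hg : T.glue t (ρ k) with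
    | none =>
      simp only [hg, Option.some.injEq] at h
      subst h
      simp only [Perm.mul_apply, swap_apply_left] at hr
      simp [hr]
    | some s =>
      simp only [hg, hTT' _ _ _ hg] at h ⊢
      exact ih (by omega) h

end GluingData

open GluingData

theorem EdgeRef.IsDiagonal.mono {e : EdgeRef} {T T' : GluingData 3 ℕ} (h : e.IsDiagonal T)
    (hc : T.cells ⊆ T'.cells) (hTT' : ∀ t j r, T.glue t j = some r → T'.glue t j = some r)
    (h₁ : T'.glue e.t₁ (e.σ₁ 3) = none) (h₂ : T'.glue e.t₂ (e.σ₂ 3) = none) : e.IsDiagonal T' := by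
  obtain ⟨a, b, -, -, c, d⟩ := h
  refine ⟨hc a, hc b, h₁, h₂, edgeWalk_mono hTT' ?_ c ?_, d⟩
  · exact Nat.mul_le_mul_left _ (Finset.card_le_card hc)
  · simpa using h₂

namespace Routine

theorem bind_run {α β : Type} {x : Routine α} {f : α → Routine β} {T T' T'' : GluingData 3 ℕ}
    {a : α} {b : β} {m n : ℕ} (h : x T = some (a, T', m)) (h' : f a T' = some (b, T'', n)) :
    (x >>= f) T = some (b, T'', m + n) := by
  change (x T).bind (fun r => (f r.1 r.2.1).map fun r' => (r'.1, r'.2.1, r.2.2 + r'.2.2)) = _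
  rw [h]
  simp [h']

theorem require_run {p : GluingData 3 ℕ → Prop} [DecidablePred p] {T : GluingData 3 ℕ} (h : p T) :
    require p T = some ((), T, 0) := if_pos h

theorem glueFaces_run {T : GluingData 3 ℕ} {t t' : ℕ} {i : Fin 4}
    {π : Perm (Fin 4)} (ht : t ∈ T.cells) (ht' : t' ∈ T.cells) (h : T.glue t i = none)
    (h' : T.glue t' (π i) = none) (hne : (t', π i) ≠ (t, i)) :
    glueFaces t i t' π T = some ((), T.glued t i t' π, 1) :=
  if_pos ⟨ht, ht', h, h', hne⟩

/-- The gluings of the tetrahedron `c` layered over the edge `e`. -/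
structure Layered (T : GluingData 3 ℕ) (e : EdgeRef) (c : ℕ) : Prop where
  glue₁ : T.glue e.t₁ (e.σ₁ 3) = some (c, e.σ₁⁻¹)
  glue₂ : T.glue e.t₂ (e.σ₂ 3) = some (c, swap 2 3 * e.σ₂⁻¹)
  glue3 : T.glue c 3 = some (e.t₁, e.σ₁)
  glue2 : T.glue c 2 = some (e.t₂, e.σ₂ * swap 2 3)

theorem Layered.of_glue {T T' : GluingData 3 ℕ} {e : EdgeRef} {c : ℕ} (h : Layered T e c)
    (hT : ∀ t j r, T.glue t j = some r → T'.glue t j = some r) : Layered T' e c :=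
  ⟨hT _ _ _ h.glue₁, hT _ _ _ h.glue₂, hT _ _ _ h.glue3, hT _ _ _ h.glue2⟩

theorem layer_run {T : GluingData 3 ℕ} (hT : T.IsTriangulation) {e : EdgeRef}
    (he : e.IsDiagonal T) : ∃ c T', layer e T = some (c, T', 3) ∧ T'.IsTriangulation ∧
      c ∉ T.cells ∧ T'.cells = insert c T.cells ∧ Layered T' e c ∧
      T'.glue c 0 = none ∧ T'.glue c 1 = none ∧
      ∀ t ∈ T.cells, ∀ j, (t, j) ≠ e.face₁ → (t, j) ≠ e.face₂ → T'.glue t j = T.glue t j := by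
  -- The name chosen by `addTet`, larger than every name in use.
  set c := T.cells.sup (· + 1) with hc
  have hcT : c ∉ T.cells := by
    intro h
    have := Finset.le_sup (f := (· + 1)) h
    simp only [← hc] at this
    omega
  obtain ⟨h1, h2, h3, h4, h5, h6⟩ := he
  have hn1 : e.t₁ ≠ c := fun h => hcT (h ▸ h1)
  have hn2 : e.t₂ ≠ c := fun h => hcT (h ▸ h2)
  have hgc : ∀ j, T.glue c j = none := by
    intro j
    cases h : T.glue c j with
    | none => rfl
    | some r => exact absurd (hT _ _ _ _ h).1 hcT
  let Ta : GluingData 3 ℕ := ⟨insert c T.cells, T.glue⟩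
  have hTa : Ta.IsTriangulation := fun t i t' π h => by
    obtain ⟨a, b, d⟩ := hT t i t' π h
    exact ⟨Finset.mem_insert_of_mem a, Finset.mem_insert_of_mem b, d⟩
  have e1 : e.σ₁⁻¹ (e.σ₁ 3) = 3 := by simp
  have e2 : (swap 2 3 * e.σ₂⁻¹ : Perm (Fin 4)) (e.σ₂ 3) = 2 := by simp
  let Tb := Ta.glued e.t₁ (e.σ₁ 3) c e.σ₁⁻¹
  have hb1 : e.t₁ ∈ Ta.cells := Finset.mem_insert_of_mem h1
  have hb2 : c ∈ Ta.cells := Finset.mem_insert_self _ _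
  have hb3 : (c, e.σ₁⁻¹ (e.σ₁ 3)) ≠ (e.t₁, e.σ₁ 3) := fun h => hn1 (congrArg Prod.fst h).symm
  have hTb : Tb.IsTriangulation := isTriangulation_glued hTa hb1 hb2 h3 (hgc _) hb3
  let Tc := Tb.glued e.t₂ (e.σ₂ 3) c (swap 2 3 * e.σ₂⁻¹)
  have hc1 : e.t₂ ∈ Tb.cells := Finset.mem_insert_of_mem h2
  have hne : ¬ ((e.t₂, e.σ₂ 3) = (e.t₁, e.σ₁ 3)) := fun h => h6 h.symm
  have hc2 : Tb.glue e.t₂ (e.σ₂ 3) = none := by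
    simp only [Tb, glued]
    rw [if_neg hne, if_neg (fun h => hn2 (congrArg Prod.fst h)), ← h4]
  have hc3 : Tb.glue c ((swap 2 3 * e.σ₂⁻¹ : Perm (Fin 4)) (e.σ₂ 3)) = none := by
    simp only [Tb, glued]
    rw [if_neg (fun h => hn1 (congrArg Prod.fst h).symm), if_neg, ← hgc 2, e2]
    rw [e1, e2]
    simp
  have hc4 : (c, (swap 2 3 * e.σ₂⁻¹ : Perm (Fin 4)) (e.σ₂ 3)) ≠ (e.t₂, e.σ₂ 3) :=
    fun h => hn2 (congrArg Prod.fst h).symm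
  have hTc : Tc.IsTriangulation := isTriangulation_glued hTb hc1 hb2 hc2 hc3 hc4
  -- All gluings after both attachments: the faces opposite `3` and `2` of the new tetrahedron are
  -- used, and those opposite `0` and `1` stay free for the fold.
  have hv : ∀ s j, Tc.glue s j = if (s, j) = (e.t₂, e.σ₂ 3) then some (c, swap 2 3 * e.σ₂⁻¹)
      else if (s, j) = (c, 2) then some (e.t₂, (swap 2 3 * e.σ₂⁻¹)⁻¹)
      else if (s, j) = (e.t₁, e.σ₁ 3) then some (c, e.σ₁⁻¹)
      else if (s, j) = (c, 3) then some (e.t₁, e.σ₁⁻¹⁻¹) else T.glue s j := by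
    intro s j
    simp only [Tc, Tb, glued, e1, e2]
    rfl
  refine ⟨c, Tc, ?_, hTc, hcT, rfl, ⟨?_, ?_, ?_, ?_⟩, ?_, ?_, ?_⟩
  · exact bind_run (m := 0) (n := 3) (require_run ⟨h1, h2, h3, h4, h5, h6⟩)
      (bind_run (T' := Ta) (m := 1) (n := 2) rfl (bind_run (T' := Tb) (m := 1) (n := 1)
        (glueFaces_run hb1 hb2 h3 (hgc _) hb3)
        (bind_run (T' := Tc) (m := 1) (n := 0) (glueFaces_run hc1 hb2 hc2 hc3 hc4) rfl)))
  · rw [hv, if_neg (fun h => hne h.symm), if_neg (fun h => hn1 (congrArg Prod.fst h)), if_pos rfl]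
  · rw [hv, if_pos rfl]
  · rw [hv, if_neg (fun h => hn2 (congrArg Prod.fst h).symm), if_neg (by simp),
      if_neg (fun h => hn1 (congrArg Prod.fst h).symm), if_pos rfl, inv_inv]
  · rw [hv, if_neg (fun h => hn2 (congrArg Prod.fst h).symm), if_pos rfl]
    simp
  · rw [hv, if_neg (fun h => hn2 (congrArg Prod.fst h).symm), if_neg (by simp),
      if_neg (fun h => hn1 (congrArg Prod.fst h).symm), if_neg (by simp), hgc]
  · rw [hv, if_neg (fun h => hn2 (congrArg Prod.fst h).symm), if_neg (by simp),
      if_neg (fun h => hn1 (congrArg Prod.fst h).symm), if_neg (by simp), hgc]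
  · intro t ht j hj1 hj2
    have htc : t ≠ c := fun h => hcT (h ▸ ht)
    rw [hv, if_neg (show ¬ (t, j) = (e.t₂, e.σ₂ 3) from hj2), if_neg (fun h => htc (congrArg Prod.fst h)),
      if_neg (show ¬ (t, j) = (e.t₁, e.σ₁ 3) from hj1),
      if_neg (fun h => htc (congrArg Prod.fst h))]

/-- Each petal costs one control step, one new tetrahedron and two gluings, and the end of the list
costs one more step. The induction goes through because the remaining petals are still diagonals
after the first layering, by `EdgeRef.IsDiagonal.mono`. -/
theorem layerAll_run {T : GluingData 3 ℕ} (hT : T.IsTriangulation) (es : List EdgeRef)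
    (he : ∀ e ∈ es, e.IsDiagonal T)
    (hd : es.Pairwise fun e e' => Disjoint ({e.face₁, e.face₂} : Finset (ℕ × Fin 4))
      {e'.face₁, e'.face₂}) :
    ∃ ts T', layerAll es T = some (ts, T', 4 * es.length + 1) ∧ T'.IsTriangulation ∧
      ts.length = es.length ∧ ts.Nodup ∧ (∀ t ∈ ts, t ∉ T.cells) ∧
      T'.cells = T.cells ∪ ts.toFinset ∧ (∀ p ∈ es.zip ts, Layered T' p.1 p.2) ∧
      (∀ c ∈ ts, T'.glue c 0 = none ∧ T'.glue c 1 = none) ∧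
      ∀ t ∈ T.cells, ∀ j, (∀ e ∈ es, (t, j) ≠ e.face₁ ∧ (t, j) ≠ e.face₂) →
        T'.glue t j = T.glue t j := by
  induction es generalizing T with
  | nil => exact ⟨[], T, rfl, hT, rfl, List.nodup_nil, by simp, by simp, by simp, by simp, by simp⟩
  | cons e es ih =>
    obtain ⟨hd1, hd2⟩ := List.pairwise_cons.1 hd
    have hde := he e List.mem_cons_self
    obtain ⟨c, Ta, h1, h2, h3, h4, h5, h6, h7, h8⟩ := layer_run hT hde
    have hmono : ∀ t j r, T.glue t j = some r → Ta.glue t j = some r := by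
      intro t j r h
      rw [h8 t (hT _ _ _ _ h).1 j, h]
      · rintro h'
        obtain ⟨rfl, rfl⟩ := Prod.mk.inj h'
        rw [hde.2.2.1] at h
        cases h
      · rintro h'
        obtain ⟨rfl, rfl⟩ := Prod.mk.inj h'
        rw [hde.2.2.2.1] at h
        cases h
    have hfaces : ∀ e' ∈ es, ∀ f, (f = e'.face₁ ∨ f = e'.face₂) → f ≠ e.face₁ ∧ f ≠ e.face₂ := by
      intro e' he' f hf
      have := Finset.disjoint_right.1 (hd1 e' he')
        (show f ∈ ({e'.face₁, e'.face₂} : Finset (ℕ × Fin 4)) by simpa using hf)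
      simpa using this
    have hdiag : ∀ e' ∈ es, e'.IsDiagonal Ta := by
      intro e' he'
      have hde' := he e' (List.mem_cons_of_mem _ he')
      refine hde'.mono (h4 ▸ Finset.subset_insert _ _) hmono ?_ ?_
      · have := hfaces e' he' _ (Or.inl rfl)
        rw [h8 _ hde'.1 _ this.1 this.2, hde'.2.2.1]
      · have := hfaces e' he' _ (Or.inr rfl)
        rw [h8 _ hde'.2.1 _ this.1 this.2, hde'.2.2.2.1]
    obtain ⟨ts, Tb, i1, i2, i3, i4, i5, i6, i7, i8, i9⟩ := ih h2 hdiag hd2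
    have hcts : c ∉ ts := fun h => i5 c h (h4 ▸ Finset.mem_insert_self _ _)
    have hTTa : T.cells ⊆ Ta.cells := h4 ▸ Finset.subset_insert _ _
    have hcTa : c ∈ Ta.cells := h4 ▸ Finset.mem_insert_self _ _
    have hce : ∀ j, ∀ e' ∈ es, (c, j) ≠ e'.face₁ ∧ (c, j) ≠ e'.face₂ := by
      intro j e' he'
      have hde' := he e' (List.mem_cons_of_mem _ he')
      constructor
      · intro h
        have hh : c = e'.t₁ := congrArg Prod.fst h
        exact h3 (by rw [hh]; exact hde'.1)
      · intro h
        have hh : c = e'.t₂ := congrArg Prod.fst h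
        exact h3 (by rw [hh]; exact hde'.2.1)
    refine ⟨c :: ts, Tb, ?_, i2, by simp [i3], List.nodup_cons.2 ⟨hcts, i4⟩, ?_, ?_, ?_, ?_, ?_⟩
    · have : layerAll (e :: es) T =
          some (c :: ts, Tb, 1 + (3 + (4 * es.length + 1 + 0))) :=
        bind_run (T' := T) (a := ()) rfl (bind_run h1 (bind_run i1 rfl))
      have hlen : 1 + (3 + (4 * es.length + 1 + 0)) = 4 * (e :: es).length + 1 := by
        simp
        omega
      rw [hlen] at this
      exact this
    · intro t ht
      rcases List.mem_cons.1 ht with rfl | ht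
      · exact h3
      · exact fun h => i5 t ht (hTTa h)
    · rw [i6, h4, List.toFinset_cons, Finset.insert_union, Finset.union_insert]
    · intro p hp
      rw [List.zip_cons_cons] at hp
      rcases List.mem_cons.1 hp with rfl | hp
      · refine ⟨?_, ?_, ?_, ?_⟩
        · rw [i9 _ (hTTa hde.1), h5.glue₁]
          intro e' he'
          exact ⟨fun h => (hfaces e' he' _ (Or.inl h)).1 rfl, fun h => (hfaces e' he' _ (Or.inr h)).1 rfl⟩
        · rw [i9 _ (hTTa hde.2.1), h5.glue₂]
          intro e' he'
          exact ⟨fun h => (hfaces e' he' _ (Or.inl h)).2 rfl, fun h => (hfaces e' he' _ (Or.inr h)).2 rfl⟩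
        · rw [i9 _ hcTa _ (hce _), h5.glue3]
        · rw [i9 _ hcTa _ (hce _), h5.glue2]
      · exact i7 p hp
    · intro c' hc'
      rcases List.mem_cons.1 hc' with rfl | hc'
      · rw [i9 _ hcTa _ (hce _), i9 _ hcTa _ (hce _)]
        exact ⟨h6, h7⟩
      · exact i8 c' hc'
    · intro t ht j hj
      rw [i9 t (hTTa ht) j fun e' he' => hj e' (List.mem_cons_of_mem _ he')]
      exact h8 t ht j (hj e List.mem_cons_self).1 (hj e List.mem_cons_self).2

theorem fold_run {T : GluingData 3 ℕ} (hT : T.IsTriangulation) {c : ℕ} (hc : c ∈ T.cells)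
    (h0 : T.glue c 0 = none) (h1 : T.glue c 1 = none) :
    fold (newEdge c) T = some ((), T.glued c 0 c (swap 0 1), 1) ∧
      (T.glued c 0 c (swap 0 1)).IsTriangulation := by
  have e1 : (newEdge c).σ₁ 3 = 0 := by simp only [newEdge]; decide
  have e2 : (newEdge c).σ₁ 2 = 1 := by simp only [newEdge]; decide
  have e3 : (newEdge c).σ₂ 3 = 1 := by simp only [newEdge]; decide
  have e4 : (newEdge c).σ₂ * (newEdge c).σ₁⁻¹ = swap 0 1 := by simp only [newEdge]; decide
  have hs : (swap 0 1 : Perm (Fin 4)) 0 = 1 := by decide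
  have hne : (c, (swap 0 1 : Perm (Fin 4)) 0) ≠ (c, 0) := by simp
  refine ⟨?_, isTriangulation_glued hT hc hc h0 (by rwa [hs]) hne⟩
  refine bind_run (m := 0) (n := 1) (T' := T) (require_run ⟨hc, hc, ?_, ?_, ?_, ?_⟩) ?_
  · rwa [e1]
  · rwa [e3]
  · rw [e1, e2, e4]
    have : 0 < 24 * T.cells.card := by
      have := Finset.card_pos.2 ⟨c, hc⟩
      omega
    -- The two faces at the new edge belong to the same tetrahedron and are both unglued, so the
    -- walk stops at once and needs only a positive bound.
    obtain ⟨n, hn⟩ : ∃ n, 24 * T.cells.card = n + 1 := ⟨24 * T.cells.card - 1, by omega⟩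
    have h1' : T.glue (newEdge c).t₁ ((1 : Perm (Fin 4)) 1) = none := h1
    rw [acrossEdge, hn, edgeWalk, h1']
    rfl
  · simp [EdgeRef.face₁, EdgeRef.face₂, e1, e3]
  · rw [e1, e4]
    exact glueFaces_run hc hc h0 (by rwa [hs]) hne

theorem foldAll_run {T : GluingData 3 ℕ} (hT : T.IsTriangulation) (ts : List ℕ) (hn : ts.Nodup)
    (hts : ∀ c ∈ ts, c ∈ T.cells ∧ T.glue c 0 = none ∧ T.glue c 1 = none) :
    ∃ T', foldAll ts T = some ((), T', 2 * ts.length + 1) ∧ T'.IsTriangulation ∧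
      T'.cells = T.cells ∧ (∀ c ∈ ts, T'.glue c 0 = some (c, swap 0 1) ∧
        T'.glue c 1 = some (c, swap 0 1)) ∧
      ∀ t j, (t ∈ ts → j ≠ 0 ∧ j ≠ 1) → T'.glue t j = T.glue t j := by
  induction ts generalizing T with
  | nil => exact ⟨T, rfl, hT, rfl, by simp, fun _ _ _ => rfl⟩
  | cons c ts ih =>
    obtain ⟨hn1, hn2⟩ := List.nodup_cons.1 hn
    obtain ⟨hc, h0, h1⟩ := hts c List.mem_cons_self
    obtain ⟨hr, hTa⟩ := fold_run hT hc h0 h1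
    have hs : (swap 0 1 : Perm (Fin 4)) 0 = 1 := by decide
    have hv : ∀ t j, (T.glued c 0 c (swap 0 1)).glue t j =
        if (t, j) = (c, 0) then some (c, swap 0 1) else if (t, j) = (c, 1) then some (c, swap 0 1)
        else T.glue t j := by
      intro t j
      simp only [glued, hs, swap_inv]
    have hTa' : ∀ c' ∈ ts, c' ∈ (T.glued c 0 c (swap 0 1)).cells ∧
        (T.glued c 0 c (swap 0 1)).glue c' 0 = none ∧
        (T.glued c 0 c (swap 0 1)).glue c' 1 = none := by
      intro c' hc'
      have hne : c' ≠ c := fun h => hn1 (h ▸ hc')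
      obtain ⟨i1, i2, i3⟩ := hts c' (List.mem_cons_of_mem _ hc')
      rw [hv, hv]
      simp only [Prod.mk.injEq, hne, false_and, if_false]
      exact ⟨i1, i2, i3⟩
    obtain ⟨T', j1, j2, j3, j4, j5⟩ := ih hTa hn2 hTa'
    refine ⟨T', ?_, j2, j3, ?_, ?_⟩
    · have : foldAll (c :: ts) T = some ((), T', 1 + (1 + (2 * ts.length + 1))) :=
        bind_run (T' := T) (a := ()) rfl (bind_run hr j1)
      have hlen : 1 + (1 + (2 * ts.length + 1)) = 2 * (c :: ts).length + 1 := by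
        simp
        omega
      rw [hlen] at this
      exact this
    · intro c' hc'
      rcases List.mem_cons.1 hc' with rfl | hc'
      · rw [j5 _ _ fun h => absurd h hn1, j5 _ _ fun h => absurd h hn1, hv, hv]
        simp
      · exact j4 c' hc'
    · intro t j htj
      rw [j5 t j fun h => htj (List.mem_cons_of_mem _ h), hv, if_neg, if_neg]
      · rintro h
        obtain ⟨rfl, rfl⟩ := Prod.mk.inj h
        exact (htj List.mem_cons_self).2 rfl
      · rintro h
        obtain ⟨rfl, rfl⟩ := Prod.mk.inj h
        exact (htj List.mem_cons_self).1 rfl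

end Routine

/-- `T'` is obtained from `T` by layering the tetrahedra `c k` over the edges `P k` and folding. -/
structure IsWedgeFolding {g : ℕ} (T T' : GluingData 3 ℕ) (P : Fin g → EdgeRef) (c : Fin g → ℕ) :
    Prop where
  isTriangulation : T'.IsTriangulation
  injective : Function.Injective c
  notMem : ∀ k, c k ∉ T.cells
  mem_cells : ∀ t, t ∈ T'.cells ↔ t ∈ T.cells ∨ ∃ k, t = c k
  layered : ∀ k, Routine.Layered T' (P k) (c k)
  glue0 : ∀ k, T'.glue (c k) 0 = some (c k, swap 0 1)
  glue1 : ∀ k, T'.glue (c k) 1 = some (c k, swap 0 1)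
  glue_old : ∀ t ∈ T.cells, ∀ j, (∀ k, (t, j) ≠ (P k).face₁ ∧ (t, j) ≠ (P k).face₂) →
    T'.glue t j = T.glue t j

theorem Routine.wedgeFolder_run {g : ℕ} {T : GluingData 3 ℕ} (hT : T.IsTriangulation)
    {P : Fin g → EdgeRef} (hP : ∀ k, (P k).IsDiagonal T)
    (hd : ∀ k l, k ≠ l →
      Disjoint ({(P k).face₁, (P k).face₂} : Finset (ℕ × Fin 4)) {(P l).face₁, (P l).face₂}) :
    ∃ T' c, Routine.wedgeFolder (List.ofFn P) T = some ((), T', 6 * g + 2) ∧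
      IsWedgeFolding T T' P c := by
  obtain ⟨ts, Ta, h1, h2, h3, h4, h5, h6, h7, h8, h9⟩ := layerAll_run hT (List.ofFn P)
    (by simpa [List.mem_ofFn] using hP)
    (List.pairwise_ofFn.2 fun k l hkl => hd k l hkl.ne)
  obtain ⟨T', i1, i2, i3, i4, i5⟩ := foldAll_run h2 ts h4 (fun c hc =>
    ⟨by rw [h6]; exact Finset.mem_union_right _ (List.mem_toFinset.2 hc), h8 c hc⟩)
  rw [List.length_ofFn] at h1 h3
  rw [h3] at i1
  have hrun := bind_run (x := layerAll (List.ofFn P)) (f := foldAll) h1 i1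
  rw [show 4 * g + 1 + (2 * g + 1) = 6 * g + 2 by omega] at hrun
  let c : Fin g → ℕ := fun k => ts[k.val]'(by rw [h3]; exact k.2)
  have hcmem : ∀ k, c k ∈ ts := fun k => List.getElem_mem _
  have hex : ∀ t ∈ ts, ∃ k, t = c k := by
    intro t ht
    obtain ⟨i, hi, rfl⟩ := List.getElem_of_mem ht
    exact ⟨⟨i, by rw [← h3]; exact hi⟩, rfl⟩
  have hsome : ∀ t j r, Ta.glue t j = some r → T'.glue t j = some r := by
    intro t j r h
    rw [i5, h]
    intro ht
    constructor
    · rintro rfl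
      rw [(h8 t ht).1] at h
      cases h
    · rintro rfl
      rw [(h8 t ht).2] at h
      cases h
  refine ⟨T', c, hrun, i2, ?_, fun k => h5 _ (hcmem k), ?_, ?_, fun k => (i4 _ (hcmem k)).1,
    fun k => (i4 _ (hcmem k)).2, ?_⟩
  · intro k l h
    have := (h4.getElem_inj_iff).1 h
    exact Fin.ext this
  · intro t
    rw [i3, h6, Finset.mem_union, List.mem_toFinset]
    refine or_congr_right ⟨hex t, ?_⟩
    rintro ⟨k, rfl⟩
    exact hcmem k
  · intro k
    refine (h7 (P k, c k) ?_).of_glue hsome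
    rw [List.mem_iff_getElem]
    refine ⟨k.val, by simp [h3], by simp [c]⟩
  · intro t ht j hj
    rw [i5, h9 t ht j]
    · simpa [List.mem_ofFn] using hj
    · exact fun h => absurd ht (h5 t h)

/-! ### The triangulation after folding -/

namespace EdgeRef

/-- One of the two faces at an edge, with the edge, as a flag. -/
def flag (e : EdgeRef) (b : Bool) : ℕ × Perm (Fin 4) := if b then (e.t₁, e.σ₁) else (e.t₂, e.σ₂)

theorem IsDiagonal.isFree {e : EdgeRef} {T : GluingData 3 ℕ} (h : e.IsDiagonal T) (b : Bool) :
    T.IsFree (e.flag b) := by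
  cases b
  · exact ⟨h.2.1, h.2.2.2.1⟩
  · exact ⟨h.1, h.2.2.1⟩

theorem IsDiagonal.across_true {e : EdgeRef} {T : GluingData 3 ℕ} (h : e.IsDiagonal T) :
    T.across (e.flag true) = some (e.flag false) :=
  acrossEdge_eq_some.1 h.2.2.2.2.1

theorem IsDiagonal.across_flag {e : EdgeRef} {T : GluingData 3 ℕ} (hT : T.IsTriangulation)
    (h : e.IsDiagonal T) (b : Bool) : T.across (e.flag b) = some (e.flag !b) := by
  cases b
  · exact across_symm hT (h.isFree true) h.across_true
  · exact h.across_true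

end EdgeRef

namespace GluingData

/-- The sides of the face of a flag, apart from the edge of the flag. They run to the third vertex of
the face if `d` is true and away from it otherwise. -/
def apexEdge (x : ℕ × Perm (Fin 4)) (d j : Bool) : ℕ × Fin 4 × Fin 4 :=
  if d then (x.1, x.2 (if j then 1 else 0), x.2 2) else (x.1, x.2 2, x.2 (if j then 1 else 0))

theorem revEdge_apexEdge (x : ℕ × Perm (Fin 4)) (d j : Bool) :
    revEdge (apexEdge x d j) = apexEdge x (!d) j := by
  cases d <;> rfl

theorem edgeStep_of_glue {T : GluingData 3 ℕ} {t t' : ℕ} {i a b : Fin 4} {π : Perm (Fin 4)}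
    (h : T.glue t i = some (t', π)) (hab : a ≠ b) (ha : i ≠ a) (hb : i ≠ b) :
    T.EdgeStep (t, a, b) (t', π a, π b) :=
  ⟨hab, i, π, ha, hb, h, rfl, rfl⟩

end GluingData

namespace IsWedgeFolding

variable {g : ℕ} {T T' : GluingData 3 ℕ} {P : Fin g → EdgeRef} {c : Fin g → ℕ}

theorem ne_of_mem (hW : IsWedgeFolding T T' P c) {t : ℕ} (ht : t ∈ T.cells) (k : Fin g) :
    t ≠ c k := fun h => hW.notMem k (h ▸ ht)

theorem glue_some (hW : IsWedgeFolding T T' P c) (hT : T.IsTriangulation)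
    (hP : ∀ k, (P k).IsDiagonal T) {t : ℕ} {j : Fin 4} {r : ℕ × Perm (Fin 4)}
    (h : T.glue t j = some r) : T'.glue t j = some r := by
  rw [hW.glue_old t (hT _ _ _ _ h).1 j, h]
  intro k
  constructor
  · intro h'
    obtain ⟨rfl, rfl⟩ := Prod.mk.inj h'
    rw [(hP k).2.2.1] at h
    cases h
  · intro h'
    obtain ⟨rfl, rfl⟩ := Prod.mk.inj h'
    rw [(hP k).2.2.2.1] at h
    cases h

theorem glue_cases (hW : IsWedgeFolding T T' P c)
    {t : ℕ} {i : Fin 4} {r : ℕ × Perm (Fin 4)} (h : T'.glue t i = some r) :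
    (t ∈ T.cells ∧ T.glue t i = some r) ∨
    ∃ k, (t = (P k).t₁ ∧ i = (P k).σ₁ 3 ∧ r = (c k, (P k).σ₁⁻¹)) ∨
      (t = (P k).t₂ ∧ i = (P k).σ₂ 3 ∧ r = (c k, swap 2 3 * (P k).σ₂⁻¹)) ∨
      (t = c k ∧ i = 3 ∧ r = ((P k).t₁, (P k).σ₁)) ∨
      (t = c k ∧ i = 2 ∧ r = ((P k).t₂, (P k).σ₂ * swap 2 3)) ∨
      (t = c k ∧ i = 0 ∧ r = (c k, swap 0 1)) ∨ (t = c k ∧ i = 1 ∧ r = (c k, swap 0 1)) := by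
  rcases (hW.mem_cells t).1 (hW.isTriangulation _ _ _ _ h).1 with ht | ⟨k, rfl⟩
  · by_cases hq : ∀ k, (t, i) ≠ (P k).face₁ ∧ (t, i) ≠ (P k).face₂
    · left
      rw [hW.glue_old t ht i hq] at h
      exact ⟨ht, h⟩
    · right
      push Not at hq
      obtain ⟨k, hk⟩ := hq
      refine ⟨k, ?_⟩
      by_cases h1 : (t, i) = (P k).face₁
      · obtain ⟨rfl, rfl⟩ := Prod.mk.inj h1
        rw [(hW.layered k).glue₁] at h
        exact Or.inl ⟨rfl, rfl, (Option.some.inj h).symm⟩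
      · obtain ⟨rfl, rfl⟩ := Prod.mk.inj (hk h1)
        rw [(hW.layered k).glue₂] at h
        exact Or.inr (Or.inl ⟨rfl, rfl, (Option.some.inj h).symm⟩)
  · right
    refine ⟨k, Or.inr (Or.inr ?_)⟩
    fin_cases i
    · have := hW.glue0 k
      exact Or.inr (Or.inr (Or.inl ⟨rfl, rfl, Option.some.inj (h.symm.trans this)⟩))
    · have := hW.glue1 k
      exact Or.inr (Or.inr (Or.inr ⟨rfl, rfl, Option.some.inj (h.symm.trans this)⟩))
    · have := (hW.layered k).glue2
      exact Or.inr (Or.inl ⟨rfl, rfl, Option.some.inj (h.symm.trans this)⟩)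
    · have := (hW.layered k).glue3
      exact Or.inl ⟨rfl, rfl, Option.some.inj (h.symm.trans this)⟩

/-- The sign of a layered tetrahedron is forced by its first attaching face. By `sign_across` the
second face demands the same sign (`h3`). The fold is compatible with any sign because `swap 0 1` is
odd. -/
theorem isOrientable (hW : IsWedgeFolding T T' P c) (hT : T.IsTriangulation)
    (hP : ∀ k, (P k).IsDiagonal T) (ho : T.IsOrientable) : T'.IsOrientable := by
  classical
  obtain ⟨o, ho⟩ := ho
  let o' : ℕ → ℤˣ := fun t =>
    if h : ∃ k, t = c k then -(Perm.sign (P h.choose).σ₁ * o (P h.choose).t₁) else o t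
  have h1 : ∀ k, o' (c k) = -(Perm.sign (P k).σ₁ * o (P k).t₁) := by
    intro k
    have hex : ∃ l, c k = c l := ⟨k, rfl⟩
    have : hex.choose = k := (hW.injective hex.choose_spec).symm
    simp only [o', dif_pos hex, this]
  have h2 : ∀ t ∈ T.cells, o' t = o t := by
    intro t ht
    exact dif_neg (fun ⟨k, hk⟩ => hW.ne_of_mem ht k hk)
  have h3 : ∀ k, o' (c k) = Perm.sign (P k).σ₂ * o (P k).t₂ := by
    intro k
    have := sign_across ho (hP k).across_true
    simp only [EdgeRef.flag, if_true, Bool.false_eq_true, if_false] at this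
    rw [h1, mul_comm, mul_comm (Perm.sign _), this]
  have hs : Perm.sign (swap 2 3 : Perm (Fin 4)) = -1 := by decide
  have hs' : Perm.sign (swap 0 1 : Perm (Fin 4)) = -1 := by decide
  have hsq : ∀ u v : ℤˣ, u * (u * v) = v := fun u v => by
    rw [← mul_assoc, Int.units_mul_self, one_mul]
  refine ⟨o', ?_⟩
  intro t i t' π hg
  rcases hW.glue_cases hg with ⟨ht, h⟩ | ⟨k, h⟩
  · rw [h2 t ht, h2 t' (hT _ _ _ _ h).2.1]
    exact ho _ _ _ _ h
  · have e1 := (h2 _ (hP k).1)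
    have e2 := (h2 _ (hP k).2.1)
    rcases h with ⟨rfl, rfl, h⟩ | ⟨rfl, rfl, h⟩ | ⟨rfl, rfl, h⟩ | ⟨rfl, rfl, h⟩ | ⟨rfl, rfl, h⟩ |
      ⟨rfl, rfl, h⟩ <;> obtain ⟨rfl, rfl⟩ := Prod.mk.inj h
    · rw [h1, e1, Perm.sign_inv, neg_mul]
    · rw [h3, e2, map_mul, hs, Perm.sign_inv, neg_mul, neg_one_mul, neg_mul, neg_neg]
    · rw [h1, e1, neg_mul_neg, hsq]
    · rw [h3, e2, map_mul, hs, mul_neg_one, neg_neg, hsq]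
    · rw [hs', neg_neg, one_mul]
    · rw [hs', neg_neg, one_mul]

/-- No vertex is new: the vertices `0`, `1`, `2` of a layered tetrahedron lie in its face glued to
the first triangle at the petal, and `3` lies in the face glued to the second. -/
theorem oneVertex (hW : IsWedgeFolding T T' P c) (hT : T.IsTriangulation)
    (hP : ∀ k, (P k).IsDiagonal T) (hv : T.OneVertex) : T'.OneVertex := by
  have hsub : ∀ t, t ∈ T.cells → t ∈ T'.cells := fun t ht => (hW.mem_cells t).2 (Or.inl ht)
  obtain ⟨hs, ⟨v⟩⟩ := Nat.card_eq_one_iff_unique.1 hv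
  obtain ⟨p₀, -⟩ := Quot.exists_rep v
  have hold : ∀ p : {p : ℕ × Fin 4 // p.1 ∈ T.cells},
      T'.vertexOf ⟨p.1, hsub _ p.2⟩ = T'.vertexOf ⟨p₀.1, hsub _ p₀.2⟩ := by
    intro p
    have h : T.vertexOf p = T.vertexOf p₀ := Subsingleton.elim _ _
    exact congrArg (Quot.lift (fun p : {p : ℕ × Fin 4 // p.1 ∈ T.cells} =>
      T'.vertexOf ⟨p.1, hsub _ p.2⟩) fun a b ⟨i, π, h1, h2, h3⟩ =>
        Quot.sound ⟨i, π, h1, hW.glue_some hT hP h2, h3⟩) h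
  refine Nat.card_eq_one_iff_unique.2 ⟨⟨?_⟩, ⟨T'.vertexOf ⟨p₀.1, hsub _ p₀.2⟩⟩⟩
  suffices H : ∀ p, T'.vertexOf p = T'.vertexOf ⟨p₀.1, hsub _ p₀.2⟩ by
    rintro ⟨p⟩ ⟨q⟩
    exact (H p).trans (H q).symm
  rintro ⟨⟨t, i⟩, hp⟩
  rcases (hW.mem_cells t).1 hp with ht | ⟨k, rfl⟩
  · exact hold ⟨(t, i), ht⟩
  · by_cases hi : i = 3
    · refine (?_ : _ = T'.vertexOf ⟨((P k).t₂, (P k).σ₂ 2), hsub _ (hP k).2.1⟩).trans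
        (hold ⟨((P k).t₂, (P k).σ₂ 2), (hP k).2.1⟩)
      refine Quot.sound ⟨2, _, ?_, (hW.layered k).glue2, ?_⟩
      · simp [hi]
      · simp [hi]
    · refine (?_ : _ = T'.vertexOf ⟨((P k).t₁, (P k).σ₁ i), hsub _ (hP k).1⟩).trans
        (hold ⟨((P k).t₁, (P k).σ₁ i), (hP k).1⟩)
      exact Quot.sound ⟨3, _, Ne.symm hi, (hW.layered k).glue3, rfl⟩

theorem link_isConnected (hW : IsWedgeFolding T T' P c) (hT : T.IsTriangulation)
    (hP : ∀ k, (P k).IsDiagonal T) (hc : T.link.IsConnected) : T'.link.IsConnected := by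
  have hsub : ∀ t, t ∈ T.cells → t ∈ T'.cells := fun t ht => (hW.mem_cells t).2 (Or.inl ht)
  have hlink := link_isTriangulation hW.isTriangulation
  obtain ⟨⟨f, hf⟩, hc⟩ := hc
  refine ⟨⟨f, mem_link_cells.2 (hsub _ (mem_link_cells.1 hf))⟩, ?_⟩
  have hmono : ∀ f f', (∃ i π, T.link.glue f i = some (f', π)) →
      ∃ i π, T'.link.glue f i = some (f', π) := by
    rintro f f' ⟨i, π, h⟩
    obtain ⟨ρ, h1, h2, h3⟩ := link_glue_eq_some.1 h
    exact ⟨i, π, link_glue_eq_some.2 ⟨ρ, hW.glue_some hT hP h1, h2, h3⟩⟩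
  have hsymm : ∀ f f', (∃ i π, T'.link.glue f i = some (f', π)) →
      ∃ i π, T'.link.glue f' i = some (f, π) :=
    fun f f' ⟨i, π, h⟩ => ⟨π i, π⁻¹, (hlink _ _ _ _ h).2.2.1⟩
  have hold : ∀ f' ∈ T'.link.cells, ∃ f₀ ∈ T.link.cells,
      Relation.ReflTransGen (fun s s' => ∃ i π, T'.link.glue s i = some (s', π)) f' f₀ := by
    rintro ⟨t, i⟩ hf'
    rcases (hW.mem_cells t).1 (mem_link_cells.1 hf') with ht | ⟨k, rfl⟩
    · exact ⟨_, mem_link_cells.2 ht, .refl⟩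
    · by_cases hi : i = 3
      · subst hi
        refine ⟨((P k).t₂, (P k).σ₂ 2), mem_link_cells.2 (hP k).2.1, .single ?_⟩
        obtain ⟨s, hs⟩ := Fin.exists_succAbove_eq (x := (2 : Fin 4)) (y := 3) (by decide)
        exact ⟨s, _, link_glue_eq_some.2 ⟨_, by rw [hs]; exact (hW.layered k).glue2, by simp, rfl⟩⟩
      · refine ⟨((P k).t₁, (P k).σ₁ i), mem_link_cells.2 (hP k).1, .single ?_⟩
        obtain ⟨s, hs⟩ := Fin.exists_succAbove_eq (x := (3 : Fin 4)) (y := i) (Ne.symm hi)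
        exact ⟨s, _, link_glue_eq_some.2 ⟨_, by rw [hs]; exact (hW.layered k).glue3, rfl, rfl⟩⟩
  intro a ha b hb
  obtain ⟨a', ha', haa'⟩ := hold a ha
  obtain ⟨b', hb', hbb'⟩ := hold b hb
  refine haa'.trans ((Relation.ReflTransGen.mono hmono _ _ (hc a' ha' b' hb')).trans ?_)
  exact Relation.ReflTransGen.mono (fun x y h => hsymm y x h) _ _ hbb'.swap

theorem sameEdge (hW : IsWedgeFolding T T' P c) (hT : T.IsTriangulation)
    (hP : ∀ k, (P k).IsDiagonal T) {x y} (h : T.SameEdge x y) : T'.SameEdge x y := by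
  induction h with
  | rel x y h =>
    obtain ⟨h0, i, π, h1, h2, h3, h4⟩ := h
    exact EdgeStep.sameEdge ⟨h0, i, π, h1, h2, hW.glue_some hT hP h3, h4⟩
  | refl x => exact .refl _
  | symm x y _ ih => exact ih.symm
  | trans x y z _ _ ih ih' => exact ih.trans ih'

/-- Enter the layered tetrahedron through the triangle, cross the fold, which exchanges the ends `0`
and `1` of the petal and fixes the apex, and leave through the same triangle. -/
theorem sameEdge_apexEdge (hW : IsWedgeFolding T T' P c) (k : Fin g) (b d : Bool) :
    T'.SameEdge (apexEdge ((P k).flag b) d false) (apexEdge ((P k).flag b) d true) := by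
  suffices H : T'.SameEdge (apexEdge ((P k).flag b) true false) (apexEdge ((P k).flag b) true true) by
    cases d
    · exact H.revEdge
    · exact H
  have hinv : ∀ (σ : Perm (Fin 4)) j, σ⁻¹ (σ j) = j := by simp
  have hs0 : (swap 0 1 : Perm (Fin 4)) 0 = 1 := by decide
  have hs2 : (swap 0 1 : Perm (Fin 4)) 2 = 2 := by decide
  have hs3 : (swap 0 1 : Perm (Fin 4)) 3 = 3 := by decide
  cases b
  · have h1 := edgeStep_of_glue (hW.layered k).glue₂ (a := (P k).σ₂ 0) (b := (P k).σ₂ 2)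
      (by simp) (by simp) (by simp)
    have h2 := edgeStep_of_glue (hW.glue1 k) (a := 0) (b := 3) (by simp) (by simp) (by simp)
    have h3 := edgeStep_of_glue (hW.layered k).glue2 (a := 1) (b := 3) (by simp) (by simp) (by simp)
    have t0 : (swap 2 3 : Perm (Fin 4)) 0 = 0 := by decide
    have t1 : (swap 2 3 : Perm (Fin 4)) 1 = 1 := by decide
    simp only [Perm.mul_apply, hs0, hs3, swap_apply_left, swap_apply_right, t1, hinv, t0] at h1 h2 h3
    exact h1.sameEdge.trans (h2.sameEdge.trans h3.sameEdge)
  · have h1 := edgeStep_of_glue (hW.layered k).glue₁ (a := (P k).σ₁ 0) (b := (P k).σ₁ 2)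
      (by simp) (by simp) (by simp)
    have h2 := edgeStep_of_glue (hW.glue1 k) (a := 0) (b := 2) (by simp) (by simp) (by simp)
    have h3 := edgeStep_of_glue (hW.layered k).glue3 (a := 1) (b := 2) (by simp) (by simp) (by simp)
    simp only [hs0, hs2, hinv] at h1 h2 h3
    exact h1.sameEdge.trans (h2.sameEdge.trans h3.sameEdge)

end IsWedgeFolding

/-! ### Edge functions after folding -/

namespace GluingData

/-- The difference of an edge function on the two sides of a face to be identified. -/
def linkDiff {g : ℕ} (T : GluingData 3 ℕ) (P : Fin g → EdgeRef) :
    T.edgeFun →+ (Fin g × Bool × Bool → ZMod 2) where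
  toFun h q := h.1 (apexEdge ((P q.1).flag q.2.1) q.2.2 false) +
    h.1 (apexEdge ((P q.1).flag q.2.1) q.2.2 true)
  map_zero' := by
    funext q
    simp
  map_add' h h' := by
    funext q
    simp only [AddSubgroup.coe_add, Pi.add_apply]
    ring

theorem mem_ker_linkDiff {g : ℕ} {T : GluingData 3 ℕ} {P : Fin g → EdgeRef} {h : T.edgeFun} :
    h ∈ (linkDiff T P).ker ↔ ∀ k b d, h.1 (apexEdge ((P k).flag b) d false) =
      h.1 (apexEdge ((P k).flag b) d true) := by
  rw [AddMonoidHom.mem_ker, funext_iff]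
  constructor
  · intro H k b d
    exact CharTwo.add_eq_zero.1 (H (k, b, d))
  · rintro H ⟨k, b, d⟩
    exact CharTwo.add_eq_zero.2 (H k b d)

/-- The extension of an edge function to a layered tetrahedron. -/
def layeredValue (h : ℕ × Fin 4 × Fin 4 → ZMod 2) (e : EdgeRef) (v : ZMod 2 × ZMod 2)
    (a b : Fin 4) : ZMod 2 :=
  if a = b then 0
  else if a ≠ 3 ∧ b ≠ 3 then h (e.t₁, e.σ₁ a, e.σ₁ b)
  else if a ≠ 2 ∧ b ≠ 2 then h (e.t₂, e.σ₂ (swap 2 3 a), e.σ₂ (swap 2 3 b))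
  else if a = 2 then v.1 else v.2

end GluingData

namespace IsWedgeFolding

variable {g : ℕ} {T T' : GluingData 3 ℕ} {P : Fin g → EdgeRef} {c : Fin g → ℕ}

open Classical in
/-- The extension of an edge function to the layered tetrahedra. -/
noncomputable def extendFun (T : GluingData 3 ℕ) (P : Fin g → EdgeRef) (c : Fin g → ℕ)
    (h : ℕ × Fin 4 × Fin 4 → ZMod 2) (v : Fin g → ZMod 2 × ZMod 2) (x : ℕ × Fin 4 × Fin 4) :
    ZMod 2 :=
  if x.1 ∈ T.cells then h x
  else if hk : ∃ k, x.1 = c k then layeredValue h (P hk.choose) (v hk.choose) x.2.1 x.2.2 else 0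

theorem extendFun_old {h : ℕ × Fin 4 × Fin 4 → ZMod 2} {v : Fin g → ZMod 2 × ZMod 2}
    {x : ℕ × Fin 4 × Fin 4} (hx : x.1 ∈ T.cells) : extendFun T P c h v x = h x :=
  if_pos hx

theorem extendFun_new (hW : IsWedgeFolding T T' P c) {h : ℕ × Fin 4 × Fin 4 → ZMod 2}
    {v : Fin g → ZMod 2 × ZMod 2} (k : Fin g) (a b : Fin 4) :
    extendFun T P c h v (c k, a, b) = layeredValue h (P k) (v k) a b := by
  have hex : ∃ l, (c k, a, b).1 = c l := ⟨k, rfl⟩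
  have : hex.choose = k := (hW.injective hex.choose_spec).symm
  rw [extendFun, if_neg (hW.notMem k), dif_pos hex, this]

/-- There are two consistency conditions. The edge `01` lies in both attaching faces, and its values
agree there because the petal is a single edge of `T` (`hcomm`). The fold matches `02` with `12` and
`03` with `13`, which is membership in the kernel of `linkDiff` (`h01`). The edge `23` is matched
only with itself, in the same direction, so `v` is arbitrary. -/
theorem extendFun_mem (hW : IsWedgeFolding T T' P c) (hT : T.IsTriangulation)
    (hP : ∀ k, (P k).IsDiagonal T) (h : T.edgeFun) (hh : h ∈ (linkDiff T P).ker)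
    (v : Fin g → ZMod 2 × ZMod 2) : extendFun T P c h.1 v ∈ T'.edgeFun := by
  rw [mem_ker_linkDiff] at hh
  have hcomm : ∀ k a b, a ≠ b → a ≠ 2 → b ≠ 2 → layeredValue h.1 (P k) (v k) a b =
      h.1 ((P k).t₂, (P k).σ₂ (swap 2 3 a), (P k).σ₂ (swap 2 3 b)) := by
    intro k a b hab ha hb
    rw [layeredValue, if_neg hab]
    by_cases h3 : a ≠ 3 ∧ b ≠ 3
    · rw [if_pos h3]
      have hse : T.SameEdge (flagEdge ((P k).flag true)) (flagEdge ((P k).flag false)) :=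
        (across_spec hT ((hP k).isFree true) (hP k).across_true).2
      have hc1 := edgeFun_sameEdge h.2 hse
      have hc2 := edgeFun_sameEdge h.2 hse.revEdge
      have hcase : ∀ a b : Fin 4, a ≠ b → a ≠ 2 → b ≠ 2 → a ≠ 3 → b ≠ 3 →
          (a = 0 ∧ b = 1) ∨ (a = 1 ∧ b = 0) := by decide
      have t0 : (swap 2 3 : Perm (Fin 4)) 0 = 0 := by decide
      have t1 : (swap 2 3 : Perm (Fin 4)) 1 = 1 := by decide
      rcases hcase a b hab ha hb h3.1 h3.2 with ⟨rfl, rfl⟩ | ⟨rfl, rfl⟩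
      · rw [t0, t1]
        exact hc1
      · rw [t0, t1]
        exact hc2
    · rw [if_neg h3, if_pos (And.intro ha hb)]
  have h01 : ∀ k a b, a ≠ b → a ≠ 0 → b ≠ 0 → layeredValue h.1 (P k) (v k) a b =
      layeredValue h.1 (P k) (v k) (swap 0 1 a) (swap 0 1 b) := by
    intro k a b hab ha hb
    have s1 : (swap 0 1 : Perm (Fin 4)) 1 = 0 := by decide
    have s2 : (swap 0 1 : Perm (Fin 4)) 2 = 2 := by decide
    have s3 : (swap 0 1 : Perm (Fin 4)) 3 = 3 := by decide
    have hcase : ∀ a b : Fin 4, a ≠ b → a ≠ 0 → b ≠ 0 → (a = 1 ∧ b = 2) ∨ (a = 2 ∧ b = 1) ∨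
        (a = 1 ∧ b = 3) ∨ (a = 3 ∧ b = 1) ∨ (a = 2 ∧ b = 3) ∨ (a = 3 ∧ b = 2) := by decide
    rcases hcase a b hab ha hb with ⟨rfl, rfl⟩ | ⟨rfl, rfl⟩ | ⟨rfl, rfl⟩ | ⟨rfl, rfl⟩ | ⟨rfl, rfl⟩ |
      ⟨rfl, rfl⟩
    · rw [s1, s2]
      exact (hh k true true).symm
    · rw [s1, s2]
      exact (hh k true false).symm
    · rw [s1, s3]
      exact (hh k false true).symm
    · rw [s1, s3]
      exact (hh k false false).symm
    · rw [s2, s3]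
    · rw [s2, s3]
  refine ⟨?_, ?_⟩
  · rintro ⟨t, a, b⟩ ⟨t', a', b'⟩ hstep
    obtain ⟨hab, i, π, ha, hb, hg, ha', hb'⟩ := id hstep
    simp only at hab ha hb hg ha' hb'
    rcases hW.glue_cases hg with ⟨ht, hg⟩ | ⟨k, hk⟩
    · rw [extendFun_old ht, extendFun_old (hT _ _ _ _ hg).2.1]
      exact h.2.1 _ _ ⟨hab, i, π, ha, hb, hg, ha', hb'⟩
    · have hinv : ∀ (σ : Perm (Fin 4)) j, σ (σ⁻¹ j) = j := by simp
      rcases hk with ⟨rfl, rfl, hk⟩ | ⟨rfl, rfl, hk⟩ | ⟨rfl, rfl, hk⟩ | ⟨rfl, rfl, hk⟩ |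
        ⟨rfl, rfl, hk⟩ | ⟨rfl, rfl, hk⟩ <;> obtain ⟨rfl, rfl⟩ := Prod.mk.inj hk <;> subst ha' hb'
      · rw [extendFun_old (hP k).1, hW.extendFun_new, layeredValue,
          if_neg ((P k).σ₁⁻¹.injective.ne hab), if_pos, hinv, hinv]
        constructor
        · rintro h3
          rw [← h3, hinv] at ha
          exact ha rfl
        · rintro h3
          rw [← h3, hinv] at hb
          exact hb rfl
      · have hne : ∀ j, (P k).σ₂ 3 ≠ j → (swap 2 3 * (P k).σ₂⁻¹ : Perm (Fin 4)) j ≠ 2 := by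
          rintro j hj h2
          apply hj
          have := congrArg (fun i => (P k).σ₂ (swap 2 3 i)) h2
          simpa [eq_comm] using this
        rw [extendFun_old (hP k).2.1, hW.extendFun_new,
          hcomm k _ _ ((swap 2 3 * (P k).σ₂⁻¹ : Perm (Fin 4)).injective.ne hab) (hne _ ha) (hne _ hb)]
        simp
      · rw [extendFun_old (x := ((P k).t₁, _)) (hP k).1, hW.extendFun_new, layeredValue, if_neg hab,
          if_pos ⟨ha.symm, hb.symm⟩]
      · rw [extendFun_old (x := ((P k).t₂, _)) (hP k).2.1, hW.extendFun_new,
          hcomm k a b hab ha.symm hb.symm]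
        rfl
      · rw [hW.extendFun_new, hW.extendFun_new, h01 k a b hab ha.symm hb.symm]
      · have hne : ∀ j : Fin 4, (1 : Fin 4) ≠ j → (swap 0 1 : Perm (Fin 4)) j ≠ 0 := by decide
        rw [hW.extendFun_new, hW.extendFun_new, h01 k _ _ ((swap 0 1 : Perm (Fin 4)).injective.ne hab)
          (hne a ha) (hne b hb), swap_apply_self, swap_apply_self]
  · rintro ⟨t, a, b⟩ hx
    by_cases ht : t ∈ T.cells
    · rw [extendFun_old ht]
      exact h.2.2 _ fun hx' => hx ⟨(hW.mem_cells t).2 (Or.inl ht), hx'.2⟩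
    · by_cases hk : ∃ k, t = c k
      · obtain ⟨k, rfl⟩ := hk
        have hab : a = b := by
          by_contra hab
          exact hx ⟨(hW.mem_cells _).2 (Or.inr ⟨k, rfl⟩), hab⟩
        rw [hW.extendFun_new, layeredValue, if_pos hab]
      · rw [extendFun, if_neg ht, dif_neg hk]

theorem restrict_mem (hW : IsWedgeFolding T T' P c) (hT : T.IsTriangulation)
    (hP : ∀ k, (P k).IsDiagonal T) {F : ℕ × Fin 4 × Fin 4 → ZMod 2} (hF : F ∈ T'.edgeFun) :
    Set.indicator {x | x.1 ∈ T.cells} F ∈ T.edgeFun := by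
  classical
  refine ⟨fun x y hxy => ?_, fun x hx => ?_⟩
  · obtain ⟨h1, h2⟩ := hxy.isEdge hT
    simp only [Set.indicator_apply, Set.mem_ofPred_eq, h1.1, h2.1, if_true]
    exact edgeFun_sameEdge hF (hW.sameEdge hT hP hxy.sameEdge)
  · simp only [Set.indicator_apply, Set.mem_ofPred_eq]
    split_ifs with h
    · exact hF.2 _ fun hx' => hx ⟨h, hx'.2⟩
    · rfl

theorem restrict_mem_ker (hW : IsWedgeFolding T T' P c) (hT : T.IsTriangulation)
    (hP : ∀ k, (P k).IsDiagonal T) {F : ℕ × Fin 4 × Fin 4 → ZMod 2} (hF : F ∈ T'.edgeFun) :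
    (⟨_, hW.restrict_mem hT hP hF⟩ : T.edgeFun) ∈ (linkDiff T P).ker := by
  rw [mem_ker_linkDiff]
  intro k b d
  have hm : ∀ j, (apexEdge ((P k).flag b) d j).1 ∈ T.cells := by
    intro j
    have := ((hP k).isFree b).1
    cases d <;> exact this
  change Set.indicator _ _ _ = Set.indicator _ _ _
  rw [Set.indicator_of_mem (s := {x : ℕ × Fin 4 × Fin 4 | x.1 ∈ T.cells}) (hm _),
    Set.indicator_of_mem (s := {x : ℕ × Fin 4 × Fin 4 | x.1 ∈ T.cells}) (hm _)]
  exact edgeFun_sameEdge hF (hW.sameEdge_apexEdge k b d)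

/-- Restriction to the old tetrahedra lands in the kernel, and `extendFun` inverts it once the
values on the new edges are given. Each new edge contributes a factor `4`, one free bit for each of
its directions. -/
theorem card_edgeFun (hW : IsWedgeFolding T T' P c) (hT : T.IsTriangulation)
    (hP : ∀ k, (P k).IsDiagonal T) :
    Nat.card T'.edgeFun = Nat.card (linkDiff T P).ker * 4 ^ g := by
  classical
  let G : T'.edgeFun → (linkDiff T P).ker × (Fin g → ZMod 2 × ZMod 2) := fun F =>
    (⟨⟨_, hW.restrict_mem hT hP F.2⟩, hW.restrict_mem_ker hT hP F.2⟩,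
      fun k => (F.1 (c k, 2, 3), F.1 (c k, 3, 2)))
  have hG : Function.Bijective G := by
    constructor
    · intro F F' hFF'
      obtain ⟨h1, h2⟩ := Prod.mk.inj hFF'
      replace h1 := congrArg (fun z => z.1.1) h1
      simp only at h1
      have hold : ∀ x : ℕ × Fin 4 × Fin 4, x.1 ∈ T.cells → F.1 x = F'.1 x := by
        intro x hx
        have := congrFun h1 x
        simpa only [Set.indicator_apply, Set.mem_ofPred_eq, hx, if_true] using this
      have hnew : ∀ k a b, F.1 (c k, a, b) = F'.1 (c k, a, b) := by
        intro k a b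
        by_cases hab : a = b
        · rw [F.2.2 _ fun h => h.2 hab, F'.2.2 _ fun h => h.2 hab]
        by_cases h3 : a ≠ 3 ∧ b ≠ 3
        · have hs := edgeStep_of_glue (hW.layered k).glue3 hab h3.1.symm h3.2.symm
          rw [F.2.1 _ _ hs, F'.2.1 _ _ hs]
          exact hold _ (hP k).1
        by_cases h2' : a ≠ 2 ∧ b ≠ 2
        · have hs := edgeStep_of_glue (hW.layered k).glue2 hab h2'.1.symm h2'.2.symm
          rw [F.2.1 _ _ hs, F'.2.1 _ _ hs]
          exact hold _ (hP k).2.1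
        obtain ⟨h4, h5⟩ := Prod.mk.inj (congrFun h2 k)
        have hcase : ∀ a b : Fin 4, ¬ a = b → ¬ (a ≠ 3 ∧ b ≠ 3) → ¬ (a ≠ 2 ∧ b ≠ 2) →
            (a = 2 ∧ b = 3) ∨ (a = 3 ∧ b = 2) := by decide
        rcases hcase a b hab h3 h2' with ⟨rfl, rfl⟩ | ⟨rfl, rfl⟩
        · exact h4
        · exact h5
      ext ⟨t, a, b⟩
      by_cases ht : t ∈ T.cells
      · exact hold _ ht
      by_cases hk : ∃ k, t = c k
      · obtain ⟨k, rfl⟩ := hk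
        exact hnew k a b
      · have : ¬ T'.IsEdge (t, a, b) := fun h => (((hW.mem_cells t).1 h.1).elim ht hk)
        rw [F.2.2 _ this, F'.2.2 _ this]
    · rintro ⟨⟨h, hh⟩, v⟩
      refine ⟨⟨_, hW.extendFun_mem hT hP h hh v⟩, Prod.ext ?_ ?_⟩
      · refine Subtype.ext (Subtype.ext (funext fun x => ?_))
        by_cases hx : x.1 ∈ T.cells
        · simp only [G, Set.indicator_apply, Set.mem_ofPred_eq, hx, if_true, extendFun_old]
        · simp only [G, Set.indicator_apply, Set.mem_ofPred_eq, hx, if_false]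
          exact (h.2.2 _ fun h => hx h.1).symm
      · funext k
        simp only [G, hW.extendFun_new, layeredValue]
        simp
  rw [Nat.card_eq_of_bijective G hG, Nat.card_prod, Nat.card_fun, Nat.card_prod, Nat.card_zmod,
    Nat.card_fin]

/-- An orientation of the edges of `T` compatible with the identifications extends. -/
theorem edgesValid_of_orientation (hW : IsWedgeFolding T T' P c) (hT : T.IsTriangulation)
    (hP : ∀ k, (P k).IsDiagonal T) (h : T.edgeFun) (hh : h ∈ (linkDiff T P).ker)
    (hrev : ∀ x, T.IsEdge x → h.1 (revEdge x) = h.1 x + 1) : T'.EdgesValid := by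
  rw [edgesValid_iff hW.isTriangulation]
  intro x hx hse
  -- The pair `(0, 1)` directs each new edge: its two directions receive different values.
  have h1 := edgeFun_sameEdge (hW.extendFun_mem hT hP h hh fun _ => (0, 1)) hse
  suffices H : extendFun T P c h.1 (fun _ => (0, 1)) (revEdge x) =
      extendFun T P c h.1 (fun _ => (0, 1)) x + 1 by
    rw [← h1] at H
    exact absurd (left_eq_add.1 H) (by decide)
  obtain ⟨t, a, b⟩ := x
  obtain ⟨ht, hab⟩ := hx
  simp only at ht hab
  rcases (hW.mem_cells t).1 ht with ht | ⟨k, rfl⟩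
  · rw [extendFun_old (x := revEdge (t, a, b)) ht, extendFun_old (x := (t, a, b)) ht]
    exact hrev _ ⟨ht, hab⟩
  · change extendFun T P c h.1 _ (c k, b, a) = _
    rw [hW.extendFun_new, hW.extendFun_new, layeredValue, layeredValue, if_neg hab, if_neg hab.symm]
    simp only [and_comm (a := b ≠ 3), and_comm (a := b ≠ 2)]
    split_ifs with h3 h2 h4 h5 h6
    · exact hrev ((P k).t₁, _, _) ⟨(hP k).1, (P k).σ₁.injective.ne hab⟩
    · exact hrev ((P k).t₂, _, _)
        ⟨(hP k).2.1, (P k).σ₂.injective.ne ((swap 2 3 : Perm (Fin 4)).injective.ne hab)⟩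
    · exact absurd (h5.trans h4.symm) hab
    · decide
    · decide
    · exact absurd (And.intro ‹¬ a = 2› ‹¬ b = 2›) ‹¬ (a ≠ 2 ∧ b ≠ 2)›

end IsWedgeFolding

/-! ### Petals in the boundary surface -/

namespace EdgeRef

/-- One of the two faces at an edge. -/
def face (e : EdgeRef) (b : Bool) : ℕ × Fin 4 := ((e.flag b).1, (e.flag b).2 3)

/-- The corner of `e.face b` labelled like a given vertex of the flag. -/
def corner (e : EdgeRef) (b : Bool) (j : Fin 3) : Fin 3 :=
  ((finSuccAboveEquiv ((e.flag b).2 3)).symm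
    ⟨(e.flag b).2 j.castSucc, (e.flag b).2.injective.ne (Fin.castSucc_lt_last j).ne⟩)

theorem succAbove_corner (e : EdgeRef) (b : Bool) (j : Fin 3) :
    (e.face b).2.succAbove (e.corner b j) = (e.flag b).2 j.castSucc := by
  have := (finSuccAboveEquiv ((e.flag b).2 3)).apply_symm_apply
    ⟨(e.flag b).2 j.castSucc, (e.flag b).2.injective.ne (Fin.castSucc_lt_last j).ne⟩
  exact congrArg Subtype.val this

theorem corner_injective (e : EdgeRef) (b : Bool) : Function.Injective (e.corner b) := by
  intro i j h
  have := congrArg (e.face b).2.succAbove h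
  rw [succAbove_corner, succAbove_corner] at this
  exact Fin.castSucc_injective _ ((e.flag b).2.injective this)

theorem exists_eq_corner (e : EdgeRef) (b : Bool) (a : Fin 3) : ∃ j, e.corner b j = a :=
  (Finite.injective_iff_surjective.1 (e.corner_injective b)) a

theorem eq_corner_of_ne {e : EdgeRef} {b : Bool} {a : Fin 3} (h : a ≠ e.corner b 2) :
    a = e.corner b 0 ∨ a = e.corner b 1 := by
  obtain ⟨j, rfl⟩ := e.exists_eq_corner b a
  fin_cases j
  · exact Or.inl rfl
  · exact Or.inr rfl
  · exact absurd rfl h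

theorem isSide_iff {e : EdgeRef} {f : ℕ × Fin 4} {s : Fin 3} :
    e.IsSide f s ↔ ∃ b, f = e.face b ∧ s = e.corner b 2 := by
  have key : ∀ b, f = e.face b → (s = e.corner b 2 ↔ f.2.succAbove s = (e.flag b).2 2) := by
    rintro b rfl
    have h : _ = (e.flag b).2 2 := e.succAbove_corner b 2
    rw [← h]
    exact Fin.succAbove_right_injective.eq_iff.symm
  rw [Bool.exists_bool, IsSide, or_comm]
  exact or_congr (and_congr_right fun h => (key false h).symm)
    (and_congr_right fun h => (key true h).symm)

theorem sideEdge_true (e : EdgeRef) (b j : Bool) :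
    apexEdge (e.flag b) true j = sideEdge (e.face b) (e.corner b (if j then 1 else 0))
      (e.corner b 2) := by
  unfold sideEdge
  rw [succAbove_corner, succAbove_corner]
  cases j <;> rfl

theorem sideEdge_false (e : EdgeRef) (b j : Bool) :
    apexEdge (e.flag b) false j = sideEdge (e.face b) (e.corner b 2)
      (e.corner b (if j then 1 else 0)) := by
  unfold sideEdge
  rw [succAbove_corner, succAbove_corner]
  cases j <;> rfl

theorem IsDiagonal.face_mem {e : EdgeRef} {T : GluingData 3 ℕ} (h : e.IsDiagonal T) (b : Bool) :
    e.face b ∈ T.boundary.cells :=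
  (h.isFree b).face_mem

theorem IsDiagonal.face_ne {e : EdgeRef} {T : GluingData 3 ℕ} (h : e.IsDiagonal T) :
    e.face true ≠ e.face false := h.2.2.2.2.2

theorem IsDiagonal.boundary_glue {e : EdgeRef} {T : GluingData 3 ℕ} (hT : T.IsTriangulation)
    (h : e.IsDiagonal T) (b : Bool) :
    ∃ π, T.boundary.glue (e.face b) (e.corner b 2) = some (e.face !b, π) ∧
      ∀ j, π (e.corner b j) = e.corner (!b) j := by
  refine ⟨restrictPerm ((e.flag b).2 3) ((e.flag !b).2 * (e.flag b).2⁻¹), ?_, ?_⟩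
  · have := boundary_glue_eq (h.isFree b) (s := e.corner b 2) (e.succAbove_corner b 2)
    rw [h.across_flag hT b] at this
    exact this
  · intro j
    have h3 : ((e.flag !b).2 * (e.flag b).2⁻¹) ((e.flag b).2 3) = (e.flag !b).2 3 := by simp
    have := succAbove_restrictPerm ((e.flag b).2 3) ((e.flag !b).2 * (e.flag b).2⁻¹) (e.corner b j)
    rw [h3, show ((e.flag b).2 3).succAbove (e.corner b j) = _ from e.succAbove_corner b j] at this
    apply Fin.succAbove_right_injective (p := (e.face !b).2)
    rw [succAbove_corner]
    refine Eq.trans this ?_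
    simp

end EdgeRef

/-- A side of a boundary triangle which is not a petal. -/
def IsPlain {g : ℕ} (P : Fin g → EdgeRef) (f : ℕ × Fin 4) (s : Fin 3) : Prop :=
  ∀ k, ¬ (P k).IsSide f s

/-- A triangle belonging to none of the quadrilaterals. -/
def IsOutside {g : ℕ} (P : Fin g → EdgeRef) (f : ℕ × Fin 4) : Prop := ∀ k b, f ≠ (P k).face b

theorem IsOutside.isPlain {g : ℕ} {P : Fin g → EdgeRef} {f : ℕ × Fin 4} (h : IsOutside P f)
    (s : Fin 3) : IsPlain P f s := by
  intro k hs
  obtain ⟨b, hb, -⟩ := EdgeRef.isSide_iff.1 hs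
  exact h k b hb

namespace IsIsolatedFillingBouquet

variable {g : ℕ} {T : GluingData 3 ℕ} {P : Fin g → EdgeRef}

theorem face_ne_face (hB : IsIsolatedFillingBouquet T P) {k l : Fin g} (hkl : k ≠ l) (b b' : Bool) :
    (P k).face b ≠ (P l).face b' := by
  have h1 : ∀ (e : EdgeRef) b, e.face b ∈ ({e.face₁, e.face₂} : Finset (ℕ × Fin 4)) := by
    intro e b
    cases b
    · exact Finset.mem_insert_of_mem (Finset.mem_singleton_self _)
    · exact Finset.mem_insert_self _ _
  exact fun h => Finset.disjoint_left.1 (hB.disjoint k l hkl) (h1 _ b) (h ▸ h1 _ b')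

theorem face_injective (hB : IsIsolatedFillingBouquet T P) {k l : Fin g} {b b' : Bool}
    (h : (P k).face b = (P l).face b') : k = l ∧ b = b' := by
  by_cases hkl : k = l
  · subst hkl
    refine ⟨rfl, ?_⟩
    have := (hB.diagonal k).face_ne
    cases b <;> cases b'
    · rfl
    · exact absurd h.symm this
    · exact absurd h this
    · rfl
  · exact absurd h (hB.face_ne_face hkl b b')

theorem isPlain_face_iff (hB : IsIsolatedFillingBouquet T P) {k : Fin g} {b : Bool} {s : Fin 3} :
    IsPlain P ((P k).face b) s ↔ s ≠ (P k).corner b 2 := by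
  constructor
  · rintro h rfl
    exact h k (EdgeRef.isSide_iff.2 ⟨b, rfl, rfl⟩)
  · rintro h l hl
    obtain ⟨b', h1, h2⟩ := EdgeRef.isSide_iff.1 hl
    obtain ⟨rfl, rfl⟩ := hB.face_injective h1
    exact h h2

theorem isSide_of_glue (hB : IsIsolatedFillingBouquet T P) (hT : T.IsTriangulation) {k : Fin g}
    {f f' : ℕ × Fin 4} {s : Fin 3} {π : Perm (Fin 3)} (h : T.boundary.glue f s = some (f', π))
    (hs : (P k).IsSide f s) : (P k).IsSide f' (π s) := by
  obtain ⟨b, rfl, rfl⟩ := EdgeRef.isSide_iff.1 hs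
  obtain ⟨ρ, h1, h2⟩ := (hB.diagonal k).boundary_glue hT b
  rw [h1] at h
  obtain ⟨rfl, rfl⟩ := Prod.mk.inj (Option.some.inj h)
  exact EdgeRef.isSide_iff.2 ⟨!b, rfl, h2 2⟩

theorem isPlain_of_glue (hB : IsIsolatedFillingBouquet T P) (hM : T.IsOneVertexManifold g)
    {f f' : ℕ × Fin 4} {s : Fin 3} {π : Perm (Fin 3)} (h : T.boundary.glue f s = some (f', π))
    (hs : IsPlain P f s) : IsPlain P f' (π s) := by
  intro k hk
  have := hB.isSide_of_glue hM.isTriangulation (hM.boundary_genus.1 _ _ _ _ h).2.2.1 hk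
  simp only [Perm.coe_inv, symm_apply_apply] at this
  exact hs k this

end IsIsolatedFillingBouquet

namespace GluingData.IsOneVertexManifold

variable {g : ℕ} {T : GluingData 3 ℕ} {P : Fin g → EdgeRef}

theorem card_boundary_vertex (hM : T.IsOneVertexManifold g) : Nat.card T.boundary.Vertex = 1 := by
  rw [← card_link_boundaryCircle hM.isTriangulation]
  exact hM.link_disc.2

theorem eq_of_crossesAt (hM : T.IsOneVertexManifold g) {α : Type*} {F : (ℕ × Fin 4) × Fin 3 → α}
    (hF : ∀ x y s, T.boundary.CrossesAt x y s → F x = F y) {x y : (ℕ × Fin 4) × Fin 3}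
    (hx : x.1 ∈ T.boundary.cells) (hy : y.1 ∈ T.boundary.cells) : F x = F y := by
  have : Subsingleton T.boundary.Vertex := (Nat.card_eq_one_iff_unique.1 hM.card_boundary_vertex).1
  have h : T.boundary.vertexOf ⟨x, hx⟩ = T.boundary.vertexOf ⟨y, hy⟩ := Subsingleton.elim _ _
  exact congrArg (Quot.lift (fun p : {p : (ℕ × Fin 4) × Fin 3 // p.1 ∈ T.boundary.cells} => F p.1)
    fun a b ⟨s, π, h1, h2, h3⟩ => hF _ _ s ⟨h1, π, h2, h3⟩) h

/-- A closed surface with one vertex and `F` triangles has `3F / 2` edges, so `1 - F / 2 = 2 - 2g`.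
In particular `g` is positive. -/
theorem card_boundary_cells (hM : T.IsOneVertexManifold g) :
    T.boundary.cells.card + 2 = 4 * g := by
  have h1 := two_mul_card_facet hM.boundary_genus.1
  have h2 := hM.boundary_genus.2.2.2
  have := hM.boundary_closed.isEmpty_freeSide
  rw [Nat.card_of_isEmpty (α := T.boundary.FreeSide), add_zero] at h1
  rw [hM.boundary_closed.card_boundaryCircle, eulerChar, hM.card_boundary_vertex] at h2
  omega

theorem card_link_vertex (hM : T.IsOneVertexManifold g) :
    (Nat.card T.link.Vertex : ℤ) = 2 * T.cells.card + 6 * g - 2 := by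
  have h1 := two_mul_card_facet (link_isTriangulation hM.isTriangulation)
  have h2 := hM.link_disc.1.2.2.2
  have h3 := hM.card_boundary_cells
  have h4 : T.link.cells.card = 4 * T.cells.card := by
    simp [link, mul_comm]
  rw [card_link_freeSide] at h1
  rw [hM.link_disc.2, eulerChar] at h2
  omega

theorem exists_petal_function (hM : T.IsOneVertexManifold g) (hB : IsIsolatedFillingBouquet T P)
    (k : Fin g) : ∃ u : (ℕ × Fin 4) × Fin 3 → ZMod 2,
      (∀ x y s, T.boundary.CrossesAt x y s → ¬ (P k).IsSide x.1 s → u x = u y) ∧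
      (∀ a, a ≠ (P k).corner true 2 → u ((P k).face true, a) = 0) ∧
      (∀ a, a ≠ (P k).corner false 2 → u ((P k).face false, a) = 1) := by
  obtain ⟨π, h1, h2⟩ := (hB.diagonal k).boundary_glue hM.isTriangulation true
  obtain ⟨u, hu, hu1, hu2⟩ := exists_side_function hM.boundary_genus.1 hM.boundary_closed
    hM.boundary_genus.2.2.1 hM.card_boundary_vertex h1 (hB.diagonal k).face_ne
  rw [h2] at hu hu2
  refine ⟨u, ?_, hu1, hu2⟩
  intro x y s hxy hs
  refine hu x y s hxy ?_ ?_
  · intro h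
    obtain ⟨h3, h4⟩ := Prod.mk.inj h
    exact hs (EdgeRef.isSide_iff.2 ⟨true, h3, h4⟩)
  · intro h
    obtain ⟨h3, h4⟩ := Prod.mk.inj h
    exact hs (EdgeRef.isSide_iff.2 ⟨false, h3, h4⟩)

end GluingData.IsOneVertexManifold

/-! ### Side functions of the petals -/

/-- For each petal, the function telling on which side of the petal a corner is. -/
structure IsSideFunctions {g : ℕ} (T : GluingData 3 ℕ) (P : Fin g → EdgeRef)
    (u : Fin g → (ℕ × Fin 4) × Fin 3 → ZMod 2) : Prop where
  crosses : ∀ k x y s, T.boundary.CrossesAt x y s → ¬ (P k).IsSide x.1 s → u k x = u k y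
  eq_zero : ∀ k a, a ≠ (P k).corner true 2 → u k ((P k).face true, a) = 0
  eq_one : ∀ k a, a ≠ (P k).corner false 2 → u k ((P k).face false, a) = 1

theorem exists_sideFunctions {g : ℕ} {T : GluingData 3 ℕ} {P : Fin g → EdgeRef}
    (hM : T.IsOneVertexManifold g) (hB : IsIsolatedFillingBouquet T P) :
    ∃ u, IsSideFunctions T P u := by
  choose u h1 h2 h3 using hM.exists_petal_function hB
  exact ⟨u, h1, h2, h3⟩

namespace IsSideFunctions

variable {g : ℕ} {T : GluingData 3 ℕ} {P : Fin g → EdgeRef}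
  {u : Fin g → (ℕ × Fin 4) × Fin 3 → ZMod 2}

/-- The jump of `h` across petal `k` is `ε k` at both ends, and `u k` jumps by `1` there, so the
corrected sum is unchanged across every side. All corners lie around one vertex, hence it is
constant. -/
theorem add_sum_eq (hu : IsSideFunctions T P u) (hM : T.IsOneVertexManifold g)
    (hB : IsIsolatedFillingBouquet T P) {h : (ℕ × Fin 4) × Fin 3 → ZMod 2} {ε : Fin g → ZMod 2}
    (h1 : ∀ x y s, T.boundary.CrossesAt x y s → IsPlain P x.1 s → h x = h y)
    (h2 : ∀ k j, j ≠ 2 → h ((P k).face true, (P k).corner true j) + ε k =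
      h ((P k).face false, (P k).corner false j))
    {x y : (ℕ × Fin 4) × Fin 3} (hx : x.1 ∈ T.boundary.cells) (hy : y.1 ∈ T.boundary.cells) :
    h x + ∑ k, ε k * u k x = h y + ∑ k, ε k * u k y := by
  refine hM.eq_of_crossesAt (F := fun x => h x + ∑ k, ε k * u k x) ?_ hx hy
  intro x y s hxy
  by_cases hs : IsPlain P x.1 s
  · simp only [h1 x y s hxy hs]
    congr 1
    exact Finset.sum_congr rfl fun k _ => by rw [hu.crosses k x y s hxy (hs k)]
  · simp only [IsPlain, not_forall, not_not] at hs
    obtain ⟨k, hk⟩ := hs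
    -- A side of petal `k` belongs to no other petal, since the quadrilaterals are disjoint, so only
    -- `u k` can change across it.
    have hsum : ∑ l, ε l * (u l x - u l y) = ε k * (u k x - u k y) := by
      refine Finset.sum_eq_single k (fun l _ hl => ?_) (by simp)
      rw [hu.crosses l x y s hxy, sub_self, mul_zero]
      intro hs
      obtain ⟨b, hb, -⟩ := EdgeRef.isSide_iff.1 hk
      obtain ⟨b', hb', -⟩ := EdgeRef.isSide_iff.1 hs
      exact hB.face_ne_face hl _ _ (hb'.symm.trans hb)
    suffices H : h x - h y + ε k * (u k x - u k y) = 0 by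
      rw [← hsum] at H
      simp only [mul_sub, Finset.sum_sub_distrib] at H
      linear_combination H
    obtain ⟨hsx, π, hg, hy⟩ := hxy
    obtain ⟨b, hb, rfl⟩ := EdgeRef.isSide_iff.1 hk
    obtain ⟨x, a⟩ := x
    obtain ⟨y, a'⟩ := y
    simp only at hb hsx hg hy
    subst hb
    obtain ⟨ρ, h3, h4⟩ := (hB.diagonal k).boundary_glue hM.isTriangulation b
    rw [h3] at hg
    obtain ⟨rfl, rfl⟩ := Prod.mk.inj (Option.some.inj hg)
    obtain ⟨j, rfl⟩ := (P k).exists_eq_corner b a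
    rw [h4] at hy
    subst hy
    have hj : j ≠ 2 := fun h => hsx (by rw [h])
    have h5 := h2 k j hj
    have h6 := hu.eq_zero k _ (((P k).corner_injective true).ne hj)
    have h7 := hu.eq_one k _ (((P k).corner_injective false).ne hj)
    have h8 : (2 : ZMod 2) = 0 := rfl
    cases b
    · simp only [Bool.not_false, h6, h7]
      linear_combination -h5 + ε k * h8
    · simp only [Bool.not_true, h6, h7]
      linear_combination h5 - ε k * h8

theorem eq_of_sameSide (hu : IsSideFunctions T P u) {k : Fin g} {x y : (ℕ × Fin 4) × Fin 3}
    (h : SameSide T.boundary (P k).IsSide x y) : u k x = u k y := by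
  induction h with
  | refl => rfl
  | tail _ h ih =>
    obtain ⟨s, π, h1, h2, h3, h4⟩ := h
    exact ih.trans (hu.crosses k _ _ s ⟨h1, π, h3, h4⟩ h2)

end IsSideFunctions

namespace IsIsolatedFillingBouquet

variable {g : ℕ} {T : GluingData 3 ℕ} {P : Fin g → EdgeRef}

/-- A function on boundary triangles that does not change across sides other than petals is
constant. -/
theorem eq_of_plain (hB : IsIsolatedFillingBouquet T P) (hM : T.IsOneVertexManifold g)
    {w : ℕ × Fin 4 → ZMod 2}
    (hw : ∀ f f' s π, T.boundary.glue f s = some (f', π) → IsPlain P f s → w f = w f')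
    {f f' : ℕ × Fin 4} (hf : f ∈ T.boundary.cells) (hf' : f' ∈ T.boundary.cells) : w f = w f' := by
  have hg : 0 < g := by
    have := hM.card_boundary_cells
    omega
  obtain ⟨u, hu⟩ := exists_sideFunctions hM hB
  -- As a function on corners, `w` depends only on the triangle, so its jump across a petal is
  -- automatically the same at both ends.
  have hconst := fun x y => hu.add_sum_eq hM hB (h := fun x => w x.1)
    (ε := fun k => w ((P k).face true) + w ((P k).face false)) (x := x) (y := y)
    (fun x y s hxy hs => by
      obtain ⟨-, π, h1, -⟩ := hxy
      exact hw _ _ s π h1 hs)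
    (fun k j _ => by
      have h8 : (2 : ZMod 2) = 0 := rfl
      linear_combination w ((P k).face true) * h8)
  have hmem : ∀ (k : Fin g) (x y : (ℕ × Fin 4) × Fin 3),
      SameSide T.boundary (P k).IsSide x y → x.1 ∈ T.boundary.cells → y.1 ∈ T.boundary.cells := by
    intro k x y h hx
    induction h with
    | refl => exact hx
    | tail _ h ih =>
      obtain ⟨s, π, h1, h2, h3, h4⟩ := h
      exact (hM.boundary_genus.1 _ _ _ _ h3).2.1
  have H := hB.nonseparating f hf f' hf'
  suffices H' : f' ∈ T.boundary.cells ∧ w f = w f' from H'.2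
  clear hf'
  induction H with
  | refl => exact ⟨hf, rfl⟩
  | @tail x y _ h ih =>
    obtain ⟨hx, ih⟩ := ih
    rcases h with ⟨s, π, h1, h2⟩ | ⟨a, b, h⟩
    · exact ⟨(hM.boundary_genus.1 _ _ _ _ h2).2.1, ih.trans (hw _ _ s π h2 h1)⟩
    · have hy := hmem ⟨0, hg⟩ _ _ (h _) hx
      refine ⟨hy, ih.trans ?_⟩
      have h1 := hconst (x, a) (y, b) hx hy
      -- A passage near the vertex between two petals changes no side function, so constancy of the
      -- corrected sum gives constancy of `w`.
      have h2 : ∀ k, u k (x, a) = u k (y, b) := fun k => hu.eq_of_sameSide (h k)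
      simp only [h2] at h1
      exact add_right_cancel h1

/-- Non-separation also allows passages near the vertex between pushed-off petals. Such passages are
superfluous: the indicator of the set reachable without them is unchanged across non-petal sides,
hence constant by `eq_of_plain`. -/
theorem reachable (hB : IsIsolatedFillingBouquet T P) (hM : T.IsOneVertexManifold g)
    {f f' : ℕ × Fin 4} (hf : f ∈ T.boundary.cells) (hf' : f' ∈ T.boundary.cells) :
    Relation.ReflTransGen (fun x y => ∃ s π, IsPlain P x s ∧ T.boundary.glue x s = some (y, π))
      f f' := by
  classical
  let R := Relation.ReflTransGen
    (fun x y => ∃ s π, IsPlain P x s ∧ T.boundary.glue x s = some (y, π)) f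
  have h := hB.eq_of_plain hM (w := fun x => if R x then 1 else 0) ?_ hf hf'
  · rw [if_pos (show R f from .refl)] at h
    by_contra hn
    rw [if_neg hn] at h
    exact one_ne_zero h
  · intro x y s π hg hs
    have : R x ↔ R y := by
      constructor
      · exact fun h => h.tail ⟨s, π, hs, hg⟩
      · exact fun h => h.tail
          ⟨π s, π⁻¹, hB.isPlain_of_glue hM hg hs, (hM.boundary_genus.1 _ _ _ _ hg).2.2.1⟩
    simp only [this]

/-- Propagation of a property of directed sides of boundary triangles, other than petals, from the
triangles outside the quadrilaterals. -/
theorem plain_induction (hB : IsIsolatedFillingBouquet T P) (hM : T.IsOneVertexManifold g)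
    (hout : ∃ f ∈ T.boundary.cells, IsOutside P f) {Q : ℕ × Fin 4 → Fin 3 → Fin 3 → Prop}
    (h1 : ∀ f ∈ T.boundary.cells, IsOutside P f → ∀ a b, a ≠ b → Q f a b)
    (h2 : ∀ f s f' π a b, T.boundary.glue f s = some (f', π) → IsPlain P f s → a ≠ b → s ≠ a →
      s ≠ b → Q f' (π a) (π b) → Q f a b)
    (h3 : ∀ k b i j, i ≠ 2 → j ≠ 2 → Q ((P k).face b) ((P k).corner b i) ((P k).corner b 2) →
      Q ((P k).face b) ((P k).corner b j) ((P k).corner b 2))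
    (h4 : ∀ k b i j, i ≠ 2 → j ≠ 2 → Q ((P k).face b) ((P k).corner b 2) ((P k).corner b i) →
      Q ((P k).face b) ((P k).corner b 2) ((P k).corner b j))
    {f : ℕ × Fin 4} (hf : f ∈ T.boundary.cells) {a b s : Fin 3} (hab : a ≠ b) (hsa : s ≠ a)
    (hsb : s ≠ b) (hs : IsPlain P f s) : Q f a b := by
  obtain ⟨z, hz, hzo⟩ := hout
  have H := hB.reachable hM hf hz
  -- Induction along a path to a triangle outside the quadrilaterals. At a triangle of a petal, `Q`
  -- is brought back through the side by which the path leaves, and `h3` or `h4` transfers it to the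
  -- other non-petal side.
  induction H using Relation.ReflTransGen.head_induction_on generalizing a b s with
  | refl => exact h1 z hz hzo a b hab
  | @head x y hxy _ ih =>
    obtain ⟨r, π, hr, hg⟩ := hxy
    by_cases hxo : IsOutside P x
    · exact h1 x hf hxo a b hab
    simp only [IsOutside, not_forall, not_not] at hxo
    obtain ⟨k, b', rfl⟩ := hxo
    rw [hB.isPlain_face_iff] at hs
    have hr' := hB.isPlain_face_iff.1 hr
    obtain ⟨i, rfl⟩ := (P k).exists_eq_corner b' r
    have hi : i ≠ 2 := fun h => hr' (by rw [h])
    -- The side crossed lies opposite `i`, so it joins the apex `2` to the other end `v` of the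
    -- petal.
    obtain ⟨v, hv2, hvi⟩ := exists_ne_ne 2 i
    have hy := (hM.boundary_genus.1 _ _ _ _ hg).2.1
    have hpl := hB.isPlain_of_glue hM hg hr
    have hinj := (P k).corner_injective b'
    have q1 : Q ((P k).face b') ((P k).corner b' v) ((P k).corner b' 2) :=
      h2 _ _ _ π _ _ hg hr (hinj.ne hv2) (hinj.ne hvi.symm) (hinj.ne hi)
        (ih hy (π.injective.ne (hinj.ne hv2)) (π.injective.ne (hinj.ne hvi.symm))
          (π.injective.ne (hinj.ne hi)) hpl)
    have q2 : Q ((P k).face b') ((P k).corner b' 2) ((P k).corner b' v) :=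
      h2 _ _ _ π _ _ hg hr (hinj.ne hv2.symm) (hinj.ne hi) (hinj.ne hvi.symm)
        (ih hy (π.injective.ne (hinj.ne hv2.symm)) (π.injective.ne (hinj.ne hi))
          (π.injective.ne (hinj.ne hvi.symm)) hpl)
    obtain ⟨a, rfl⟩ := (P k).exists_eq_corner b' a
    obtain ⟨b, rfl⟩ := (P k).exists_eq_corner b' b
    obtain ⟨s, rfl⟩ := (P k).exists_eq_corner b' s
    have hcase : ∀ a b s : Fin 3, a ≠ b → s ≠ a → s ≠ b → s ≠ 2 → (a ≠ 2 ∧ b = 2) ∨ (a = 2 ∧ b ≠ 2) := by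
      decide
    have hne : ∀ {i j}, (P k).corner b' i ≠ (P k).corner b' j → i ≠ j := fun h h' => h (by rw [h'])
    rcases hcase a b s (hne hab) (hne hsa) (hne hsb) (hne hs) with ⟨ha, rfl⟩ | ⟨rfl, hb⟩
    · exact h3 k b' v a hv2 ha q1
    · exact h4 k b' v b hv2 hb q2

end IsIsolatedFillingBouquet

/-! ### The boundary after folding -/

/-- A directed side of a boundary triangle which is not a petal. -/
structure IsPlainDart {g : ℕ} (T : GluingData 3 ℕ) (P : Fin g → EdgeRef) (f : ℕ × Fin 4)
    (a b : Fin 3) : Prop where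
  mem : f ∈ T.boundary.cells
  ne : a ≠ b
  isPlain : ∀ s, s ≠ a → s ≠ b → IsPlain P f s

section

variable {g : ℕ} {T : GluingData 3 ℕ} {P : Fin g → EdgeRef} {f : ℕ × Fin 4} {a b : Fin 3}

theorem IsPlainDart.symm (h : IsPlainDart T P f a b) : IsPlainDart T P f b a :=
  ⟨h.mem, h.ne.symm, fun s h1 h2 => h.isPlain s h2 h1⟩

theorem IsPlainDart.isEdge (h : IsPlainDart T P f a b) : T.IsEdge (sideEdge f a b) :=
  ⟨(mem_boundary_cells.1 h.mem).1, Fin.succAbove_right_injective.ne h.ne⟩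

theorem IsOutside.isPlainDart (h : IsOutside P f) (hf : f ∈ T.boundary.cells) (hab : a ≠ b) :
    IsPlainDart T P f a b :=
  ⟨hf, hab, fun s _ _ => h.isPlain s⟩

theorem eq_of_ne_of_ne {a b s r : Fin 3} (hab : a ≠ b) (hsa : s ≠ a) (hsb : s ≠ b) (hra : r ≠ a)
    (hrb : r ≠ b) : r = s := by
  revert a b s r
  decide

namespace IsIsolatedFillingBouquet

theorem isPlainDart_apex (hB : IsIsolatedFillingBouquet T P) (k : Fin g) (b : Bool) {i : Fin 3}
    (hi : i ≠ 2) : IsPlainDart T P ((P k).face b) ((P k).corner b i) ((P k).corner b 2) :=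
  ⟨(hB.diagonal k).face_mem b, ((P k).corner_injective b).ne hi,
    fun _ _ h => hB.isPlain_face_iff.2 h⟩

theorem isPlainDart_face (hB : IsIsolatedFillingBouquet T P) {k : Fin g} {β : Bool}
    (h : IsPlainDart T P ((P k).face β) a b) :
    (∃ j : Bool, a = (P k).corner β (if j then 1 else 0) ∧ b = (P k).corner β 2) ∨
      ∃ j : Bool, a = (P k).corner β 2 ∧ b = (P k).corner β (if j then 1 else 0) := by
  have hex : ∀ a, a ≠ (P k).corner β 2 → ∃ j : Bool, a = (P k).corner β (if j then 1 else 0) := by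
    intro a ha
    rcases EdgeRef.eq_corner_of_ne ha with h | h
    · exact ⟨false, h⟩
    · exact ⟨true, h⟩
  by_cases hb : b = (P k).corner β 2
  · obtain ⟨j, hj⟩ := hex a (hb ▸ h.ne)
    exact Or.inl ⟨j, hj, hb⟩
  by_cases ha : a = (P k).corner β 2
  · obtain ⟨j, hj⟩ := hex b hb
    exact Or.inr ⟨j, ha, hj⟩
  exact absurd rfl (hB.isPlain_face_iff.1 (h.isPlain _ (Ne.symm ha) (Ne.symm hb)))

theorem exists_isPlainDart (hB : IsIsolatedFillingBouquet T P) (hf : f ∈ T.boundary.cells)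
    (a : Fin 3) : ∃ b, IsPlainDart T P f a b := by
  by_cases ho : IsOutside P f
  · obtain ⟨b, hb, -⟩ := exists_ne_ne a a
    exact ⟨b, ho.isPlainDart hf hb.symm⟩
  · simp only [IsOutside, not_forall, not_not] at ho
    obtain ⟨k, β, rfl⟩ := ho
    obtain ⟨i, rfl⟩ := (P k).exists_eq_corner β a
    by_cases hi : i = 2
    · subst hi
      exact ⟨_, (hB.isPlainDart_apex k β (i := 0) (by decide)).symm⟩
    · exact ⟨_, hB.isPlainDart_apex k β hi⟩

theorem isPlainDart_of_glue (hB : IsIsolatedFillingBouquet T P) (hM : T.IsOneVertexManifold g)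
    {f' : ℕ × Fin 4} {s : Fin 3} {π : Perm (Fin 3)} (h : T.boundary.glue f s = some (f', π))
    (hs : IsPlain P f s) (hab : a ≠ b) (hsa : s ≠ a) (hsb : s ≠ b) :
    IsPlainDart T P f' (π a) (π b) := by
  refine ⟨(hM.boundary_genus.1 _ _ _ _ h).2.1, π.injective.ne hab, fun r h1 h2 => ?_⟩
  rw [eq_of_ne_of_ne (π.injective.ne hab) (π.injective.ne hsa) (π.injective.ne hsb) h1 h2]
  exact hB.isPlain_of_glue hM h hs

end IsIsolatedFillingBouquet

end

/-! ### Fold functions -/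

/-- Functions on the corners of the boundary triangles that descend to the boundary after folding. -/
structure IsFoldFunction {g : ℕ} (T : GluingData 3 ℕ) (P : Fin g → EdgeRef)
    (h : (ℕ × Fin 4) × Fin 3 → ZMod 2) : Prop where
  crosses : ∀ x y s, T.boundary.CrossesAt x y s → IsPlain P x.1 s → h x = h y
  base : ∀ k b, h ((P k).face b, (P k).corner b 0) = h ((P k).face b, (P k).corner b 1)

namespace IsFoldFunction

variable {g : ℕ} {T T' : GluingData 3 ℕ} {P : Fin g → EdgeRef} {c : Fin g → ℕ}
  {h : (ℕ × Fin 4) × Fin 3 → ZMod 2} {f f' : ℕ × Fin 4} {a b a' b' : Fin 3}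

theorem base_eq (hh : IsFoldFunction T P h) (k : Fin g) (b : Bool) {i j : Fin 3} (hi : i ≠ 2)
    (hj : j ≠ 2) : h ((P k).face b, (P k).corner b i) = h ((P k).face b, (P k).corner b j) := by
  have hcase : ∀ i : Fin 3, i ≠ 2 → i = 0 ∨ i = 1 := by decide
  have := hh.base k b
  rcases hcase i hi with rfl | rfl <;> rcases hcase j hj with rfl | rfl
  · rfl
  · exact this
  · exact this.symm
  · rfl

theorem eq_of_glue (hh : IsFoldFunction T P h) {s : Fin 3} {π : Perm (Fin 3)}
    (hg : T.boundary.glue f s = some (f', π)) (hs : IsPlain P f s) (ha : s ≠ a) :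
    h (f, a) = h (f', π a) :=
  hh.crosses _ _ s ⟨ha, π, hg, rfl⟩ hs

open Classical in
/-- The function of the edges of the triangulation determined by a function on boundary corners. -/
noncomputable def edgeExt (T : GluingData 3 ℕ) (P : Fin g → EdgeRef)
    (h : (ℕ × Fin 4) × Fin 3 → ZMod 2) (x : ℕ × Fin 4 × Fin 4) : ZMod 2 :=
  if ∃ f a b, IsPlainDart T P f a b ∧ T.SameEdge (sideEdge f a b) x ∧ h (f, a) = 1 then 1 else 0

/-- The definition asks for some boundary side on the given edge. There are at most two, glued to
each other in the boundary, and `h` agrees on them, so the choice does not matter. -/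
theorem edgeExt_sideEdge (hh : IsFoldFunction T P h) (hT : T.IsTriangulation)
    (hd : IsPlainDart T P f a b) : edgeExt T P h (sideEdge f a b) = h (f, a) := by
  have h01 : ∀ v : ZMod 2, v = 0 ∨ v = 1 := by decide
  rcases h01 (h (f, a)) with h0 | h1
  · rw [h0, edgeExt, if_neg]
    rintro ⟨f', a', b', hd', hs, h1⟩
    rcases eq_or_boundary_glue_of_sameEdge hT hd'.mem hd.mem hd'.ne hd.ne hs with
      ⟨rfl, rfl, rfl⟩ | ⟨s, π, hsa, hsb, hg, rfl, rfl⟩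
    · rw [h0] at h1
      exact zero_ne_one h1
    · rw [hh.eq_of_glue hg (hd'.isPlain s hsa hsb) hsa, h0] at h1
      exact zero_ne_one h1
  · rw [h1, edgeExt, if_pos ⟨f, a, b, hd, .refl _, h1⟩]

theorem edgeExt_mem (hT : T.IsTriangulation) : edgeExt T P h ∈ T.edgeFun := by
  refine ⟨fun x y hxy => ?_, fun x hx => ?_⟩
  · have : ∀ z, T.SameEdge z x ↔ T.SameEdge z y :=
      fun z => ⟨fun hz => hz.trans hxy.sameEdge, fun hz => hz.trans hxy.sameEdge.symm⟩
    classical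
    exact if_congr (exists₃_congr fun f a b => by rw [this]) rfl rfl
  · rw [edgeExt, if_neg]
    rintro ⟨f, a, b, hd, hs, -⟩
    exact hx ((hs.isEdge_iff hT).1 hd.isEdge)

theorem edgeExt_mem_ker (hh : IsFoldFunction T P h) (hT : T.IsTriangulation)
    (hB : IsIsolatedFillingBouquet T P) :
    (⟨_, edgeExt_mem (P := P) (h := h) hT⟩ : T.edgeFun) ∈ (linkDiff T P).ker := by
  rw [mem_ker_linkDiff]
  intro k b d
  have hp := fun j : Bool => hB.isPlainDart_apex k b (i := if j then 1 else 0) (by cases j <;> decide)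
  cases d
  · rw [EdgeRef.sideEdge_false, EdgeRef.sideEdge_false]
    exact (hh.edgeExt_sideEdge hT (hp false).symm).trans (hh.edgeExt_sideEdge hT (hp true).symm).symm
  · rw [EdgeRef.sideEdge_true, EdgeRef.sideEdge_true]
    exact (hh.edgeExt_sideEdge hT (hp false)).trans
      ((hh.base k b).trans (hh.edgeExt_sideEdge hT (hp true)).symm)

/-- The chain of identifications in `T'` may run through old and layered tetrahedra. Instead of
following it, `h` is extended to an edge function of `T'`, which is constant along any chain. -/
theorem eq_of_sameEdge (hh : IsFoldFunction T P h) (hT : T.IsTriangulation)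
    (hB : IsIsolatedFillingBouquet T P) (hW : IsWedgeFolding T T' P c)
    (hd : IsPlainDart T P f a b) (hd' : IsPlainDart T P f' a' b')
    (hs : T'.SameEdge (sideEdge f a b) (sideEdge f' a' b')) : h (f, a) = h (f', a') := by
  have h1 := edgeFun_sameEdge (hW.extendFun_mem hT hB.diagonal _ (hh.edgeExt_mem_ker hT hB) 0) hs
  have h2 : (sideEdge f a b).1 ∈ T.cells := hd.isEdge.1
  have h3 : (sideEdge f' a' b').1 ∈ T.cells := hd'.isEdge.1
  rw [IsWedgeFolding.extendFun_old h2, IsWedgeFolding.extendFun_old h3] at h1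
  exact (hh.edgeExt_sideEdge hT hd).symm.trans (h1.trans (hh.edgeExt_sideEdge hT hd'))

/-- A function as above is determined by its values outside the quadrilaterals. -/
theorem eq_of_outside {h' : (ℕ × Fin 4) × Fin 3 → ZMod 2} (hh : IsFoldFunction T P h)
    (hh' : IsFoldFunction T P h') (hM : T.IsOneVertexManifold g)
    (hB : IsIsolatedFillingBouquet T P) (hout : ∃ f ∈ T.boundary.cells, IsOutside P f)
    (heq : ∀ f ∈ T.boundary.cells, IsOutside P f → ∀ a, h (f, a) = h' (f, a))
    (hf : f ∈ T.boundary.cells) (a : Fin 3) : h (f, a) = h' (f, a) := by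
  obtain ⟨b, hd⟩ := hB.exists_isPlainDart hf a
  obtain ⟨s, hsa, hsb⟩ := exists_ne_ne a b
  refine hB.plain_induction hM hout (Q := fun f a _ => h (f, a) = h' (f, a))
    (fun f hf hfo a _ _ => heq f hf hfo a) ?_ ?_ ?_ hf hd.ne hsa hsb (hd.isPlain s hsa hsb)
  · intro f s f' π a b hg hs hab hsa hsb H
    rw [hh.eq_of_glue hg hs hsa, hh'.eq_of_glue hg hs hsa, H]
  · intro k b i j hi hj H
    rw [hh.base_eq k b hj hi, hh'.base_eq k b hj hi, H]
  · intro k b i j hi hj H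
    exact H

end IsFoldFunction

namespace IsSideFunctions

variable {g : ℕ} {T T' : GluingData 3 ℕ} {P : Fin g → EdgeRef} {c : Fin g → ℕ}
  {u : Fin g → (ℕ × Fin 4) × Fin 3 → ZMod 2}

theorem apply_face_false (hu : IsSideFunctions T P u) (hM : T.IsOneVertexManifold g)
    (hB : IsIsolatedFillingBouquet T P) {k l : Fin g} (hkl : l ≠ k) {j : Fin 3} (hj : j ≠ 2) :
    u l ((P k).face false, (P k).corner false j) = u l ((P k).face true, (P k).corner true j) := by
  obtain ⟨π, h1, h2⟩ := (hB.diagonal k).boundary_glue hM.isTriangulation true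
  refine (hu.crosses l _ _ _ ⟨?_, π, h1, (h2 j).symm⟩ ?_).symm
  · exact ((P k).corner_injective true).ne hj.symm
  · intro hs
    obtain ⟨b, hb, -⟩ := EdgeRef.isSide_iff.1 hs
    exact hB.face_ne_face hkl _ _ hb.symm

/-- This is where the petals must not cross: both ends of petal `k` lie on the same side of petal
`l`. For `l = k` the values are fixed by the normalisation of `u`. -/
theorem base_eq (hu : IsSideFunctions T P u) (hM : T.IsOneVertexManifold g)
    (hB : IsIsolatedFillingBouquet T P) (l k : Fin g) (b : Bool) :
    u l ((P k).face b, (P k).corner b 0) = u l ((P k).face b, (P k).corner b 1) := by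
  have hne : ∀ b, (P k).corner b 0 ≠ (P k).corner b 2 ∧ (P k).corner b 1 ≠ (P k).corner b 2 :=
    fun b => ⟨((P k).corner_injective b).ne (by decide), ((P k).corner_injective b).ne (by decide)⟩
  by_cases hkl : l = k
  · subst hkl
    cases b
    · rw [hu.eq_one _ _ (hne false).1, hu.eq_one _ _ (hne false).2]
    · rw [hu.eq_zero _ _ (hne true).1, hu.eq_zero _ _ (hne true).2]
  · have htrue : u l ((P k).face true, (P k).corner true 0) =
        u l ((P k).face true, (P k).corner true 1) :=
      hu.eq_of_sameSide (hB.noncrossing l k hkl _ _ ((P k).succAbove_corner true 0)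
        ((P k).succAbove_corner true 1))
    cases b
    · rw [hu.apply_face_false hM hB hkl (by decide), hu.apply_face_false hM hB hkl (by decide), htrue]
    · exact htrue

theorem isFoldFunction (hu : IsSideFunctions T P u) (hM : T.IsOneVertexManifold g)
    (hB : IsIsolatedFillingBouquet T P) (c₀ : ZMod 2) (δ : Fin g → ZMod 2) :
    IsFoldFunction T P fun x => c₀ + ∑ k, δ k * u k x := by
  refine ⟨fun x y s hxy hs => ?_, fun k b => ?_⟩
  · congr 1
    exact Finset.sum_congr rfl fun k _ => by rw [hu.crosses k x y s hxy (hs k)]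
  · congr 1
    exact Finset.sum_congr rfl fun l _ => by rw [hu.base_eq hM hB l k b]

theorem sum_face_false (hu : IsSideFunctions T P u) (hM : T.IsOneVertexManifold g)
    (hB : IsIsolatedFillingBouquet T P) (δ : Fin g → ZMod 2) (k : Fin g) :
    ∑ l, δ l * u l ((P k).face false, (P k).corner false 0) =
      ∑ l, δ l * u l ((P k).face true, (P k).corner true 0) + δ k := by
  rw [← sub_eq_iff_eq_add', ← Finset.sum_sub_distrib, Finset.sum_eq_single k]
  · rw [hu.eq_zero k _ (((P k).corner_injective true).ne (by decide)),
      hu.eq_one k _ (((P k).corner_injective false).ne (by decide))]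
    ring
  · intro l _ hl
    rw [hu.apply_face_false hM hB hl (by decide), sub_self]
  · simp

end IsSideFunctions

/-! ### Vertices and connectedness of the new boundary -/

namespace IsWedgeFolding

variable {g : ℕ} {T T' : GluingData 3 ℕ} {P : Fin g → EdgeRef} {c : Fin g → ℕ}

theorem mem_boundary_cells_iff (hW : IsWedgeFolding T T' P c) {f : ℕ × Fin 4} :
    f ∈ T'.boundary.cells ↔ f ∈ T.boundary.cells ∧ IsOutside P f := by
  rw [mem_boundary_cells, mem_boundary_cells]
  have hout : IsOutside P f → ∀ k, (f.1, f.2) ≠ (P k).face₁ ∧ (f.1, f.2) ≠ (P k).face₂ :=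
    fun h k => ⟨h k true, h k false⟩
  constructor
  · rintro ⟨h1, h2⟩
    have ho : IsOutside P f := by
      rintro k b rfl
      cases b
      · exact absurd (h2.symm.trans (hW.layered k).glue₂) (by simp)
      · exact absurd (h2.symm.trans (hW.layered k).glue₁) (by simp)
    rcases (hW.mem_cells f.1).1 h1 with ht | ⟨k, hk⟩
    · rw [hW.glue_old _ ht _ (hout ho)] at h2
      exact ⟨⟨ht, h2⟩, ho⟩
    · rw [hk] at h2
      obtain ⟨t, i⟩ := f
      simp only at h2
      have h0 := hW.glue0 k
      have h1' := hW.glue1 k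
      have h2' := (hW.layered k).glue2
      have h3 := (hW.layered k).glue3
      fin_cases i
      · exact absurd (h2.symm.trans h0) (by simp)
      · exact absurd (h2.symm.trans h1') (by simp)
      · exact absurd (h2.symm.trans h2') (by simp)
      · exact absurd (h2.symm.trans h3) (by simp)
  · rintro ⟨⟨h1, h2⟩, ho⟩
    exact ⟨(hW.mem_cells _).2 (Or.inl h1), by rw [hW.glue_old _ h1 _ (hout ho), h2]⟩

theorem card_boundary_cells_add (hW : IsWedgeFolding T T' P c) (hB : IsIsolatedFillingBouquet T P) :
    T'.boundary.cells.card + 2 * g = T.boundary.cells.card := by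
  classical
  have himg : ((Finset.univ : Finset (Fin g × Bool)).image fun q => (P q.1).face q.2).card = 2 * g := by
    rw [Finset.card_image_of_injective]
    · simp [mul_comm]
    · rintro ⟨k, b⟩ ⟨k', b'⟩ h
      obtain ⟨rfl, rfl⟩ := hB.face_injective h
      rfl
  rw [← himg, ← Finset.card_union_of_disjoint]
  · congr 1
    ext f
    simp only [Finset.mem_union, hW.mem_boundary_cells_iff, Finset.mem_image, Finset.mem_univ,
      true_and, Prod.exists]
    constructor
    · rintro (h | ⟨k, b, rfl⟩)
      · exact h.1
      · exact (hB.diagonal k).face_mem b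
    · intro h
      by_cases ho : IsOutside P f
      · exact Or.inl ⟨h, ho⟩
      · simp only [IsOutside, not_forall, not_not] at ho
        obtain ⟨k, b, hk⟩ := ho
        exact Or.inr ⟨k, b, hk.symm⟩
  · rw [Finset.disjoint_left]
    intro f hf hf'
    simp only [Finset.mem_image, Finset.mem_univ, true_and, Prod.exists] at hf'
    obtain ⟨k, b, rfl⟩ := hf'
    exact (hW.mem_boundary_cells_iff.1 hf).2 k b rfl

theorem sameEdge_apexEdge' (hW : IsWedgeFolding T T' P c) (k : Fin g) (b d j j' : Bool) :
    T'.SameEdge (apexEdge ((P k).flag b) d j) (apexEdge ((P k).flag b) d j') := by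
  cases j <;> cases j'
  · exact .refl _
  · exact hW.sameEdge_apexEdge k b d
  · exact (hW.sameEdge_apexEdge k b d).symm
  · exact .refl _

theorem sameEdge_apex (hW : IsWedgeFolding T T' P c) (k : Fin g) (b : Bool) {i j : Fin 3}
    (hi : i ≠ 2) (hj : j ≠ 2) :
    T'.SameEdge (sideEdge ((P k).face b) ((P k).corner b i) ((P k).corner b 2))
      (sideEdge ((P k).face b) ((P k).corner b j) ((P k).corner b 2)) := by
  have hcase : ∀ i : Fin 3, i ≠ 2 → ∃ j : Bool, i = if j then 1 else 0 := by decide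
  obtain ⟨i, rfl⟩ := hcase i hi
  obtain ⟨j, rfl⟩ := hcase j hj
  rw [← EdgeRef.sideEdge_true, ← EdgeRef.sideEdge_true]
  exact hW.sameEdge_apexEdge' k b true i j

theorem sameEdge_face (hW : IsWedgeFolding T T' P c) (hB : IsIsolatedFillingBouquet T P) {k : Fin g}
    {β : Bool} {a b a' b' : Fin 3} (h : IsPlainDart T P ((P k).face β) a b)
    (h' : IsPlainDart T P ((P k).face β) a' b') :
    T'.SameEdge (sideEdge ((P k).face β) a b) (sideEdge ((P k).face β) a' b') ∨
      a ≠ a' ∧ T'.SameEdge (sideEdge ((P k).face β) a b) (sideEdge ((P k).face β) b' a') := by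
  have hne : ∀ j : Bool, (P k).corner β (if j then 1 else 0) ≠ (P k).corner β 2 :=
    fun j => ((P k).corner_injective β).ne (by cases j <;> decide)
  rcases hB.isPlainDart_face h with ⟨j, rfl, rfl⟩ | ⟨j, rfl, rfl⟩ <;>
  rcases hB.isPlainDart_face h' with ⟨j', rfl, rfl⟩ | ⟨j', rfl, rfl⟩
  · rw [← EdgeRef.sideEdge_true, ← EdgeRef.sideEdge_true]
    exact Or.inl (hW.sameEdge_apexEdge' k β true j j')
  · rw [← EdgeRef.sideEdge_true, ← EdgeRef.sideEdge_true]
    exact Or.inr ⟨hne j, hW.sameEdge_apexEdge' k β true j j'⟩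
  · rw [← EdgeRef.sideEdge_false, ← EdgeRef.sideEdge_false]
    exact Or.inr ⟨(hne j').symm, hW.sameEdge_apexEdge' k β false j j'⟩
  · rw [← EdgeRef.sideEdge_false, ← EdgeRef.sideEdge_false]
    exact Or.inl (hW.sameEdge_apexEdge' k β false j j')

/-- Every boundary edge other than the petals is identified with a remaining boundary edge. -/
theorem exists_outside (hW : IsWedgeFolding T T' P c) (hM : T.IsOneVertexManifold g)
    (hB : IsIsolatedFillingBouquet T P) (hout : ∃ f ∈ T.boundary.cells, IsOutside P f)
    {f : ℕ × Fin 4} {a b : Fin 3} (hd : IsPlainDart T P f a b) :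
    ∃ y a' b', y ∈ T'.boundary.cells ∧ a' ≠ b' ∧
      T'.SameEdge (sideEdge f a b) (sideEdge y a' b') := by
  obtain ⟨s, hsa, hsb⟩ := exists_ne_ne a b
  refine hB.plain_induction hM hout (Q := fun f a b => ∃ y a' b', y ∈ T'.boundary.cells ∧ a' ≠ b' ∧
      T'.SameEdge (sideEdge f a b) (sideEdge y a' b')) ?_ ?_ ?_ ?_ hd.mem hd.ne hsa hsb
      (hd.isPlain s hsa hsb)
  · intro f hf hfo a b hab
    exact ⟨f, a, b, hW.mem_boundary_cells_iff.2 ⟨hf, hfo⟩, hab, .refl _⟩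
  · rintro f s f' π a b hg hs hab hsa hsb ⟨y, a', b', hy, hab', H⟩
    exact ⟨y, a', b', hy, hab', (hW.sameEdge hM.isTriangulation hB.diagonal
      (sameEdge_of_boundary_glue hM.isTriangulation hg hab hsa hsb)).trans H⟩
  · rintro k b i j hi hj ⟨y, a', b', hy, hab', H⟩
    exact ⟨y, a', b', hy, hab', (hW.sameEdge_apex k b hj hi).trans H⟩
  · rintro k b i j hi hj ⟨y, a', b', hy, hab', H⟩
    exact ⟨y, a', b', hy, hab', (hW.sameEdge_apex k b hj hi).revEdge.trans H⟩

theorem vertexOf_eq_of_sameEdge (hW : IsWedgeFolding T T' P c) {f f' : ℕ × Fin 4}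
    (hf : f ∈ T'.boundary.cells) (hf' : f' ∈ T'.boundary.cells) {a b a' b' : Fin 3} (hab : a ≠ b)
    (hab' : a' ≠ b') (h : T'.SameEdge (sideEdge f a b) (sideEdge f' a' b')) :
    T'.boundary.vertexOf ⟨(f, a), hf⟩ = T'.boundary.vertexOf ⟨(f', a'), hf'⟩ := by
  rcases eq_or_boundary_glue_of_sameEdge hW.isTriangulation hf hf' hab hab' h with
    ⟨rfl, rfl, rfl⟩ | ⟨s, π, hsa, hsb, hg, ha, hb⟩
  · rfl
  · exact Quot.sound ⟨s, π, hsa, hg, ha.symm⟩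

/-- Corners of the triangles used up by layering need values too. Every non-petal side at such a
corner is identified in `T'` with a side of a remaining triangle (`exists_outside`), and the value
of `H` is read at the start of that side. -/
theorem exists_isFoldFunction (hW : IsWedgeFolding T T' P c) (hM : T.IsOneVertexManifold g)
    (hB : IsIsolatedFillingBouquet T P) (hout : ∃ f ∈ T.boundary.cells, IsOutside P f)
    (H : T'.boundary.Vertex → ZMod 2) : ∃ h, IsFoldFunction T P h ∧
      ∀ p : {p : (ℕ × Fin 4) × Fin 3 // p.1 ∈ T'.boundary.cells},
        h p.1 = H (T'.boundary.vertexOf p) := by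
  classical
  let Val : (ℕ × Fin 4) × Fin 3 → ZMod 2 → Prop := fun x v => ∃ b, IsPlainDart T P x.1 x.2 b ∧
    ∃ y a' b', ∃ hy : y ∈ T'.boundary.cells, a' ≠ b' ∧
      T'.SameEdge (sideEdge x.1 x.2 b) (sideEdge y a' b') ∧ v = H (T'.boundary.vertexOf ⟨(y, a'), hy⟩)
  -- The value does not depend on the chosen side. In a remaining triangle both sides start at the
  -- same vertex. In a triangle at a petal, two non-petal sides with the same start are identified
  -- in the same direction.
  have huniq : ∀ x v v', Val x v → Val x v' → v = v' := by
    rintro ⟨f, a⟩ v v' ⟨b, hd, y, c₁, d₁, hy, hcd, hs, rfl⟩ ⟨b', hd', y', c₂, d₂, hy', hcd', hs', rfl⟩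
    simp only at hd hd' hs hs'
    by_cases ho : IsOutside P f
    · have hf := hW.mem_boundary_cells_iff.2 ⟨hd.mem, ho⟩
      rw [← hW.vertexOf_eq_of_sameEdge hf hy hd.ne hcd hs,
        ← hW.vertexOf_eq_of_sameEdge hf hy' hd'.ne hcd' hs']
    · simp only [IsOutside, not_forall, not_not] at ho
      obtain ⟨k, β, rfl⟩ := ho
      rcases hW.sameEdge_face hB hd hd' with h | h
      · rw [hW.vertexOf_eq_of_sameEdge hy hy' hcd hcd' (hs.symm.trans (h.trans hs'))]
      · exact absurd rfl h.1
  have hex : ∀ f ∈ T.boundary.cells, ∀ a, ∃ v, Val (f, a) v := by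
    intro f hf a
    obtain ⟨b, hd⟩ := hB.exists_isPlainDart hf a
    obtain ⟨y, a', b', hy, hab', hs⟩ := hW.exists_outside hM hB hout hd
    exact ⟨_, b, hd, y, a', b', hy, hab', hs, rfl⟩
  let h : (ℕ × Fin 4) × Fin 3 → ZMod 2 := fun x => if hx : ∃ v, Val x v then hx.choose else 0
  have hval : ∀ x v, Val x v → h x = v := by
    intro x v hv
    have hx : ∃ v, Val x v := ⟨v, hv⟩
    simp only [h, dif_pos hx]
    exact huniq x _ _ hx.choose_spec hv
  refine ⟨h, ⟨?_, ?_⟩, ?_⟩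
  · rintro ⟨f, a⟩ ⟨f', a'⟩ s ⟨hsa, π, hg, ha'⟩ hs
    simp only at hsa hg ha' hs
    subst ha'
    obtain ⟨b, hba, hbs⟩ := exists_ne_ne a s
    have hd : IsPlainDart T P f a b := by
      refine ⟨boundary_glue_mem hg, hba.symm, fun r h1 h2 => ?_⟩
      rwa [eq_of_ne_of_ne hba.symm hsa hbs.symm h1 h2]
    obtain ⟨y, c₁, d₁, hy, hcd, hse⟩ := hW.exists_outside hM hB hout hd
    rw [hval (f, a) _ ⟨b, hd, y, c₁, d₁, hy, hcd, hse, rfl⟩]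
    refine (hval (f', π a) _ ⟨π b, hB.isPlainDart_of_glue hM hg hs hba.symm hsa hbs.symm, y, c₁, d₁,
      hy, hcd, ?_, rfl⟩).symm
    exact (hW.sameEdge hM.isTriangulation hB.diagonal
      (sameEdge_of_boundary_glue hM.isTriangulation hg hba.symm hsa hbs.symm)).symm.trans hse
  · intro k b
    have hd := fun i (hi : i ≠ 2) => hB.isPlainDart_apex k b (i := i) hi
    obtain ⟨y, c₁, d₁, hy, hcd, hse⟩ := hW.exists_outside hM hB hout (hd 0 (by decide))
    rw [hval _ _ ⟨_, hd 0 (by decide), y, c₁, d₁, hy, hcd, hse, rfl⟩]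
    exact (hval _ _ ⟨_, hd 1 (by decide), y, c₁, d₁, hy, hcd,
      (hW.sameEdge_apex k b (by decide) (by decide)).trans hse, rfl⟩).symm
  · rintro ⟨⟨f, a⟩, hf⟩
    obtain ⟨b, hb, -⟩ := exists_ne_ne a a
    obtain ⟨hf', ho⟩ := hW.mem_boundary_cells_iff.1 hf
    exact hval _ _ ⟨b, ho.isPlainDart hf' hb.symm, f, a, b, hf, hb.symm, .refl _, rfl⟩

/-- The pairs `(c₀, δ)` parametrise the functions on the new vertices by `c₀ + ∑ δ k * u k`. The
coefficient `δ k` is recovered as the jump across petal `k`, after extending equality to all old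
corners by `eq_of_outside`. Every function arises, by applying `add_sum_eq` to its pullback.
Comparing cardinalities gives the exponent `g + 1`. -/
theorem card_boundary_vertex (hW : IsWedgeFolding T T' P c) (hM : T.IsOneVertexManifold g)
    (hB : IsIsolatedFillingBouquet T P) (hout : ∃ f ∈ T.boundary.cells, IsOutside P f) :
    Nat.card T'.boundary.Vertex = g + 1 := by
  have hT := hM.isTriangulation
  obtain ⟨u, hu⟩ := exists_sideFunctions hM hB
  let F : ZMod 2 × (Fin g → ZMod 2) → (ℕ × Fin 4) × Fin 3 → ZMod 2 :=
    fun q x => q.1 + ∑ k, q.2 k * u k x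
  have hF : ∀ q, IsFoldFunction T P (F q) := fun q => hu.isFoldFunction hM hB q.1 q.2
  let Φ : ZMod 2 × (Fin g → ZMod 2) → T'.boundary.Vertex → ZMod 2 := fun q =>
    Quot.lift (fun p => F q p.1) (by
      rintro ⟨⟨f, a⟩, hf⟩ ⟨⟨f', a'⟩, hf'⟩ ⟨s, π, hsa, hg, ha'⟩
      simp only at hf hf' hsa hg ha'
      subst ha'
      obtain ⟨b, hba, hbs⟩ := exists_ne_ne a s
      obtain ⟨h1, h2⟩ := hW.mem_boundary_cells_iff.1 hf
      obtain ⟨h1', h2'⟩ := hW.mem_boundary_cells_iff.1 hf'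
      exact (hF q).eq_of_sameEdge hT hB hW (h2.isPlainDart h1 hba.symm)
        (h2'.isPlainDart h1' (π.injective.ne hba.symm))
        (sameEdge_of_boundary_glue hW.isTriangulation hg hba.symm hsa hbs.symm))
  have hΦ : Function.Bijective Φ := by
    constructor
    · rintro ⟨c₁, δ₁⟩ ⟨c₂, δ₂⟩ heq
      have hall : ∀ f ∈ T.boundary.cells, ∀ a, F (c₁, δ₁) (f, a) = F (c₂, δ₂) (f, a) := by
        intro f hf a
        refine (hF _).eq_of_outside (hF _) hM hB hout (fun f hf ho a => ?_) hf a
        exact congrFun heq (T'.boundary.vertexOf ⟨(f, a), hW.mem_boundary_cells_iff.2 ⟨hf, ho⟩⟩)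
      have hδ : δ₁ = δ₂ := by
        funext k
        have h1 := hall _ ((hB.diagonal k).face_mem true) ((P k).corner true 0)
        have h2 := hall _ ((hB.diagonal k).face_mem false) ((P k).corner false 0)
        simp only [F, hu.sum_face_false hM hB] at h1 h2
        linear_combination h2 - h1
      subst hδ
      obtain ⟨f, hf, -⟩ := hout
      exact congrArg (·, δ₁) (add_right_cancel (hall f hf 0))
    · intro H
      obtain ⟨h, hh, hH⟩ := hW.exists_isFoldFunction hM hB hout H
      have h8 : (2 : ZMod 2) = 0 := rfl
      let ε : Fin g → ZMod 2 := fun k =>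
        h ((P k).face true, (P k).corner true 0) + h ((P k).face false, (P k).corner false 0)
      have hconst := fun x y => hu.add_sum_eq hM hB (h := h) (ε := ε) (x := x) (y := y) hh.crosses
        (fun k j hj => by
          rw [hh.base_eq k true hj (j := 0) (by decide), hh.base_eq k false hj (j := 0) (by decide)]
          simp only [ε]
          linear_combination h ((P k).face true, (P k).corner true 0) * h8)
      obtain ⟨z, hz, -⟩ := hout
      refine ⟨(h (z, 0) + ∑ k, ε k * u k (z, 0), ε), ?_⟩
      funext v
      obtain ⟨p, rfl⟩ := Quot.exists_rep v
      refine Eq.trans ?_ (hH p)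
      have := hconst (z, 0) p.1 hz (hW.mem_boundary_cells_iff.1 p.2).1
      change _ + ∑ k, ε k * u k p.1 = _
      simp only at this ⊢
      linear_combination this + (∑ k, ε k * u k p.1) * h8
  have hcard := Nat.card_eq_of_bijective Φ hΦ
  rw [card_fun_vertex, Nat.card_prod, Nat.card_fun, Nat.card_zmod, Nat.card_fin, ← pow_succ'] at hcard
  exact (Nat.pow_right_injective le_rfl hcard).symm

theorem boundary_isConnected (hW : IsWedgeFolding T T' P c) (hM : T.IsOneVertexManifold g)
    (hB : IsIsolatedFillingBouquet T P) (hout : ∃ f ∈ T.boundary.cells, IsOutside P f) :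
    T'.boundary.IsConnected := by
  have hT := hM.isTriangulation
  obtain ⟨z₀, hz₀, hzo₀⟩ := hout
  refine ⟨⟨z₀, hW.mem_boundary_cells_iff.2 ⟨hz₀, hzo₀⟩⟩, ?_⟩
  intro z hz y hy
  let Conn := Relation.ReflTransGen (fun s s' => ∃ i π, T'.boundary.glue s i = some (s', π)) z
  have hstep : ∀ f f', f ∈ T'.boundary.cells → f' ∈ T'.boundary.cells → ∀ a b a' b', a ≠ b → a' ≠ b' →
      T'.SameEdge (sideEdge f a b) (sideEdge f' a' b') → Conn f → Conn f' := by
    intro f f' hf hf' a b a' b' hab hab' hs hc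
    rcases eq_or_boundary_glue_of_sameEdge hW.isTriangulation hf hf' hab hab' hs with
      ⟨rfl, -⟩ | ⟨s, π, -, -, hg, -⟩
    · exact hc
    · exact hc.tail ⟨s, π, hg⟩
  obtain ⟨hz1, hz2⟩ := hW.mem_boundary_cells_iff.1 hz
  obtain ⟨hy1, hy2⟩ := hW.mem_boundary_cells_iff.1 hy
  have H := hB.reachable hM hz1 hy1
  -- The path in the old boundary may visit triangles that no longer belong to the new one. So the
  -- statement carried along concerns every remaining triangle with a side identified with a
  -- non-petal side of the current triangle.
  suffices Q : ∀ a b, IsPlainDart T P y a b → ∀ y' c₁ d₁, y' ∈ T'.boundary.cells → c₁ ≠ d₁ →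
      T'.SameEdge (sideEdge y a b) (sideEdge y' c₁ d₁) → Conn y' from
    Q 0 1 (hy2.isPlainDart hy1 (by decide)) y 0 1 hy (by decide) (.refl _)
  clear hy1 hy2 hy
  induction H with
  | refl =>
    intro a b hd y' c₁ d₁ hy' hcd hs
    exact hstep _ _ hz hy' _ _ _ _ hd.ne hcd hs .refl
  | @tail x x' _ h ih =>
    obtain ⟨s, π, hs, hg⟩ := h
    intro a' b' hd' y' c₁ d₁ hy' hcd hse
    obtain ⟨a, b, hab, hsa, hsb⟩ : ∃ a b : Fin 3, a ≠ b ∧ s ≠ a ∧ s ≠ b := by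
      clear hg hs
      revert s
      decide
    have hd : IsPlainDart T P x a b :=
      ⟨boundary_glue_mem hg, hab, fun r h1 h2 => by rwa [eq_of_ne_of_ne hab hsa hsb h1 h2]⟩
    have hxx : T'.SameEdge (sideEdge x a b) (sideEdge x' (π a) (π b)) := hW.sameEdge hT hB.diagonal
      (sameEdge_of_boundary_glue hT hg hab hsa hsb)
    have hdx := hB.isPlainDart_of_glue hM hg hs hab hsa hsb
    by_cases ho : IsOutside P x'
    · have hx' := hW.mem_boundary_cells_iff.2 ⟨hd'.mem, ho⟩
      exact hstep _ _ hx' hy' _ _ _ _ hd'.ne hcd hse (ih a b hd x' _ _ hx' (π.injective.ne hab) hxx)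
    · simp only [IsOutside, not_forall, not_not] at ho
      obtain ⟨k, β, rfl⟩ := ho
      rcases hW.sameEdge_face hB hdx hd' with h | ⟨-, h⟩
      · exact ih a b hd y' c₁ d₁ hy' hcd (hxx.trans (h.trans hse))
      · exact ih a b hd y' d₁ c₁ hy' hcd.symm (hxx.trans (h.trans hse.revEdge))

end IsWedgeFolding

/-! ### The edges identified by folding -/

/-- A directed side, other than the petal, of a triangle at a petal. -/
def EdgeRef.apexDart (e : EdgeRef) (b d j : Bool) : (ℕ × Fin 4) × Fin 3 × Fin 3 :=
  if d then (e.face b, e.corner b (if j then 1 else 0), e.corner b 2)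
  else (e.face b, e.corner b 2, e.corner b (if j then 1 else 0))

theorem EdgeRef.apexEdge_eq (e : EdgeRef) (b d j : Bool) : apexEdge (e.flag b) d j =
    sideEdge (e.apexDart b d j).1 (e.apexDart b d j).2.1 (e.apexDart b d j).2.2 := by
  cases d
  · exact e.sideEdge_false b j
  · exact e.sideEdge_true b j

/-- The number of times a directed side occurs among the sides of triangles at petals. -/
def dartCount {g : ℕ} (P : Fin g → EdgeRef) (x : (ℕ × Fin 4) × Fin 3 × Fin 3)
    (q : Fin g × Bool × Bool) : ZMod 2 :=
  (if (P q.1).apexDart q.2.1 q.2.2 false = x then 1 else 0) +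
    if (P q.1).apexDart q.2.1 q.2.2 true = x then 1 else 0

namespace IsIsolatedFillingBouquet

variable {g : ℕ} {T : GluingData 3 ℕ} {P : Fin g → EdgeRef}

theorem isPlainDart_apexDart (hB : IsIsolatedFillingBouquet T P) (k : Fin g) (b d j : Bool) :
    IsPlainDart T P ((P k).apexDart b d j).1 ((P k).apexDart b d j).2.1
      ((P k).apexDart b d j).2.2 := by
  have := hB.isPlainDart_apex k b (i := if j then 1 else 0) (by cases j <;> decide)
  cases d
  · exact this.symm
  · exact this

theorem apexDart_inj (hB : IsIsolatedFillingBouquet T P) {k k' : Fin g} {b d j b' d' j' : Bool}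
    (h : (P k).apexDart b d j = (P k').apexDart b' d' j') : (k, b, d, j) = (k', b', d', j') := by
  have hf : ∀ k b d j, ((P k).apexDart b d j).1 = (P k).face b := by
    intro k b d j
    cases d <;> rfl
  have h1 := congrArg Prod.fst h
  rw [hf, hf] at h1
  obtain ⟨rfl, rfl⟩ := hB.face_injective h1
  have hinj := (P k).corner_injective b
  have h2 := congrArg (fun x => x.2.1) h
  have h3 := congrArg (fun x => x.2.2) h
  cases d <;> cases d' <;> simp only [EdgeRef.apexDart, Bool.false_eq_true, if_false, if_true] at h2 h3
  · have := hinj h3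
    cases j <;> cases j' <;> first | rfl | exact absurd this (by decide)
  · have := hinj h3
    cases j <;> exact absurd this (by decide)
  · have := hinj h2
    cases j <;> exact absurd this (by decide)
  · have := hinj h2
    cases j <;> cases j' <;> first | rfl | exact absurd this (by decide)

theorem dartCount_apexDart (hB : IsIsolatedFillingBouquet T P) (k : Fin g) (b d j : Bool) :
    dartCount P ((P k).apexDart b d j) = Pi.single (k, b, d) 1 := by
  have key : ∀ k' b' d' j', ((P k').apexDart b' d' j' = (P k).apexDart b d j) ↔
      (k', b', d') = (k, b, d) ∧ j' = j := by
    intro k' b' d' j'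
    constructor
    · intro h
      have := hB.apexDart_inj h
      simp only [Prod.mk.injEq] at this ⊢
      tauto
    · rintro ⟨h, rfl⟩
      simp only [Prod.mk.injEq] at h
      obtain ⟨rfl, rfl, rfl⟩ := h
      rfl
  funext ⟨k', b', d'⟩
  simp only [dartCount, key, Pi.single_apply]
  by_cases h : (k', b', d') = (k, b, d)
  · cases j <;> simp [h]
  · simp [h]

theorem dartCount_outside {f : ℕ × Fin 4} (ho : IsOutside P f) (a b : Fin 3) :
    dartCount P (f, a, b) = 0 := by
  have : ∀ k b' d j, (P k).apexDart b' d j ≠ (f, a, b) := by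
    intro k b' d j h
    have h1 := congrArg Prod.fst h
    cases d <;> exact ho k b' h1.symm
  funext q
  simp [dartCount, this]

end IsIsolatedFillingBouquet

namespace GluingData.IsOneVertexManifold

variable {g : ℕ} {T : GluingData 3 ℕ} {P : Fin g → EdgeRef}

theorem sameEdge_sideEdge_iff (hM : T.IsOneVertexManifold g) {f f' f₁ : ℕ × Fin 4} {s : Fin 3}
    {π : Perm (Fin 3)} (hg : T.boundary.glue f s = some (f', π)) {a b a₁ b₁ : Fin 3} (hab : a ≠ b)
    (hsa : s ≠ a) (hsb : s ≠ b) (hf₁ : f₁ ∈ T.boundary.cells) (hab₁ : a₁ ≠ b₁) :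
    T.SameEdge (sideEdge f a b) (sideEdge f₁ a₁ b₁) ↔
      (f₁, a₁, b₁) = (f, a, b) ∨ (f₁, a₁, b₁) = (f', π a, π b) := by
  constructor
  · intro h
    rcases eq_or_boundary_glue_of_sameEdge hM.isTriangulation (boundary_glue_mem hg) hf₁ hab hab₁ h
      with ⟨rfl, rfl, rfl⟩ | ⟨r, ρ, hra, hrb, hg', rfl, rfl⟩
    · exact Or.inl rfl
    · rw [eq_of_ne_of_ne hab hsa hsb hra hrb, hg] at hg'
      obtain ⟨rfl, rfl⟩ := Prod.mk.inj (Option.some.inj hg')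
      exact Or.inr rfl
  · rintro (h | h) <;> simp only [Prod.mk.injEq] at h <;> obtain ⟨rfl, rfl, rfl⟩ := h
    · exact .refl _
    · exact sameEdge_of_boundary_glue hM.isTriangulation hg hab hsa hsb

/-- A directed boundary edge consists of exactly two directed boundary sides, which are distinct
because no side is glued to itself. Its indicator therefore counts both. -/
theorem linkDiff_indicator (hM : T.IsOneVertexManifold g) (hB : IsIsolatedFillingBouquet T P)
    {f f' : ℕ × Fin 4} {s : Fin 3} {π : Perm (Fin 3)} (hg : T.boundary.glue f s = some (f', π))
    {a b : Fin 3} (hab : a ≠ b) (hsa : s ≠ a) (hsb : s ≠ b) :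
    ∃ h : T.edgeFun, linkDiff T P h = dartCount P (f, a, b) + dartCount P (f', π a, π b) := by
  classical
  have hx : T.IsEdge (sideEdge f a b) :=
    ⟨(mem_boundary_cells.1 (boundary_glue_mem hg)).1, Fin.succAbove_right_injective.ne hab⟩
  have hne : ((f', π a, π b) : (ℕ × Fin 4) × Fin 3 × Fin 3) ≠ (f, a, b) := by
    intro h
    simp only [Prod.mk.injEq] at h
    obtain ⟨rfl, ha, hb⟩ := h
    refine (hM.boundary_genus.1 _ _ _ _ hg).2.2.2 (Prod.ext rfl ?_)
    refine eq_of_ne_of_ne hab hsa hsb ?_ ?_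
    · rw [← ha, π.injective.ne_iff]
      exact hsa
    · rw [← hb, π.injective.ne_iff]
      exact hsb
  refine ⟨⟨_, indicator_mem_edgeFun hM.isTriangulation hx⟩, ?_⟩
  have key : ∀ k b' d j, Set.indicator {y | T.SameEdge (sideEdge f a b) y} (1 : ℕ × Fin 4 × Fin 4 → ZMod 2)
      (apexEdge ((P k).flag b') d j) =
      (if (P k).apexDart b' d j = (f, a, b) then 1 else 0) +
        if (P k).apexDart b' d j = (f', π a, π b) then 1 else 0 := by
    intro k b' d j
    have hd := hB.isPlainDart_apexDart k b' d j
    have := hM.sameEdge_sideEdge_iff hg hab hsa hsb hd.mem hd.ne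
    rw [← EdgeRef.apexEdge_eq] at this
    rw [Set.indicator_apply]
    refine (if_congr (Q := (P k).apexDart b' d j = (f, a, b) ∨
      (P k).apexDart b' d j = (f', π a, π b)) this rfl rfl).trans ?_
    by_cases h1 : (P k).apexDart b' d j = (f, a, b)
    · rw [if_pos (Or.inl h1), if_pos h1, if_neg, add_zero]
      · rfl
      · rw [h1]
        exact hne.symm
    · rw [if_neg h1, zero_add]
      refine if_congr ?_ rfl rfl
      exact ⟨fun h => h.resolve_left h1, Or.inr⟩
  funext ⟨k, b', d⟩
  refine (congrArg₂ (· + ·) (key k b' d false) (key k b' d true)).trans ?_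
  simp only [Pi.add_apply, dartCount]
  ring

/-- A side outside the quadrilaterals has count zero, glued sides have counts congruent modulo the
range, and the two sides at an apex have equal counts. By `plain_induction` the counts of all
non-petal sides lie in the range, and among them are all basis vectors. -/
theorem linkDiff_surjective (hM : T.IsOneVertexManifold g) (hB : IsIsolatedFillingBouquet T P)
    (hout : ∃ f ∈ T.boundary.cells, IsOutside P f) : Function.Surjective (linkDiff T P) := by
  have key : ∀ f a b, IsPlainDart T P f a b → dartCount P (f, a, b) ∈ (linkDiff T P).range := by
    intro f a b hd
    obtain ⟨s, hsa, hsb⟩ := exists_ne_ne a b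
    refine hB.plain_induction hM hout (Q := fun f a b => dartCount P (f, a, b) ∈ (linkDiff T P).range)
      ?_ ?_ ?_ ?_ hd.mem hd.ne hsa hsb (hd.isPlain s hsa hsb)
    · intro f _ ho a b _
      rw [IsIsolatedFillingBouquet.dartCount_outside ho]
      exact zero_mem _
    · intro f s f' π a b hg _ hab hsa hsb H
      obtain ⟨h, hh⟩ := hM.linkDiff_indicator hB hg hab hsa hsb
      rw [eq_sub_of_add_eq hh.symm]
      exact sub_mem ⟨h, rfl⟩ H
    all_goals
      have hcase : ∀ i : Fin 3, i ≠ 2 → ∃ j : Bool, i = if j then 1 else 0 := by decide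
      intro k b i j hi hj H
      obtain ⟨i, rfl⟩ := hcase i hi
      obtain ⟨j, rfl⟩ := hcase j hj
    · have h1 := hB.dartCount_apexDart k b true i
      rw [← hB.dartCount_apexDart k b true j] at h1
      exact h1 ▸ H
    · have h1 := hB.dartCount_apexDart k b false i
      rw [← hB.dartCount_apexDart k b false j] at h1
      exact h1 ▸ H
  intro v
  have : v = ∑ q, v q • (Pi.single q 1 : Fin g × Bool × Bool → ZMod 2) := by
    funext q
    simp [Finset.sum_apply, Pi.single_apply]
  change v ∈ (linkDiff T P).range
  rw [this]
  refine sum_mem fun q _ => ?_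
  obtain ⟨k, b, d⟩ := q
  have h1 := key _ _ _ (hB.isPlainDart_apexDart k b d true)
  rw [hB.dartCount_apexDart] at h1
  have h01 : ∀ v : ZMod 2, v = 0 ∨ v = 1 := by decide
  rcases h01 (v (k, b, d)) with h | h
  · rw [h, zero_smul]
    exact zero_mem _
  · rw [h, one_smul]
    exact h1

theorem card_ker_linkDiff (hM : T.IsOneVertexManifold g) (hB : IsIsolatedFillingBouquet T P)
    (hout : ∃ f ∈ T.boundary.cells, IsOutside P f) :
    Nat.card (linkDiff T P).ker * 2 ^ (4 * g) = 2 ^ Nat.card T.link.Vertex := by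
  have h1 := (linkDiff T P).ker.card_mul_index
  rw [AddSubgroup.index_ker, AddMonoidHom.range_eq_top.2 (hM.linkDiff_surjective hB hout),
    AddSubgroup.card_top, card_edgeFun hM.isTriangulation] at h1
  rw [← h1, Nat.card_fun, Nat.card_zmod, Nat.card_prod, Nat.card_prod, Nat.card_fin]
  congr 2
  simp [mul_comm]

/-- The edges can be directed compatibly with the identifications. -/
theorem exists_direction (hM : T.IsOneVertexManifold g) :
    ∃ h : T.edgeFun, ∀ x, T.IsEdge x → h.1 (revEdge x) = h.1 x + 1 := by
  classical
  have hT := hM.isTriangulation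
  have hc : Countable T.DirectedEdge := by
    have : Countable T.DirectedSide := inferInstanceAs (Countable {p : _ // _})
    exact inferInstanceAs (Countable (Quot _))
  -- Any injective numbering selects one of the two directions of each edge, which are different
  -- because the edges are valid.
  obtain ⟨e, he⟩ := exists_injective_nat T.DirectedEdge
  let F : ℕ × Fin 4 × Fin 4 → ZMod 2 := fun x =>
    if hx : T.IsEdge x then
      if e (T.edgeOf ⟨x, hx⟩) < e (T.edgeOf ⟨revEdge x, hx.1, hx.2.symm⟩) then 1 else 0
    else 0
  refine ⟨⟨F, fun x y hxy => ?_, fun x hx => dif_neg hx⟩, fun x hx => ?_⟩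
  · obtain ⟨hx, hy⟩ := hxy.isEdge hT
    have h1 : T.edgeOf ⟨x, hx⟩ = T.edgeOf ⟨y, hy⟩ := (edgeOf_eq_iff hT).2 hxy.sameEdge
    have h2 : T.edgeOf ⟨revEdge x, hx.1, hx.2.symm⟩ = T.edgeOf ⟨revEdge y, hy.1, hy.2.symm⟩ :=
      (edgeOf_eq_iff hT).2 hxy.sameEdge.revEdge
    simp only [F, dif_pos hx, dif_pos hy, h1, h2]
  · have hx' : T.IsEdge (revEdge x) := ⟨hx.1, hx.2.symm⟩
    have hne := he.ne (hM.edgesValid ⟨x, hx⟩)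
    change F (revEdge x) = F x + 1
    simp only [F, dif_pos hx, dif_pos hx']
    change (if e (T.edgeOf ⟨revEdge x, _⟩) < e (T.edgeOf ⟨x, _⟩) then (1 : ZMod 2) else 0) = _
    change e (T.edgeOf ⟨x, hx⟩) ≠ e (T.edgeOf ⟨revEdge x, hx'⟩) at hne
    rcases lt_or_gt_of_ne hne with h | h
    · rw [if_pos h, if_neg h.not_gt]
      decide
    · rw [if_pos h, if_neg h.not_gt]
      decide

end GluingData.IsOneVertexManifold

/-- Take any direction `h` of the edges and correct it by an undirected function `m + m'`, where
`m'` is `m` on reversed edges. The correction keeps opposite directions opposite. For a directed `h`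
the failures at `d` and `!d` coincide, so it is enough that `m` equals the failure at `true` and is
zero at `false`. -/
theorem IsWedgeFolding.edgesValid {g : ℕ} {T T' : GluingData 3 ℕ} {P : Fin g → EdgeRef}
    {c : Fin g → ℕ} (hW : IsWedgeFolding T T' P c) (hM : T.IsOneVertexManifold g)
    (hB : IsIsolatedFillingBouquet T P) (hout : ∃ f ∈ T.boundary.cells, IsOutside P f) :
    T'.EdgesValid := by
  obtain ⟨h, hrev⟩ := hM.exists_direction
  obtain ⟨m, hm⟩ := hM.linkDiff_surjective hB hout
    fun q => if q.2.2 then linkDiff T P h (q.1, q.2.1, true) else 0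
  have hmr : (fun x => m.1 (revEdge x)) ∈ T.edgeFun :=
    ⟨fun x y hxy => m.2.1 _ _ hxy.revEdge, fun x hx => m.2.2 _ fun hx' => hx ⟨hx'.1, hx'.2.symm⟩⟩
  let m' : T.edgeFun := ⟨_, hmr⟩
  have h1 : ∀ k b d, linkDiff T P m' (k, b, d) = linkDiff T P m (k, b, !d) := by
    intro k b d
    change m.1 (revEdge _) + m.1 (revEdge _) = _
    rw [revEdge_apexEdge, revEdge_apexEdge]
    rfl
  have h2 : ∀ k b, linkDiff T P h (k, b, false) = linkDiff T P h (k, b, true) := by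
    intro k b
    change h.1 _ + h.1 _ = h.1 _ + h.1 _
    have hr : ∀ j, h.1 (apexEdge ((P k).flag b) false j) = h.1 (apexEdge ((P k).flag b) true j) + 1 := by
      intro j
      have := hrev (apexEdge ((P k).flag b) true j)
        (by rw [EdgeRef.apexEdge_eq]; exact (hB.isPlainDart_apexDart k b true j).isEdge)
      rwa [revEdge_apexEdge] at this
    simp only [hr]
    have h8 : (2 : ZMod 2) = 0 := rfl
    linear_combination h8
  refine hW.edgesValid_of_orientation hM.isTriangulation hB.diagonal (h + m + m') ?_ ?_
  · rw [AddMonoidHom.mem_ker]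
    funext ⟨k, b, d⟩
    have h8 : (2 : ZMod 2) = 0 := rfl
    rw [map_add, map_add]
    simp only [Pi.add_apply, h1, hm, Pi.zero_apply]
    cases d
    · simp only [Bool.not_false, if_true, Bool.false_eq_true, if_false, h2]
      linear_combination linkDiff T P h (k, b, true) * h8
    · simp only [Bool.not_true, if_true, Bool.false_eq_true, if_false]
      linear_combination linkDiff T P h (k, b, true) * h8
  · intro x hx
    have := hrev x hx
    change h.1 (revEdge x) + m.1 (revEdge x) + m.1 x = h.1 x + m.1 x + m.1 (revEdge x) + 1
    linear_combination this

/-! ### A single petal -/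

namespace GluingData.IsOneVertexManifold

variable {T : GluingData 3 ℕ} {P : Fin 1 → EdgeRef}

theorem eq_face_of_mem (hM : T.IsOneVertexManifold 1) (hB : IsIsolatedFillingBouquet T P)
    {f : ℕ × Fin 4} (hf : f ∈ T.boundary.cells) : ∃ b, f = (P 0).face b := by
  have h1 : ({(P 0).face true, (P 0).face false} : Finset (ℕ × Fin 4)) ⊆ T.boundary.cells := by
    intro x hx
    rcases Finset.mem_insert.1 hx with rfl | hx
    · exact (hB.diagonal 0).face_mem true
    · rw [Finset.mem_singleton.1 hx]
      exact (hB.diagonal 0).face_mem false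
  have h2 := hM.card_boundary_cells
  have h3 := Finset.eq_of_subset_of_card_le h1 (by
    rw [Finset.card_pair (hB.diagonal 0).face_ne]
    omega)
  rw [← h3] at hf
  rcases Finset.mem_insert.1 hf with rfl | hf
  · exact ⟨true, rfl⟩
  · exact ⟨false, Finset.mem_singleton.1 hf⟩

/-- Otherwise the two non-petal sides of the first triangle would be glued to each other, and the
second triangle could be reached only across the petal. -/
theorem glue_face_true (hM : T.IsOneVertexManifold 1) (hB : IsIsolatedFillingBouquet T P) {i : Fin 3}
    (hi : i ≠ 2) : ∃ π, T.boundary.glue ((P 0).face true) ((P 0).corner true i) =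
      some ((P 0).face false, π) := by
  by_contra hn
  have hinj := (P 0).corner_injective true
  have hF := (hB.diagonal 0).face_mem true
  obtain ⟨⟨f', π⟩, hg⟩ := Option.ne_none_iff_exists'.1
    (hM.boundary_closed _ hF ((P 0).corner true i))
  obtain ⟨-, hf', hg', hne⟩ := hM.boundary_genus.1 _ _ _ _ hg
  obtain ⟨b, rfl⟩ := hM.eq_face_of_mem hB hf'
  cases b
  · exact hn ⟨π, hg⟩
  have hpl := hB.isPlain_of_glue hM hg (hB.isPlain_face_iff.2 (hinj.ne hi))
  rw [hB.isPlain_face_iff] at hpl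
  have hsides : ∀ s, s ≠ (P 0).corner true 2 → s = (P 0).corner true i ∨ s = π ((P 0).corner true i) := by
    intro s hs
    by_contra! h
    exact h.2 (eq_of_ne_of_ne (hinj.ne hi) (fun h => hne (Prod.ext rfl h)) hpl h.1 hs)
  have hr := hB.reachable hM hF ((hB.diagonal 0).face_mem false)
  have : ∀ f, Relation.ReflTransGen (fun x y => ∃ s π, IsPlain P x s ∧
      T.boundary.glue x s = some (y, π)) ((P 0).face true) f → f = (P 0).face true := by
    intro f h
    induction h with
    | refl => rfl
    | tail _ h ih =>
      obtain ⟨s, ρ, hs, h⟩ := h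
      rw [ih] at hs h
      rcases hsides s (hB.isPlain_face_iff.1 hs) with rfl | rfl
      · rw [hg] at h
        exact (Prod.mk.inj (Option.some.inj h)).1.symm
      · rw [hg'] at h
        exact (Prod.mk.inj (Option.some.inj h)).1.symm
  exact (hB.diagonal 0).face_ne (this _ hr).symm

/-- On a torus, the sides of one triangle at the petal running to its apex are glued to the sides of
the other triangle running from its apex. -/
theorem exists_glue_apexDart (hM : T.IsOneVertexManifold 1) (hB : IsIsolatedFillingBouquet T P)
    (j : Bool) : ∃ s π j', T.boundary.glue ((P 0).face true) s = some ((P 0).face false, π) ∧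
      s ≠ (P 0).corner true (if j then 1 else 0) ∧ s ≠ (P 0).corner true 2 ∧
      ((P 0).face false, π ((P 0).corner true (if j then 1 else 0)), π ((P 0).corner true 2)) =
        (P 0).apexDart false false j' := by
  obtain ⟨u, hu⟩ := exists_sideFunctions hM hB
  have hinj := (P 0).corner_injective true
  have hj : (if j then 1 else 0 : Fin 3) ≠ 2 := by cases j <;> decide
  obtain ⟨i, hij, hi⟩ := exists_ne_ne (if j then 1 else 0) 2
  obtain ⟨π, hg⟩ := hM.glue_face_true hB hi
  have h1 := hu.crosses 0 ((P 0).face true, (P 0).corner true (if j then 1 else 0))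
    ((P 0).face false, π ((P 0).corner true (if j then 1 else 0))) ((P 0).corner true i)
    ⟨hinj.ne hij, π, hg, rfl⟩ (hB.isPlain_face_iff.2 (hinj.ne hi) 0)
  rw [hu.eq_zero 0 _ (hinj.ne hj)] at h1
  -- The side function is `0` at the ends of the petal in one triangle and `1` at its ends in the
  -- other, so an end of the petal can only be matched with the opposite apex.
  have h2 : π ((P 0).corner true (if j then 1 else 0)) = (P 0).corner false 2 := by
    by_contra hn
    rw [hu.eq_one 0 _ hn] at h1
    exact zero_ne_one h1
  have h3 : π ((P 0).corner true 2) ≠ (P 0).corner false 2 := by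
    rw [← h2]
    exact π.injective.ne (hinj.ne hj.symm)
  obtain ⟨j', hj'⟩ : ∃ j' : Bool, π ((P 0).corner true 2) =
      (P 0).corner false (if j' then 1 else 0) := by
    rcases EdgeRef.eq_corner_of_ne h3 with h | h
    · exact ⟨false, h⟩
    · exact ⟨true, h⟩
  exact ⟨_, π, j', hg, hinj.ne hij, hinj.ne hi, by rw [h2, hj']; rfl⟩

/-- On the torus the two sides towards one apex are, as edges, the two sides away from the other
apex. The conditions at the two triangles are therefore the same sums with the direction reversed.
-/
theorem linkDiff_face_false (hM : T.IsOneVertexManifold 1) (hB : IsIsolatedFillingBouquet T P)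
    (h : T.edgeFun) (d : Bool) :
    linkDiff T P h (0, false, !d) = linkDiff T P h (0, true, d) := by
  have hinj := (P 0).corner_injective true
  have hne : ∀ j : Bool, (if j then 1 else 0 : Fin 3) ≠ 2 := fun j => by cases j <;> decide
  have hse : ∀ j, ∃ j', T.SameEdge (apexEdge ((P 0).flag true) true j)
      (apexEdge ((P 0).flag false) false j') := by
    intro j
    obtain ⟨s, π, j', hg, h1, h2, h3⟩ := hM.exists_glue_apexDart hB j
    refine ⟨j', ?_⟩
    have := sameEdge_of_boundary_glue hM.isTriangulation hg (hinj.ne (hne j)) h1 h2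
    rw [EdgeRef.apexEdge_eq (P 0) false, ← h3]
    rwa [EdgeRef.sideEdge_true]
  choose σ hσ using hse
  -- Otherwise two different sides of the first triangle would lie on one edge and be glued to each
  -- other, against `glue_face_true`.
  have hσne : σ false ≠ σ true := by
    intro h
    have h1 := hσ false
    rw [h] at h1
    have h2 := h1.trans (hσ true).symm
    rw [EdgeRef.sideEdge_true, EdgeRef.sideEdge_true] at h2
    have hF := (hB.diagonal 0).face_mem true
    rcases eq_or_boundary_glue_of_sameEdge hM.isTriangulation hF hF (hinj.ne (hne false))
      (hinj.ne (hne true)) h2 with ⟨-, h3, -⟩ | ⟨s, π, -, hs, hg, -⟩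
    · exact absurd (hinj h3) (by decide)
    · obtain ⟨i, rfl⟩ := (P 0).exists_eq_corner true s
      obtain ⟨ρ, hg'⟩ := hM.glue_face_true hB (i := i) (fun h => hs (by rw [h]))
      rw [hg] at hg'
      exact (hB.diagonal 0).face_ne (Prod.mk.inj (Option.some.inj hg')).1
  have hd : ∀ j, h.1 (apexEdge ((P 0).flag false) (!d) (σ j)) =
      h.1 (apexEdge ((P 0).flag true) d j) := by
    intro j
    cases d
    · have := (hσ j).revEdge
      rw [revEdge_apexEdge, revEdge_apexEdge] at this
      exact (edgeFun_sameEdge h.2 this).symm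
    · exact (edgeFun_sameEdge h.2 (hσ j)).symm
  change h.1 _ + h.1 _ = h.1 _ + h.1 _
  rw [← hd false, ← hd true]
  cases h0 : σ false <;> cases h1 : σ true
  · exact absurd (h0.trans h1.symm) hσne
  · rfl
  · exact add_comm _ _
  · exact absurd (h0.trans h1.symm) hσne

/-- By `linkDiff_face_false` the conditions at one triangle imply those at the other. The remaining
two, one for each direction, are independent: the indicator of a single non-petal edge hits one
basis vector. -/
theorem card_ker_linkDiff_one (hM : T.IsOneVertexManifold 1) (hB : IsIsolatedFillingBouquet T P) :
    Nat.card (linkDiff T P).ker * 4 = 2 ^ Nat.card T.link.Vertex := by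
  let ψ : T.edgeFun →+ (Bool → ZMod 2) :=
    { toFun := fun h d => linkDiff T P h (0, true, d)
      map_zero' := by
        rw [map_zero]
        rfl
      map_add' := fun h h' => by
        rw [map_add]
        rfl }
  have hker : ψ.ker = (linkDiff T P).ker := by
    ext h
    rw [AddMonoidHom.mem_ker, AddMonoidHom.mem_ker]
    constructor
    · intro h0
      have htrue : ∀ d, linkDiff T P h (0, true, d) = 0 := fun d => congrFun h0 d
      funext ⟨k, b, d⟩
      obtain rfl := Subsingleton.elim k 0
      cases b
      · rw [← Bool.not_not d, hM.linkDiff_face_false hB, htrue]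
        rfl
      · exact htrue d
    · intro h0
      funext d
      change linkDiff T P h _ = 0
      rw [h0]
      rfl
  have hsurj : Function.Surjective ψ := by
    have hinj := (P 0).corner_injective true
    have hsingle : ∀ d, (Pi.single d 1 : Bool → ZMod 2) ∈ ψ.range := by
      intro d
      obtain ⟨s, π, j', hg, h1, h2, h3⟩ := hM.exists_glue_apexDart hB false
      have hcount : ∀ h : T.edgeFun, linkDiff T P h = dartCount P ((P 0).apexDart true d false) +
          dartCount P ((P 0).apexDart false (!d) j') → ψ h = Pi.single d 1 := by
        intro h hh
        rw [hB.dartCount_apexDart, hB.dartCount_apexDart] at hh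
        funext e
        change linkDiff T P h (0, true, e) = _
        rw [hh]
        simp [Pi.single_apply]
      cases d
      · obtain ⟨h, hh⟩ := hM.linkDiff_indicator hB hg (hinj.ne (a₁ := 2) (a₂ := 0) (by decide)) h2 h1
        refine ⟨h, hcount h (hh.trans ?_)⟩
        congr 2
        have := congrArg (fun x => (x.1, x.2.2, x.2.1)) h3
        exact this
      · obtain ⟨h, hh⟩ := hM.linkDiff_indicator hB hg (hinj.ne (a₁ := 0) (a₂ := 2) (by decide)) h1 h2
        refine ⟨h, hcount h (hh.trans ?_)⟩
        congr 2
    intro v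
    change v ∈ ψ.range
    have : v = ∑ q, v q • (Pi.single q 1 : Bool → ZMod 2) := by
      funext q
      simp [Pi.single_apply]
    rw [this]
    refine sum_mem fun q _ => ?_
    have h01 : ∀ v : ZMod 2, v = 0 ∨ v = 1 := by decide
    rcases h01 (v q) with h | h
    · rw [h, zero_smul]
      exact zero_mem _
    · rw [h, one_smul]
      exact hsingle q
  have h1 := ψ.ker.card_mul_index
  rw [AddSubgroup.index_ker, AddMonoidHom.range_eq_top.2 hsurj, AddSubgroup.card_top,
    card_edgeFun hM.isTriangulation, hker, Nat.card_fun, Nat.card_zmod] at h1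
  rw [← h1]
  simp

end GluingData.IsOneVertexManifold

/-! ### The result of the Wedge-Folder -/

theorem GluingData.two_mul_eulerChar_link {T : GluingData 3 ℕ} (hT : T.IsTriangulation) :
    2 * T.link.eulerChar = 2 * (Nat.card T.link.Vertex : ℤ) - 4 * T.cells.card -
      3 * T.boundary.cells.card := by
  have h1 := two_mul_card_facet (link_isTriangulation hT)
  have h2 : T.link.cells.card = 4 * T.cells.card := by
    simp [link, mul_comm]
  rw [card_link_freeSide] at h1
  rw [eulerChar]
  omega

namespace IsWedgeFolding

variable {g : ℕ} {T T' : GluingData 3 ℕ} {P : Fin g → EdgeRef} {c : Fin g → ℕ}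

theorem cells_eq (hW : IsWedgeFolding T T' P c) :
    T'.cells = T.cells ∪ Finset.univ.image c := by
  ext t
  simp [hW.mem_cells, eq_comm]

theorem card_cells (hW : IsWedgeFolding T T' P c) : T'.cells.card = T.cells.card + g := by
  rw [hW.cells_eq, Finset.card_union_of_disjoint, Finset.card_image_of_injective _ hW.injective,
    Finset.card_univ, Fintype.card_fin]
  rw [Finset.disjoint_left]
  intro t ht ht'
  obtain ⟨k, -, rfl⟩ := Finset.mem_image.1 ht'
  exact hW.notMem k ht

theorem card_boundary_cells (hW : IsWedgeFolding T T' P c) (hM : T.IsOneVertexManifold g)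
    (hB : IsIsolatedFillingBouquet T P) : T'.boundary.cells.card + 2 = 2 * g := by
  have h1 := hW.card_boundary_cells_add hB
  have h2 := hM.card_boundary_cells
  omega

theorem exists_isOutside (hW : IsWedgeFolding T T' P c) (hM : T.IsOneVertexManifold g)
    (hB : IsIsolatedFillingBouquet T P) (hg : 2 ≤ g) :
    ∃ f ∈ T.boundary.cells, IsOutside P f := by
  have h := hW.card_boundary_cells hM hB
  obtain ⟨f, hf⟩ := Finset.card_pos.1 (show 0 < T'.boundary.cells.card by omega)
  exact ⟨f, hW.mem_boundary_cells_iff.1 hf⟩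

theorem boundary_cells_eq_empty {P : Fin 1 → EdgeRef} {c : Fin 1 → ℕ}
    (hW : IsWedgeFolding T T' P c) (hM : T.IsOneVertexManifold 1)
    (hB : IsIsolatedFillingBouquet T P) : T'.boundary.cells = ∅ := by
  have h := hW.card_boundary_cells hM hB
  exact Finset.card_eq_zero.1 (by omega)

theorem card_link_vertex_add (hW : IsWedgeFolding T T' P c) (hM : T.IsOneVertexManifold g)
    (hB : IsIsolatedFillingBouquet T P) (hg : 2 ≤ g) :
    Nat.card T'.link.Vertex + 2 * g = Nat.card T.link.Vertex := by
  have h1 := hW.card_edgeFun hM.isTriangulation hB.diagonal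
  rw [GluingData.card_edgeFun hW.isTriangulation] at h1
  have h2 := hM.card_ker_linkDiff hB (hW.exists_isOutside hM hB hg)
  refine Nat.pow_right_injective le_rfl (?_ : 2 ^ _ = 2 ^ _)
  have h4 : (4 : ℕ) ^ g = 2 ^ (2 * g) := by
    rw [pow_mul]
    norm_num
  rw [← h2, pow_add, h1, mul_assoc, h4, ← pow_add]
  congr 2
  omega

theorem card_link_vertex_one {P : Fin 1 → EdgeRef} {c : Fin 1 → ℕ}
    (hW : IsWedgeFolding T T' P c) (hM : T.IsOneVertexManifold 1)
    (hB : IsIsolatedFillingBouquet T P) : Nat.card T'.link.Vertex = Nat.card T.link.Vertex := by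
  have h1 := hW.card_edgeFun hM.isTriangulation hB.diagonal
  rw [GluingData.card_edgeFun hW.isTriangulation, pow_one, hM.card_ker_linkDiff_one hB] at h1
  exact Nat.pow_right_injective le_rfl h1

/-- For `g ≥ 2`, substituting `2g` fewer link vertices, `g` more tetrahedra and `2g - 2` boundary
triangles gives Euler characteristic `1 - g`, which is `2` minus the `g + 1` circles. For `g = 1`
there are no circles and the value is `2`. -/
theorem link_isSurfaceOfGenus_zero (hW : IsWedgeFolding T T' P c) (hM : T.IsOneVertexManifold g)
    (hB : IsIsolatedFillingBouquet T P) : T'.link.IsSurfaceOfGenus 0 := by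
  have hT := hM.isTriangulation
  refine ⟨link_isTriangulation hW.isTriangulation,
    hW.link_isConnected hT hB.diagonal hM.link_disc.1.2.1,
    link_isOrientable (hW.isOrientable hT hB.diagonal hM.orientable), ?_⟩
  have h1 := two_mul_eulerChar_link hW.isTriangulation
  have h2 := hM.card_link_vertex
  have h3 := hW.card_boundary_cells hM hB
  have h4 := hW.card_cells
  rw [card_link_boundaryCircle hW.isTriangulation]
  by_cases hg : 2 ≤ g
  · have h5 := hW.card_link_vertex_add hM hB hg
    rw [hW.card_boundary_vertex hM hB (hW.exists_isOutside hM hB hg)]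
    push_cast
    omega
  · obtain rfl : g = 1 := by omega
    have h5 := hW.card_link_vertex_one hM hB
    have : IsEmpty T'.boundary.Vertex := by
      refine ⟨fun v => ?_⟩
      obtain ⟨p, -⟩ := Quot.exists_rep v
      have := Finset.card_pos.2 ⟨_, p.2⟩
      omega
    rw [Nat.card_of_isEmpty]
    push_cast
    omega

/-- The surface has `g + 1` vertices, `3g - 3` edges and `2g - 2` triangles. It is embedded along
edges because two boundary sides on one edge of `T'` are glued in the boundary. -/
theorem hasPinchedSphereBoundary (hW : IsWedgeFolding T T' P c) (hM : T.IsOneVertexManifold g)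
    (hB : IsIsolatedFillingBouquet T P) (hg : 2 ≤ g) : T'.HasPinchedSphereBoundary := by
  have hT := hM.isTriangulation
  have hT' := hW.isTriangulation
  have hout := hW.exists_isOutside hM hB hg
  have hE := hW.edgesValid hM hB hout
  have ho := hW.isOrientable hT hB.diagonal hM.orientable
  have hS := boundary_isTriangulation hT' hE ho
  have hV := hW.card_boundary_vertex hM hB hout
  have hc := boundary_isClosed hT'
  refine
    { oneVertex := hW.oneVertex hT hB.diagonal hM.oneVertex
      edgesValid := hE
      sphere := ⟨⟨hS, hW.boundary_isConnected hM hB hout, boundary_isOrientable ho, ?_⟩, hc⟩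
      edges_injective := ?_
      two_le_circles := ?_
      sheets := fun p q x y h1 h2 h3 h4 => vertexOf_eq_iff_circleOf_eq hT' ⟨h1, h2⟩ ⟨h3, h4⟩ }
  · have h1 := two_mul_card_facet hS
    have h2 := hW.card_boundary_cells hM hB
    have := hc.isEmpty_freeSide
    rw [Nat.card_of_isEmpty (α := T'.boundary.FreeSide)] at h1
    rw [hc.card_boundaryCircle, eulerChar, hV]
    push_cast
    omega
  · rintro ⟨⟨f, a, b⟩, hp⟩ ⟨⟨f', a', b'⟩, hq⟩ h
    replace h : T'.SameEdge (sideEdge f a b) (sideEdge f' a' b') := (edgeOf_eq_iff hT').1 h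
    rcases eq_or_boundary_glue_of_sameEdge hT' hp.1 hq.1 hp.2 hq.2 h with
      ⟨rfl, rfl, rfl⟩ | ⟨s, π, hsa, hsb, hg, ha, hb⟩
    · rfl
    · exact Quot.sound ⟨s, π, hsa, hsb, hg, ha.symm, hb.symm⟩
  · rw [card_link_boundaryCircle hT', hV]
    omega

end IsWedgeFolding

theorem mainTheorem5 :
    ∃ C : ℕ, ∀ (g : ℕ) (T : GluingData 3 ℕ) (P : Fin g → EdgeRef),
      T.IsOneVertexManifold g → IsIsolatedFillingBouquet T P →
      ∃ (T' : GluingData 3 ℕ) (steps : ℕ),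
        Routine.wedgeFolder (List.ofFn P) T = some ((), T', steps) ∧
        steps ≤ C * g ∧
        T.cells ⊆ T'.cells ∧ T'.cells.card = T.cells.card + g ∧
        T'.IsTriangulation ∧ T'.OneVertex ∧
        T'.link.IsSurfaceOfGenus 0 ∧
        (2 ≤ g → T'.HasPinchedSphereBoundary) ∧
        (g = 1 → T'.boundary.cells = ∅) := by
  -- The run takes `6 * g + 2` steps, which is at most `8 * g` because `g` is positive.
  refine ⟨8, fun g T P hM hB => ?_⟩
  obtain ⟨T', c, hrun, hW⟩ := Routine.wedgeFolder_run hM.isTriangulation hB.diagonal hB.disjoint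
  refine ⟨T', 6 * g + 2, hrun, ?_, ?_, hW.card_cells, hW.isTriangulation,
    hW.oneVertex hM.isTriangulation hB.diagonal hM.oneVertex, hW.link_isSurfaceOfGenus_zero hM hB,
    hW.hasPinchedSphereBoundary hM hB, ?_⟩
  · have := hM.card_boundary_cells
    omega
  · exact fun t ht => (hW.mem_cells t).2 (Or.inl ht)
  · rintro rfl
    exact hW.boundary_cells_eq_empty hM hB
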